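/- Let $\gamma\subset\mathbb C$ be a piecewise regular Jordan curve (a simple closed curve that is a concatenation of finitely many $C^\infty$ immersed arcs, smooth up to their end points). Let $D\subset\mathbb C$ be the bounded component of $\mathbb C\setminus\gamma$ and let $D^*\ni\infty$ be the unbounded one together with $\infty$. Let $d=\sum_{j=1}^m a_j z_j$ with weights $a_j>0$ and source points $z_j\in D$, and let $d^*=1\cdot\infty$. Write $G_{D,d}=\sum_j a_jG_{D,z_j}$ and $G_{D^*,d^*}=G_{D^*,\infty}$, where $G_{\Omega,w}$ is the Green's function of $\Omega$ with zero boundary values and singularity $\log|z-w|^{-1}$ at $w$ ($\log|z|$ if $w=\infty$). Suppose that $\gamma$ is stationary with divisors $d,d^*$, that is, $\nabla G_{D,d}(p)+\nabla G_{D^*,d^*}(p)=0$ at every regular point $p$ of $\gamma$, where the gradients are non-tangential limits taken from $D$ and from $D^*$. Let $f:\mathbb D\to D$ and $g:\{|z|>1\}\cup\{\infty\}\to D^*$ be conformal bijections with $g(\infty)=\infty$, and let $h=g^{-1}\circ f|_{S^1}:S^1\to S^1$ be the corresponding conformal welding homeomorphism of $\gamma$ ($f$ and $g$ being extended continuously to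 $S^1$). Put $x_j=f^{-1}(z_j)\in\mathbb D$. Then \[ h(z)=\lambda\prod_{j=1}^m\left(\frac{z-x_j}{1-\overline{x_j}\,z}\right)^{a_j},\qquad |z|=1, \] for some constant $\lambda$ with $|\lambda|=1$, where the powers are taken along continuous branches of the logarithm on the circle: for each $j$ there is a continuous $L_j:\mathbb R\to\mathbb C$ with $e^{L_j(\theta)}=(e^{i\theta}-x_j)/(1-\overline{x_j}e^{i\theta})$ for all $\theta\in\mathbb R$, and for every choice of such $L_1,\dots,L_m$ there is a $\lambda$ with $|\lambda|=1$ such that $h(e^{i\theta})=\lambda\prod_{j=1}^m e^{a_jL_j(\theta)}$ for all $\theta\in\mathbb R$. -/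

import Mathlib

open Set Filter Topology

namespace HeleShaw

/-- `γ : ℝ → ℂ` is a `1`-periodic parametrization of a piecewise regular Jordan curve in `ℂ`:
it is continuous, injective on a period, and a period is cut into finitely many closed intervals
on each of which `γ` is a smooth immersion (up to and including the end points). -/
structure IsPiecewiseRegularJordan (γ : ℝ → ℂ) : Prop where
  continuous : Continuous γ
  periodic : Function.Periodic γ 1
  injOn : InjOn γ (Ico 0 1)
  pieces : ∃ (n : ℕ) (t : Fin (n + 1) → ℝ), StrictMono t ∧ t 0 = 0 ∧ t (Fin.last n) = 1 ∧
    ∀ i : Fin n, ContDiffOn ℝ (⊤ : ℕ∞) γ (Icc (t i.castSucc) (t i.succ)) ∧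
      ∀ s ∈ Icc (t i.castSucc) (t i.succ),
        derivWithin γ (Icc (t i.castSucc) (t i.succ)) s ≠ 0

/-- `γ t` is a regular point of the curve: near `t` the curve is a smooth immersion. -/
def IsRegularParam (γ : ℝ → ℂ) (t : ℝ) : Prop :=
  ContDiffAt ℝ (⊤ : ℕ∞) γ t ∧ deriv γ t ≠ 0

/-- The inner domain `D` of the Jordan curve `γ`: the bounded component of `ℂ ∖ γ`. -/
def inner (γ : ℝ → ℂ) : Set ℂ :=
  {z | z ∈ (range γ)ᶜ ∧ Bornology.IsBounded (connectedComponentIn (range γ)ᶜ z)}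

/-- The finite part of the outer domain `D* ∋ ∞` of the Jordan curve `γ`: the unbounded component
of `ℂ ∖ γ`. The domain `D*` of the Riemann sphere is this set together with `∞`. -/
def outer (γ : ℝ → ℂ) : Set ℂ :=
  {z | z ∈ (range γ)ᶜ ∧ ¬ Bornology.IsBounded (connectedComponentIn (range γ)ᶜ z)}

/-- The inner domain as a subset of the Riemann sphere `ℂ ∪ {∞}`. -/
def innerSphere (γ : ℝ → ℂ) : Set (OnePoint ℂ) := (fun z : ℂ => (z : OnePoint ℂ)) '' inner γ

/-- The outer domain, including the point `∞`, as a subset of the Riemann sphere. -/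
def outerSphere (γ : ℝ → ℂ) : Set (OnePoint ℂ) :=
  insert OnePoint.infty ((fun z : ℂ => (z : OnePoint ℂ)) '' outer γ)

/-- `G` has the singularity in `E` of a Green's function with pole `w` and is harmonic elsewhere.
For finite `w`, `G = log (1 / |z - w|) + H` with `H` harmonic in `E`, and `G` stays harmonic at `∞`
if `∞` is an interior point (a harmonic function with a limit at an isolated boundary point has a
removable singularity there; the condition is empty for bounded `E`). For `w = ∞`, `G` is harmonic
in `E` and `G - log |z|` has a limit at `∞`. -/
def HasGreenSingularity (E : Set ℂ) (w : OnePoint ℂ) (G : ℂ → ℝ) : Prop :=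
  (∀ p : ℂ, w = (p : OnePoint ℂ) →
    (∃ H : ℂ → ℝ, InnerProductSpace.HarmonicOnNhd H E ∧
      ∀ z ∈ E, z ≠ p → G z = Real.log (‖z - p‖⁻¹) + H z) ∧
    ∃ c : ℝ, Tendsto G (Bornology.cobounded ℂ ⊓ 𝓟 E) (𝓝 c)) ∧
  (w = OnePoint.infty →
    InnerProductSpace.HarmonicOnNhd G E ∧
      ∃ c : ℝ, Tendsto (fun z => G z - Real.log ‖z‖) (Bornology.cobounded ℂ ⊓ 𝓟 E) (𝓝 c))

/-- `G` is the Green's function with Dirichlet boundary values and pole `w` of a domain of the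
Riemann sphere whose boundary lies in `ℂ`; `E` is the finite part of the domain. -/
def IsGreenFunction (E : Set ℂ) (w : OnePoint ℂ) (G : ℂ → ℝ) : Prop :=
  HasGreenSingularity E w G ∧ ∀ p ∈ frontier E, Tendsto G (𝓝[E] p) (𝓝 0)

/-- The Green's function `G_{D,w}`; it is unique on `E ∖ {w}`. -/
noncomputable def greenFunction (E : Set ℂ) (w : OnePoint ℂ) : ℂ → ℝ :=
  Classical.epsilon (IsGreenFunction E w)

/-- The potential `G_{D,d} = ∑ a_j G_{D,z_j}` of a divisor `d = ∑ a_j z_j`. -/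
noncomputable def greenPotential (E : Set ℂ) (d : OnePoint ℂ →₀ ℝ) (z : ℂ) : ℝ :=
  d.sum fun w a => a * greenFunction E w z

/-- The gradient of `u : E → ℝ` has the non-tangential limit `v` at the boundary point `p`. -/
def HasNontangentialGradient (E : Set ℂ) (u : ℂ → ℝ) (p v : ℂ) : Prop :=
  ∀ M : ℝ, Tendsto (fun z => gradient u z)
    (𝓝[{z | z ∈ E ∧ dist z p ≤ M * Metric.infDist z (frontier E)}] p) (𝓝 v)

/-- The curve `γ` is a stationary Jordan curve with source divisors `d` (in the inner domain) and
`d'` (in the outer domain of the sphere): the configuration is admissible with positive source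
strengths and the vector field `V = -(∇G_{D,d} + ∇G_{D*,d'})` vanishes at every regular point of
the curve. -/
structure IsStationaryJordan (γ : ℝ → ℂ) (d d' : OnePoint ℂ →₀ ℝ) : Prop where
  curve : IsPiecewiseRegularJordan γ
  pos : ∀ w ∈ d.support, 0 < d w
  pos' : ∀ w ∈ d'.support, 0 < d' w
  supp : ↑d.support ⊆ innerSphere γ
  supp' : ↑d'.support ⊆ outerSphere γ
  velocity : ∀ t : ℝ, IsRegularParam γ t → ∃ v v' : ℂ,
    HasNontangentialGradient (inner γ) (greenPotential (inner γ) d) (γ t) v ∧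
    HasNontangentialGradient (outer γ) (greenPotential (outer γ) d') (γ t) v' ∧
    -(v + v') = 0

/-- A conformal map of the open unit disc onto the inner domain. -/
def IsInnerConformal (γ : ℝ → ℂ) (f : ℂ → ℂ) : Prop :=
  DifferentiableOn ℂ f (Metric.ball 0 1) ∧ BijOn f (Metric.ball 0 1) (inner γ)

/-- A conformal map of `{|z| > 1} ∪ {∞}` onto the outer domain of the sphere that fixes `∞`. -/
def IsOuterConformal (γ : ℝ → ℂ) (g : ℂ → ℂ) : Prop :=
  DifferentiableOn ℂ g {z | 1 < ‖z‖} ∧ BijOn g {z | 1 < ‖z‖} (outer γ) ∧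
    Tendsto g (Bornology.cobounded ℂ) (Bornology.cobounded ℂ)

/-- `h = g⁻¹ ∘ f` on the unit circle, with `f` and `g` extended continuously to the circle from
the disc and from the exterior of the disc respectively. -/
def IsWelding (f g : ℂ → ℂ) (h : Circle ≃ₜ Circle) : Prop :=
  ∀ z : Circle, extendFrom {w : ℂ | 1 < ‖w‖} g (h z) = extendFrom (Metric.ball 0 1) f z

/-- `L` is a continuous branch of `θ ↦ log ((z - x) / (1 - x̄ z))`, `z = exp (i θ)`. -/
def IsLogBranch (x : ℂ) (L : ℝ → ℂ) : Prop :=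
  Continuous L ∧ ∀ θ : ℝ, Complex.exp (L θ) =
    ((Circle.exp θ : ℂ) - x) / (1 - (starRingEnd ℂ) x * (Circle.exp θ : ℂ))

end HeleShaw

/-! Let u be the potential of d in D, minus the Green's function in D*, and 0 on γ. It is continuous
across γ, and stationarity says that its gradient has the same boundary values from both sides, so u
is harmonic across regular points (`harmonicAt_of_isRegularParam`). Adding P(w) = Σ a_j log|w - z_j|
cancels the poles, and the finitely many corners are removable because the sum is continuous there.
What remains is harmonic in the whole plane and differs from (Σ a_j - 1) log|z| by a bounded amount
near ∞. Liouville's theorem gives Σ a_j = 1 and makes it a constant c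
(`IsStationaryJordan.exists_const`).

Pulled back by the conformal maps, with b_j the Blaschke factor of x_j, this reads Σ a_j log|f -
z_j| = c + Σ a_j log|b_j| in the disc and Σ a_j log|g - z_j| = c + log|w| outside. Hence the
branches of ∏ ((f - z_j)/b_j)^{a_j} and of w⁻¹ ∏ (g - z_j)^{a_j} are constant. On the circle g(h) =
f, so dividing the two relations cancels the factors f - z_j and leaves h as a constant times ∏
b_j^{a_j} (`eventually_sum_sub_eq_log`, `eq_mul_prod_exp_of_eventually`).

Harmonicity across a smooth arc rests on three facts. A logarithmic barrier bounds u by the distance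
to the arc, so its gradient is bounded up to the arc. The holomorphic completions on the two sides
are therefore Lipschitz, and their boundary values are primitives of the same function along the
arc. Painlevé's theorem glues them. Charts turn the tangent to the direction 1 + i: the arc is then
an increasing graph, met at most once by every horizontal and vertical line, and the quadrant up and
to the left of a point above it stays above it.

The boundary values of f and g come from the relations themselves: the logarithmic derivative shows
that R(F) F' is bounded near the circle, where R(p) = Σ a_j / (p - z_j) has finitely many zeros, and
this forces limits (`exists_tendsto_of_norm_deriv_le`). Neither Carathéodory's theorem nor the
Jordan curve theorem is needed; openness of the two domains and connectedness of the inner one come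
from the conformal maps. -/

namespace HeleShaw

open InnerProductSpace

/-! ### Injective holomorphic maps -/

/-- At a critical point f - f(z) is the n-th power, n ≥ 2, of a local coordinate up to a constant
factor. Two small points whose coordinates differ by an n-th root of unity then have the same image.
-/
theorem deriv_ne_zero_of_injOn {f : ℂ → ℂ} {U : Set ℂ} (hU : IsOpen U)
    (hf : DifferentiableOn ℂ f U) (hinj : InjOn f U) {z : ℂ} (hz : z ∈ U) : deriv f z ≠ 0 := by
  intro hd
  have han : AnalyticAt ℂ f z := hf.analyticAt (hU.mem_nhds hz)
  have hF : AnalyticAt ℂ (fun w => f w - f z) z := han.sub analyticAt_const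
  have hne : ¬ ∀ᶠ w in 𝓝 z, f w - f z = 0 := by
    intro h
    have h2 : ∀ᶠ w in 𝓝[≠] z, w = z := by
      filter_upwards [nhdsWithin_le_nhds h, nhdsWithin_le_nhds (hU.mem_nhds hz)] with w h1 h2
      exact hinj h2 hz (sub_eq_zero.mp h1)
    obtain ⟨w, h1, h2⟩ := (h2.and self_mem_nhdsWithin).exists
    exact h2 h1
  obtain ⟨n, g, hg, hg0, heq⟩ := hF.exists_eventuallyEq_pow_smul_nonzero_iff.mpr hne
  have hn0 : n ≠ 0 := by
    rintro rfl
    have := heq.self_of_nhds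
    simp at this
    exact hg0 this.symm
  have hn1 : n ≠ 1 := by
    rintro rfl
    have h1 : HasDerivAt (fun w => (w - z) ^ 1 • g w) (g z) z := by
      have := ((hasDerivAt_id z).sub_const z).fun_mul hg.differentiableAt.hasDerivAt
      simpa [smul_eq_mul] using this
    have h2 : HasDerivAt (fun w => f w - f z) (g z) z := h1.congr_of_eventuallyEq heq
    have h3 := (h2.add_const (f z)).deriv
    simp at h3
    exact hg0 (h3 ▸ hd)
  -- An n-th root of g / g(z), equal to 1 at z; dividing by g(z) first puts the argument of the
  -- logarithm near 1.
  set r : ℂ → ℂ := fun w => Complex.exp (Complex.log (g w / g z) / n) with hr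
  have hslit : ∀ᶠ w in 𝓝 z, g w / g z ∈ Complex.slitPlane := by
    apply (hg.continuousAt.div_const (g z)).eventually_mem
    rw [div_self hg0]
    exact Complex.isOpen_slitPlane.mem_nhds Complex.one_mem_slitPlane
  have hnC : (n : ℂ) ≠ 0 := by exact_mod_cast hn0
  have hrn : ∀ᶠ w in 𝓝 z, g w = g z * r w ^ n := by
    filter_upwards [hslit] with w hw
    rw [hr, ← Complex.exp_nat_mul, mul_div_cancel₀ _ hnC,
      Complex.exp_log (Complex.slitPlane_ne_zero hw), mul_div_cancel₀ _ hg0]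
  have hran : AnalyticAt ℂ r z := by
    have h1 : AnalyticAt ℂ (fun w => g w / g z) z := hg.div_const
    exact ((h1.clog hslit.self_of_nhds).div_const).cexp
  have hψ : HasStrictDerivAt (fun w => (w - z) * r w) 1 z := by
    have h1 : HasStrictDerivAt (fun w => w - z) 1 z := (hasStrictDerivAt_id z).sub_const z
    have := h1.fun_mul hran.hasStrictDerivAt
    simpa [hr, div_self hg0] using this
  have hmap := hψ.map_nhds_eq one_ne_zero
  set S : Set ℂ := {w | w ∈ U ∧ f w - f z = g z * ((w - z) * r w) ^ n} with hS
  have hSn : S ∈ 𝓝 z := by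
    filter_upwards [hU.mem_nhds hz, heq, hrn] with w h1 h2 h3
    refine ⟨h1, ?_⟩
    rw [h2, h3, smul_eq_mul, mul_pow]; ring
  have hT : (fun w => (w - z) * r w) '' S ∈ 𝓝 (0 : ℂ) := by
    have := image_mem_map (m := fun w => (w - z) * r w) hSn
    rw [hmap] at this
    simpa using this
  set ξ : ℂ := Complex.exp (2 * Real.pi * Complex.I / n)
  have hξ : IsPrimitiveRoot ξ n := Complex.isPrimitiveRoot_exp n hn0
  have hξ1 : ξ ≠ 1 := hξ.ne_one (by omega)
  have hT2 : ∀ᶠ η in 𝓝 (0 : ℂ), ξ * η ∈ (fun w => (w - z) * r w) '' S := by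
    have : Tendsto (fun η : ℂ => ξ * η) (𝓝 0) (𝓝 0) := by
      simpa using (continuous_const_mul ξ).tendsto 0
    exact this hT
  -- Both η ≠ 0 and ξη are values of the coordinate (w - z) r(w) at points of S, and f takes the
  -- same value at these points.
  obtain ⟨η, ⟨h1, h2⟩, h3⟩ := (((Filter.Eventually.and hT hT2).filter_mono
    (nhdsWithin_le_nhds (s := {0}ᶜ))).and self_mem_nhdsWithin).exists
  obtain ⟨a, ha, hae⟩ := h1
  obtain ⟨b, hb, hbe⟩ := h2
  have hab : a = b := by
    apply hinj ha.1 hb.1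
    have e1 := ha.2
    have e2 := hb.2
    simp only at hae hbe
    rw [hae] at e1
    rw [hbe, mul_pow, hξ.pow_eq_one, one_mul] at e2
    exact sub_left_inj.mp (e1.trans e2.symm)
  subst hab
  have h4 : ξ * η = η := hbe.symm.trans hae
  exact hξ1 (mul_right_cancel₀ (h3 : η ≠ 0) (h4.trans (one_mul η).symm))

theorem image_mem_nhds_of_injOn {f : ℂ → ℂ} {U : Set ℂ} (hU : IsOpen U)
    (hf : DifferentiableOn ℂ f U) (hinj : InjOn f U) {z : ℂ} (hz : z ∈ U) {s : Set ℂ}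
    (hs : s ∈ 𝓝 z) : f '' s ∈ 𝓝 (f z) := by
  have han : AnalyticAt ℂ f z := hf.analyticAt (hU.mem_nhds hz)
  have := han.hasStrictDerivAt.map_nhds_eq (deriv_ne_zero_of_injOn hU hf hinj hz)
  rw [← this]
  exact image_mem_map hs

theorem isOpen_image_of_injOn {f : ℂ → ℂ} {U : Set ℂ} (hU : IsOpen U)
    (hf : DifferentiableOn ℂ f U) (hinj : InjOn f U) : IsOpen (f '' U) := by
  rw [isOpen_iff_mem_nhds]
  rintro _ ⟨z, hz, rfl⟩
  exact image_mem_nhds_of_injOn hU hf hinj hz (hU.mem_nhds hz)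

theorem analyticAt_leftInverse {f k : ℂ → ℂ} {U : Set ℂ} (hU : IsOpen U)
    (hf : DifferentiableOn ℂ f U) (hinj : InjOn f U) (hk : ∀ w ∈ U, k (f w) = w) {z : ℂ}
    (hz : z ∈ U) : AnalyticAt ℂ k (f z) := by
  have hd : DifferentiableOn ℂ k (f '' U) := by
    rintro _ ⟨w, hw, rfl⟩
    have han : AnalyticAt ℂ f w := hf.analyticAt (hU.mem_nhds hw)
    have := han.hasStrictDerivAt.to_local_left_inverse (deriv_ne_zero_of_injOn hU hf hinj hw)
      (g := k) (by filter_upwards [hU.mem_nhds hw] with x hx using hk x hx)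
    exact this.hasDerivAt.differentiableAt.differentiableWithinAt
  exact hd.analyticAt ((isOpen_image_of_injOn hU hf hinj).mem_nhds (mem_image_of_mem f hz))

/-! ### Harmonic functions -/

/-- The complex derivative `u_x - i u_y` of a real function. -/
noncomputable def dz (u : ℂ → ℝ) (z : ℂ) : ℂ := fderiv ℝ u z 1 - Complex.I * fderiv ℝ u z Complex.I

/-- Links the gradient of the velocity condition to `dz u`, which is holomorphic wherever u is
harmonic. -/
theorem star_gradient (u : ℂ → ℝ) (z : ℂ) : (starRingEnd ℂ) (gradient u z) = dz u z := by
  have h : ∀ w, fderiv ℝ u z w = Inner.inner ℝ (gradient u z) w := by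
    intro w
    simp [gradient]
  unfold dz
  rw [h, h]
  generalize gradient u z = g
  apply Complex.ext <;> simp [Complex.inner]

theorem dz_congr {u v : ℂ → ℝ} {z : ℂ} (h : u =ᶠ[𝓝 z] v) : dz u z = dz v z := by
  unfold dz; rw [h.fderiv_eq]

theorem dz_re {F : ℂ → ℂ} {F' z : ℂ} (h : HasDerivAt F F' z) :
    dz (fun w => (F w).re) z = F' := by
  have h1 := (Complex.reCLM.hasFDerivAt (x := F z)).comp z (h.hasFDerivAt.restrictScalars ℝ)
  have h2 : fderiv ℝ (fun w => (F w).re) z = _ := h1.fderiv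
  unfold dz
  rw [h2]
  apply Complex.ext <;> simp

theorem dz_of_eventuallyEq_re {u : ℂ → ℝ} {F : ℂ → ℂ} {F' z : ℂ} (h : HasDerivAt F F' z)
    (hu : ∀ᶠ w in 𝓝 z, u w = (F w).re) : dz u z = F' :=
  (dz_congr hu).trans (dz_re h)

/-- Interior gradient estimate. The completion F has Re (F - F(c)) ≤ 2M, so Borel–Carathéodory
bounds |F - F(c)| by 4M on the circle of radius r/2, and Cauchy's estimate there gives 8M/r. Only
the deviation from an arbitrary constant `a` enters. -/
theorem norm_dz_le {u : ℂ → ℝ} {c : ℂ} {r M : ℝ} (hr : 0 < r) (hM : 0 < M)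
    (hu : HarmonicOnNhd u (Metric.ball c r)) (a : ℝ) (hb : ∀ z ∈ Metric.ball c r, |u z - a| ≤ M) :
    ‖dz u c‖ ≤ 8 * M / r := by
  obtain ⟨F, hF, hFe⟩ := hu.exists_analyticOnNhd_ball_re_eq
  have hcb : c ∈ Metric.ball c r := Metric.mem_ball_self hr
  have hd : dz u c = deriv F c := by
    apply dz_of_eventuallyEq_re (hF c hcb).differentiableAt.hasDerivAt
    filter_upwards [Metric.ball_mem_nhds c hr] with w hw using (hFe hw).symm
  have hmem : ∀ z ∈ Metric.ball (0 : ℂ) r, c + z ∈ Metric.ball c r := by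
    intro z hz; simpa using hz
  have hGd : DifferentiableOn ℂ (fun z => F (c + z) - F c) (Metric.ball 0 r) := by
    intro z hz
    have := (hF (c + z) (hmem z hz)).differentiableAt
    apply DifferentiableAt.differentiableWithinAt
    apply DifferentiableAt.sub_const
    exact DifferentiableAt.comp z (f := fun z => c + z) this (by fun_prop)
  have hG : ∀ z ∈ Metric.ball (0 : ℂ) r, ‖F (c + z) - F c‖ ≤ 2 * (2 * M) * ‖z‖ / (r - ‖z‖) := by
    intro z hz
    refine Complex.borelCaratheodory_zero (f := fun z => F (c + z) - F c) (R := r) (by linarith)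
      hGd ?_ hr hz (by simp)
    intro w hw
    have e1 := hFe (hmem w hw)
    have e2 := hFe hcb
    simp only at e1 e2
    simp only [mem_ofPred_eq, Complex.sub_re, e1, e2]
    have h1 := abs_le.mp (hb _ (hmem w hw))
    have h2 := abs_le.mp (hb _ hcb)
    linarith [h1.1, h1.2, h2.1, h2.2]
  have hdG : deriv (fun z => F (c + z) - F c) 0 = deriv F c := by
    rw [deriv_sub_const, deriv_comp_const_add, add_zero]
  rw [hd, ← hdG]
  have h8 : 8 * M / r = (4 * M) / (r / 2) := by field_simp; ring
  rw [h8]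
  apply Complex.norm_deriv_le_of_forall_mem_sphere_norm_le (by linarith)
  · apply DifferentiableOn.diffContOnCl
    rw [closure_ball _ (by linarith : r / 2 ≠ 0)]
    exact hGd.mono (Metric.closedBall_subset_ball (by linarith))
  · intro z hz
    have hz' : ‖z‖ = r / 2 := by simpa using hz
    have := hG z (by simp [hz']; linarith)
    rw [hz'] at this
    refine this.trans (le_of_eq ?_)
    have : r - r / 2 = r / 2 := by ring
    rw [this]
    field_simp
    norm_num

/-- The primitive is the integral along the segment from c, differentiated under the integral sign.
A compact thickening of the segment inside U supplies the dominating constant. -/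
theorem exists_hasDerivAt_of_starConvex {U : Set ℂ} (hU : IsOpen U) {c : ℂ}
    (hs : StarConvex ℝ c U) {Q : ℂ → ℂ} (hQ : DifferentiableOn ℂ Q U) :
    ∃ w : ℂ → ℂ, ∀ z ∈ U, HasDerivAt w (Q z) z := by
  refine ⟨fun z => ∫ s in (0 : ℝ)..1, (z - c) * Q (c + s * (z - c)), fun z hz => ?_⟩
  have hseg : ∀ x ∈ U, ∀ s ∈ Icc (0 : ℝ) 1, c + s * (x - c) ∈ U := by
    intro x hx s hs'
    have := hs hx (a := 1 - s) (b := s) (by linarith [hs'.2]) hs'.1 (by ring)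
    convert this using 1
    simp; ring
  have hQa : AnalyticOnNhd ℂ Q U := hQ.analyticOnNhd hU
  have hQ' : ContinuousOn (deriv Q) U := fun x hx => (hQa x hx).deriv.continuousAt.continuousWithinAt
  set S : Set ℂ := (fun s : ℝ => c + s * (z - c)) '' Icc 0 1 with hS
  have hSc : IsCompact S := isCompact_Icc.image (by fun_prop)
  have hSU : S ⊆ U := by rintro _ ⟨s, hs', rfl⟩; exact hseg z hz s hs'
  obtain ⟨δ, hδ, hδU⟩ := hSc.exists_cthickening_subset_open hU hSU
  have hTc : IsCompact (Metric.cthickening δ S) := hSc.cthickening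
  obtain ⟨B₁, hB₁⟩ := hTc.exists_bound_of_continuousOn (hQ'.mono hδU)
  obtain ⟨B₀, hB₀⟩ := hTc.exists_bound_of_continuousOn (hQ.continuousOn.mono hδU)
  have hnear : ∀ x ∈ Metric.ball z δ, ∀ s ∈ Icc (0 : ℝ) 1,
      c + s * (x - c) ∈ Metric.cthickening δ S := by
    intro x hx s hs'
    refine Metric.mem_cthickening_of_dist_le _ (c + s * (z - c)) _ _ ⟨s, hs', rfl⟩ ?_
    rw [dist_eq_norm]
    have : c + s * (x - c) - (c + s * (z - c)) = s * (x - z) := by ring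
    rw [this, norm_mul, Complex.norm_real, Real.norm_eq_abs, abs_of_nonneg hs'.1]
    rw [Metric.mem_ball, dist_eq_norm] at hx
    nlinarith [norm_nonneg (x - z), hs'.1, hs'.2]
  have hcont : ∀ x ∈ Metric.ball z δ, ContinuousOn (fun s : ℝ => c + s * (x - c)) (Icc 0 1) := by
    intro x _; fun_prop
  have key := intervalIntegral.hasDerivAt_integral_of_dominated_loc_of_deriv_le
    (F := fun (x : ℂ) (s : ℝ) => (x - c) * Q (c + s * (x - c)))
    (F' := fun (x : ℂ) (s : ℝ) => Q (c + s * (x - c)) + (x - c) * (deriv Q (c + s * (x - c)) * s))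
    (μ := MeasureTheory.volume) (a := 0) (b := 1) (x₀ := z) (s := Metric.ball z δ)
    (bound := fun _ => B₀ + (‖z - c‖ + δ) * B₁) (Metric.ball_mem_nhds z hδ)
    ?_ ?_ ?_ ?_ ?_ ?_
  · have h2 := key.2
    have h3 : (∫ s in (0 : ℝ)..1, (Q (c + s * (z - c)) + (z - c) * (deriv Q (c + s * (z - c)) * s)))
        = Q z := by
      -- The differentiated integrand is d/ds of s Q(c + s(z - c)), so it integrates to Q(z).
      have := intervalIntegral.integral_eq_sub_of_hasDerivAt (a := 0) (b := 1)
        (f := fun s : ℝ => s * Q (c + s * (z - c)))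
        (f' := fun s : ℝ => Q (c + s * (z - c)) + (z - c) * (deriv Q (c + s * (z - c)) * s)) ?_ ?_
      · rw [this]; simp
      · intro s hs'
        rw [uIcc_of_le zero_le_one] at hs'
        have e1 : HasDerivAt Q (deriv Q (c + s * (z - c))) (c + s * (z - c)) :=
          (hQa _ (hseg z hz s hs')).differentiableAt.hasDerivAt
        have e2 : HasDerivAt (fun s : ℝ => c + (s : ℂ) * (z - c)) (z - c) s := by
          simpa using (Complex.ofRealCLM.hasDerivAt.mul_const (z - c)).const_add c
        have e3 : HasDerivAt (fun s : ℝ => Q (c + s * (z - c))) _ s :=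
          HasDerivAt.comp s e1 e2
        have e4 := (Complex.ofRealCLM.hasDerivAt (x := s)).fun_mul e3
        refine e4.congr_deriv ?_
        simp only [Complex.ofRealCLM_apply, Complex.ofReal_one]
        ring
      · apply ContinuousOn.intervalIntegrable
        rw [uIcc_of_le zero_le_one]
        have hm : MapsTo (fun s : ℝ => c + (s : ℂ) * (z - c)) (Icc 0 1) U := hseg z hz
        exact ((hQ.continuousOn.comp (by fun_prop) hm)).add
          (continuousOn_const.mul ((hQ'.comp (by fun_prop) hm).mul (by fun_prop)))
    rwa [h3] at h2
  · filter_upwards [Metric.ball_mem_nhds z hδ] with x hx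
    have hm : MapsTo (fun s : ℝ => c + (s : ℂ) * (x - c)) (Ioc 0 1) U :=
      fun s hs' => hδU (hnear x hx s (Ioc_subset_Icc_self hs'))
    rw [uIoc_of_le zero_le_one]
    exact (continuousOn_const.mul (hQ.continuousOn.comp (by fun_prop) hm)).aestronglyMeasurable
      measurableSet_Ioc
  · apply ContinuousOn.intervalIntegrable
    rw [uIcc_of_le zero_le_one]
    have hm : MapsTo (fun s : ℝ => c + (s : ℂ) * (z - c)) (Icc 0 1) U := hseg z hz
    exact continuousOn_const.mul (hQ.continuousOn.comp (by fun_prop) hm)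
  · have hm : MapsTo (fun s : ℝ => c + (s : ℂ) * (z - c)) (Ioc 0 1) U :=
      fun s hs' => hseg z hz s (Ioc_subset_Icc_self hs')
    rw [uIoc_of_le zero_le_one]
    exact ((hQ.continuousOn.comp (by fun_prop) hm).add
      (continuousOn_const.mul ((hQ'.comp (by fun_prop) hm).mul
        (by fun_prop)))).aestronglyMeasurable measurableSet_Ioc
  · filter_upwards with s hs' x hx
    rw [uIoc_of_le zero_le_one] at hs'
    have hmem := hnear x hx s (Ioc_subset_Icc_self hs')
    have h0 := hB₀ _ hmem
    have h1 := hB₁ _ hmem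
    have hx' : ‖x - c‖ ≤ ‖z - c‖ + δ := by
      rw [Metric.mem_ball, dist_eq_norm] at hx
      have : x - c = (z - c) + (x - z) := by ring
      rw [this]
      exact (norm_add_le _ _).trans (by linarith)
    refine (norm_add_le _ _).trans (add_le_add h0 ?_)
    rw [norm_mul, norm_mul, Complex.norm_real, Real.norm_eq_abs, abs_of_pos hs'.1]
    have hB1 : 0 ≤ B₁ := (norm_nonneg _).trans h1
    have : ‖deriv Q (c + s * (x - c))‖ * s ≤ B₁ := by
      nlinarith [norm_nonneg (deriv Q (c + s * (x - c))), hs'.1, hs'.2]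
    exact mul_le_mul hx' this (mul_nonneg (norm_nonneg _) hs'.1.le) (by positivity)
  · exact intervalIntegrable_const
  · filter_upwards with s hs' x hx
    rw [uIoc_of_le zero_le_one] at hs'
    have hmem := hδU (hnear x hx s (Ioc_subset_Icc_self hs'))
    have e1 : HasDerivAt Q (deriv Q (c + s * (x - c))) (c + s * (x - c)) :=
      (hQa _ hmem).differentiableAt.hasDerivAt
    have e2 : HasDerivAt (fun x : ℂ => c + (s : ℂ) * (x - c)) s x := by
      simpa using (((hasDerivAt_id x).sub_const c).const_mul (s : ℂ)).const_add c
    have e3 : HasDerivAt (fun x : ℂ => Q (c + s * (x - c))) _ x := HasDerivAt.comp x e1 e2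
    have e4 := ((hasDerivAt_id x).sub_const c).fun_mul e3
    simpa using e4

/-- A harmonic function on a star-convex open set is the real part of a holomorphic function. -/
theorem exists_hasDerivAt_dz_re_eq {U : Set ℂ} (hU : IsOpen U) {c : ℂ} (hc : c ∈ U)
    (hs : StarConvex ℝ c U) {u : ℂ → ℝ} (hu : HarmonicOnNhd u U) :
    ∃ w : ℂ → ℂ, (∀ z ∈ U, HasDerivAt w (dz u z) z) ∧ ∀ z ∈ U, (w z).re = u z := by
  have hQ : DifferentiableOn ℂ (dz u) U := fun x hx =>
    (HarmonicAt.differentiableAt_complex_partial (hu x hx)).differentiableWithinAt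
  obtain ⟨w₀, hw₀⟩ := exists_hasDerivAt_of_starConvex hU hs hQ
  refine ⟨fun z => w₀ z - w₀ c + u c, fun z hz => ((hw₀ z hz).sub_const _).add_const _, ?_⟩
  have hw : ∀ z ∈ U, HasDerivAt (fun z => w₀ z - w₀ c + u c) (dz u z) z :=
    fun z hz => ((hw₀ z hz).sub_const _).add_const _
  have hpre : IsPreconnected U := (hs.isPathConnected hc).isConnected.isPreconnected
  have hfd : ∀ z ∈ U, HasFDerivAt (fun z => (w₀ z - w₀ c + u c).re - u z) (0 : ℂ →L[ℝ] ℝ) z := by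
    intro z hz
    have h1 := (Complex.reCLM.hasFDerivAt (x := w₀ z - w₀ c + u c)).comp z
      ((hw z hz).hasFDerivAt.restrictScalars ℝ)
    have h2 : HasFDerivAt u (fderiv ℝ u z) z :=
      ((hu z hz).1.differentiableAt two_ne_zero).hasFDerivAt
    refine (h1.fun_sub h2).congr_fderiv ?_
    ext a
    have ha : a = a.re • (1 : ℂ) + a.im • Complex.I := by simp
    rw [ha]
    simp only [map_add, map_smul]
    simp [dz]
  intro z hz
  have h := hU.is_const_of_fderiv_eq_zero (𝕜 := ℝ)
    (f := fun z => (w₀ z - w₀ c + u c).re - u z) hpre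
    (fun z hz => (hfd z hz).differentiableAt.differentiableWithinAt)
    (fun z hz => (hfd z hz).fderiv) hz hc
  simp only [sub_self, zero_add, Complex.ofReal_re] at h
  change (w₀ z - w₀ c + u c).re = u z
  linarith

/-- Maximum principle with limsup conditions at the frontier and at infinity; V may be unbounded or
disconnected. A value above m would make a superlevel set compact, so the maximum would be attained;
the set where it is attained would then be closed, open and compact in the plane. -/
theorem harmonic_le_of_boundary {V : Set ℂ} (hV : IsOpen V) {v : ℂ → ℝ}
    (hv : HarmonicOnNhd v V) {m : ℝ}
    (hb : ∀ p ∈ frontier V, ∀ ε > 0, ∀ᶠ z in 𝓝[V] p, v z ≤ m + ε)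
    (hinf : ∀ ε > 0, ∀ᶠ z in Bornology.cobounded ℂ ⊓ 𝓟 V, v z ≤ m + ε) :
    ∀ z ∈ V, v z ≤ m := by
  by_contra! hcon
  obtain ⟨z₀, hz₀, hm⟩ := hcon
  set ε := (v z₀ - m) / 2 with hε
  have hε0 : 0 < ε := by rw [hε]; linarith
  have hlt : m + ε < v z₀ := by rw [hε]; linarith
  set K : Set ℂ := {z | z ∈ V ∧ v z₀ ≤ v z} with hK
  have hKb : Bornology.IsBounded K := by
    have h1 := hinf ε hε0
    rw [eventually_inf_principal] at h1
    rw [← Bornology.isCobounded_compl_iff]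
    filter_upwards [h1] with z h2 h3
    linarith [h2 h3.1, h3.2]
  have hKc : IsClosed K := by
    rw [← closure_subset_iff_isClosed]
    intro p hp
    have hp' : p ∈ closure V := closure_mono (fun z hz => hz.1) hp
    by_cases hpV : p ∈ V
    · refine ⟨hpV, ?_⟩
      have hc : ContinuousAt v p := (hv.continuousOn).continuousAt (hV.mem_nhds hpV)
      by_contra! hlt2
      have : ∀ᶠ z in 𝓝 p, v z < v z₀ := hc.eventually_lt_const hlt2
      obtain ⟨z, h1, h2⟩ := ((mem_closure_iff_frequently.mp hp).and_eventually this).exists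
      exact absurd h1.2 (not_le.mpr h2)
    · have hpf : p ∈ frontier V := by rw [hV.frontier_eq]; exact ⟨hp', hpV⟩
      have h1 := hb p hpf ε hε0
      rw [eventually_nhdsWithin_iff] at h1
      obtain ⟨z, h2, h3⟩ := ((mem_closure_iff_frequently.mp hp).and_eventually h1).exists
      linarith [h3 h2.1, h2.2]
  have hKcomp : IsCompact K := Metric.isCompact_of_isClosed_isBounded hKc hKb
  obtain ⟨z₁, hz₁, hmax⟩ := hKcomp.exists_isMaxOn ⟨z₀, hz₀, le_rfl⟩
    (hv.continuousOn.mono fun z hz => hz.1)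
  have hmaxV : ∀ z ∈ V, v z ≤ v z₁ := by
    intro z hz
    by_cases h : v z₀ ≤ v z
    · exact hmax (show z ∈ K from ⟨hz, h⟩)
    · exact (not_le.mp h).le.trans hz₁.2
  set K' : Set ℂ := {z | z ∈ V ∧ v z = v z₁} with hK'
  have hK'eq : K' = K ∩ v ⁻¹' {v z₁} := by
    ext z
    constructor
    · rintro ⟨h1, h2⟩
      exact ⟨⟨h1, h2 ▸ hz₁.2⟩, h2⟩
    · rintro ⟨h1, h2⟩
      exact ⟨h1.1, h2⟩
  have hcl : IsClosed K' := by
    rw [hK'eq]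
    exact (hv.continuousOn.mono fun z hz => hz.1).preimage_isClosed_of_isClosed hKc
      isClosed_singleton
  have hop : IsOpen K' := by
    rw [isOpen_iff_mem_nhds]
    rintro p ⟨hp, hpe⟩
    obtain ⟨ρ, hρ, hball⟩ := Metric.isOpen_iff.mp hV p hp
    obtain ⟨F, hF, hFe⟩ := (hv.mono hball).exists_analyticOnNhd_ball_re_eq
    have hpb : p ∈ Metric.ball p ρ := Metric.mem_ball_self hρ
    -- The maximum modulus principle applies to exp F, whose modulus is exp v.
    have h1 : ∀ᶠ y in 𝓝 p, ‖Complex.exp (F y)‖ = ‖Complex.exp (F p)‖ := by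
      apply Complex.norm_eventually_eq_of_isLocalMax (f := fun y => Complex.exp (F y))
      · filter_upwards [Metric.ball_mem_nhds p hρ] with y hy
        exact (hF y hy).differentiableAt.cexp
      · filter_upwards [Metric.ball_mem_nhds p hρ] with y hy
        simp only [Function.comp_apply, Complex.norm_exp]
        have e1 := hFe hy
        have e2 := hFe hpb
        simp only at e1 e2
        rw [e1, e2, hpe]
        exact Real.exp_le_exp.mpr (hmaxV y (hball hy))
    filter_upwards [h1, Metric.ball_mem_nhds p hρ] with y h2 hy
    refine ⟨hball hy, ?_⟩
    have e1 := hFe hy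
    have e2 := hFe hpb
    simp only [Complex.norm_exp, Real.exp_eq_exp] at e1 e2 h2
    rw [← hpe, ← e1, ← e2, h2]
  have huniv : K' = univ := IsClopen.eq_univ ⟨hcl, hop⟩ ⟨z₁, hz₁.1, rfl⟩
  have : IsCompact (univ : Set ℂ) := by
    rw [← huniv]
    exact hKcomp.of_isClosed_subset hcl (by rw [hK'eq]; exact inter_subset_left)
  exact noncompact_univ ℂ this

/-! ### A harmonic function near a smooth arc -/

/-- The open square with centre `0` and half side `ρ`. -/
def square (ρ : ℝ) : Set ℂ := {z | |z.re| < ρ ∧ |z.im| < ρ}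

/-- The part of the square above the graph of `φ`. -/
def upper (φ : ℝ → ℝ) (ρ : ℝ) : Set ℂ := {z | z ∈ square ρ ∧ φ z.re < z.im}

/-- The part of the square below the graph of `φ`. -/
def lower (φ : ℝ → ℝ) (ρ : ℝ) : Set ℂ := {z | z ∈ square ρ ∧ z.im < φ z.re}

/-- A `C^{1,1}` arc `κ` through `0` with tangent direction close to `1 + i`, which is a graph
`y = φ x` over `|x| < ρ`. -/
structure LocalArc (κ κ' : ℝ → ℂ) (φ : ℝ → ℝ) (δ ρ K : ℝ) : Prop where
  δ_pos : 0 < δ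
  ρ_pos : 0 < ρ
  K_pos : 0 < K
  hasDerivAt : ∀ t, |t| < δ → HasDerivAt κ (κ' t) t
  cont : ContinuousOn κ' (Ioo (-δ) δ)
  near : ∀ t, |t| < δ → ‖κ' t - (1 + Complex.I)‖ ≤ 1 / 20
  taylor : ∀ s t, |s| < δ → |t| < δ → ‖κ t - κ s - (t - s) * κ' s‖ ≤ K * (t - s) ^ 2
  secant : ∀ s t, |s| < δ → |t| < δ → ‖κ t - κ s - (t - s) * (1 + Complex.I)‖ ≤ 1 / 20 * |t - s|
  graph : ∀ t, |t| < δ → φ (κ t).re = (κ t).im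
  surj : ∀ x, |x| < ρ → ∃ t, |t| < δ ∧ (κ t).re = x
  lip : ∀ x y, |φ x - φ y - (x - y)| ≤ 1 / 10 * |x - y|
  zero : κ 0 = 0

theorem isOpen_square (ρ : ℝ) : IsOpen (square ρ) :=
  (isOpen_lt (f := fun z : ℂ => |z.re|) (by fun_prop) continuous_const).inter
    (isOpen_lt (f := fun z : ℂ => |z.im|) (by fun_prop) continuous_const)

theorem square_mono {ρ ρ' : ℝ} (h : ρ' ≤ ρ) : square ρ' ⊆ square ρ :=
  fun _ hz => ⟨hz.1.trans_le h, hz.2.trans_le h⟩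

theorem upper_mono {φ : ℝ → ℝ} {ρ ρ' : ℝ} (h : ρ' ≤ ρ) : upper φ ρ' ⊆ upper φ ρ :=
  fun _ hz => ⟨square_mono h hz.1, hz.2⟩

theorem mem_square_of_norm_lt {z : ℂ} {ρ : ℝ} (h : ‖z‖ < ρ) : z ∈ square ρ :=
  ⟨(Complex.abs_re_le_norm z).trans_lt h, (Complex.abs_im_le_norm z).trans_lt h⟩

/-! ### Geometry of the arc, barrier and gradient bound -/

namespace LocalArc

variable {κ κ' : ℝ → ℂ} {φ : ℝ → ℝ} {δ ρ K : ℝ}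

theorem mono (h : LocalArc κ κ' φ δ ρ K) {ρ' : ℝ} (h0 : 0 < ρ') (hle : ρ' ≤ ρ) :
    LocalArc κ κ' φ δ ρ' K :=
  { h with ρ_pos := h0, surj := fun x hx => h.surj x (hx.trans_le hle) }

theorem reflect (h : LocalArc κ κ' φ δ ρ K) :
    LocalArc (fun t => -κ (-t)) (fun t => κ' (-t)) (fun x => -φ (-x)) δ ρ K where
  δ_pos := h.δ_pos
  ρ_pos := h.ρ_pos
  K_pos := h.K_pos
  hasDerivAt t ht := by
    have h1 := (h.hasDerivAt (-t) (by simpa using ht)).scomp t (hasDerivAt_neg t)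
    simpa using h1.fun_neg
  cont := h.cont.comp continuousOn_neg (fun t ht => ⟨by linarith [ht.2], by linarith [ht.1]⟩)
  near t ht := h.near (-t) (by simpa using ht)
  taylor s t hs ht := by
    have := h.taylor (-s) (-t) (by simpa using hs) (by simpa using ht)
    have e1 : -κ (-t) - -κ (-s) - (t - s) * κ' (-s)
        = -(κ (-t) - κ (-s) - ((-t : ℝ) - (-s : ℝ)) * κ' (-s)) := by push_cast; ring
    have e2 : (t - s) ^ 2 = (-t - -s) ^ 2 := by ring
    rwa [e1, norm_neg, e2]
  secant s t hs ht := by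
    have := h.secant (-s) (-t) (by simpa using hs) (by simpa using ht)
    have e1 : -κ (-t) - -κ (-s) - (t - s) * (1 + Complex.I)
        = -(κ (-t) - κ (-s) - ((-t : ℝ) - (-s : ℝ)) * (1 + Complex.I)) := by push_cast; ring
    have e2 : |t - s| = |-t - -s| := by rw [← abs_neg]; congr 1; ring
    rwa [e1, norm_neg, e2]
  graph t ht := by simpa using h.graph (-t) (by simpa using ht)
  surj x hx := by
    obtain ⟨t, ht, hx⟩ := h.surj (-x) (by simpa using hx)
    exact ⟨-t, by simpa using ht, by simp [hx]⟩
  lip x y := by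
    have := h.lip (-x) (-y)
    rw [← abs_neg] at this
    convert this using 2
    · ring
    · rw [← abs_neg]; congr 1; ring
  zero := by simp [h.zero]

theorem lt_of_lt (h : LocalArc κ κ' φ δ ρ K) {x y : ℝ} (hxy : x < y) : φ x < φ y := by
  have := abs_le.mp (h.lip x y)
  rw [abs_of_neg (by linarith : x - y < 0)] at this
  linarith [this.2]

theorem abs_sub_le (h : LocalArc κ κ' φ δ ρ K) (x y : ℝ) : |φ x - φ y| ≤ 11 / 10 * |x - y| := by
  have h1 := h.lip x y
  have h2 := abs_add_le (φ x - φ y - (x - y)) (x - y)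
  rw [sub_add_cancel] at h2
  linarith

theorem continuous_graph (h : LocalArc κ κ' φ δ ρ K) : Continuous φ := by
  have : LipschitzWith (11 / 10) φ := LipschitzWith.of_dist_le_mul fun x y => by
    simpa [Real.dist_eq] using h.abs_sub_le x y
  exact this.continuous

theorem graph_zero (h : LocalArc κ κ' φ δ ρ K) : φ 0 = 0 := by
  simpa [h.zero] using h.graph 0 (by simpa using h.δ_pos)

theorem abs_graph_le (h : LocalArc κ κ' φ δ ρ K) (x : ℝ) : |φ x| ≤ 11 / 10 * |x| := by
  simpa [h.graph_zero] using h.abs_sub_le x 0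

theorem isOpen_upper (h : LocalArc κ κ' φ δ ρ K) (ρ' : ℝ) : IsOpen (upper φ ρ') := by
  have := h.continuous_graph
  exact (isOpen_square ρ').inter
    (isOpen_lt (f := fun z : ℂ => φ z.re) (g := fun z : ℂ => z.im) (by fun_prop) (by fun_prop))

/-- The slope of φ lies between 9/10 and 11/10, so moving from a point above the graph towards the
upper left centre never meets the graph. -/
theorem starConvex_upper (h : LocalArc κ κ' φ δ ρ K) {ρ' : ℝ} (h0 : 0 < ρ') :
    (⟨-ρ' / 2, ρ' / 2⟩ : ℂ) ∈ upper φ ρ' ∧ StarConvex ℝ (⟨-ρ' / 2, ρ' / 2⟩ : ℂ) (upper φ ρ') := by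
  have hmem : (⟨-ρ' / 2, ρ' / 2⟩ : ℂ) ∈ upper φ ρ' := by
    refine ⟨⟨?_, ?_⟩, ?_⟩
    · rw [abs_lt]; constructor <;> simp only <;> linarith
    · rw [abs_lt]; constructor <;> simp only <;> linarith
    · have : φ (-ρ' / 2) < φ 0 := h.lt_of_lt (by linarith)
      rw [h.graph_zero] at this
      simp only; linarith
  refine ⟨hmem, ?_⟩
  rintro ⟨x, y⟩ hz a b ha hb hab
  obtain ⟨⟨hx, hy⟩, hφ⟩ := hz
  simp only [abs_lt] at hx hy hφ
  have e : a • (⟨-ρ' / 2, ρ' / 2⟩ : ℂ) + b • (⟨x, y⟩ : ℂ)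
      = ⟨a * (-ρ' / 2) + b * x, a * (ρ' / 2) + b * y⟩ := by
    apply Complex.ext <;> simp
  rw [e]
  have hb1 : b = 1 - a := by linarith
  subst hb1
  refine ⟨⟨?_, ?_⟩, ?_⟩
  · simp only [abs_lt]; constructor <;> nlinarith
  · simp only [abs_lt]; constructor <;> nlinarith
  · simp only
    have h1 := (abs_le.mp (h.lip (a * (-ρ' / 2) + (1 - a) * x) x)).2
    have h2 := (abs_le.mp (h.lip x 0)).2
    have h2' := (abs_le.mp (h.lip x 0)).1
    rw [h.graph_zero] at h2 h2'
    have h3 : |x - 0| ≤ ρ' := by rw [sub_zero, abs_le]; constructor <;> linarith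
    have h4 : |a * (-ρ' / 2) + (1 - a) * x - x| ≤ a * (3 / 2 * ρ') := by
      have : a * (-ρ' / 2) + (1 - a) * x - x = a * (-ρ' / 2 - x) := by ring
      rw [this, abs_mul, abs_of_nonneg ha]
      apply mul_le_mul_of_nonneg_left _ ha
      rw [abs_le]; constructor <;> linarith
    rcases eq_or_lt_of_le ha with rfl | ha'
    · simpa using hφ
    · nlinarith [mul_pos ha' h0, mul_nonneg hb (sub_pos.mpr hφ).le]

/-- Exterior disc condition. With q = z - κ(t) and upward unit normal n, the Taylor bound gives Re(q
n̄) ≥ -K(s - t)² ≥ -2K|q|², where κ(s) is the arc point with the same real part as z. Hence |q +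
rn|² ≥ r² + (1 - 4rK)|q|². -/
theorem norm_sub_center_ge (h : LocalArc κ κ' φ δ ρ K) {r : ℝ} (hr : 0 < r) (hrK : 4 * r * K ≤ 1)
    {t : ℝ} (ht : |t| < δ) {z : ℂ} (hz : z ∈ upper φ ρ) :
    r ≤ ‖z - (κ t - r * (Complex.I * κ' t / ‖κ' t‖))‖ := by
  obtain ⟨s, hs, hsx⟩ := h.surj z.re hz.1.1
  set k := κ' t with hk
  have hkre : 0 < k.re := by
    have h1 := (Complex.abs_re_le_norm _).trans (h.near t ht)
    simp at h1
    linarith [(abs_le.mp h1).1]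
  have hk0 : 0 < ‖k‖ := by
    rw [norm_pos_iff]; rintro h0; rw [h0] at hkre; simp at hkre
  set n : ℂ := Complex.I * k / ‖k‖ with hn
  have hn1 : ‖n‖ = 1 := by
    rw [hn, norm_div, norm_mul, Complex.norm_I, Complex.norm_real, norm_norm]; field_simp
  set E : ℂ := κ s - κ t - (s - t) * k with hE
  have hEb : ‖E‖ ≤ K * (s - t) ^ 2 := h.taylor t s ht hs
  set η : ℝ := z.im - φ z.re with hη
  have hηpos : 0 < η := sub_pos.mpr hz.2
  have hzq : z = κ s + Complex.I * η := by
    apply Complex.ext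
    · simp [hsx]
    · simp [hη, ← hsx, h.graph s hs]
  have hinner : -(K * (s - t) ^ 2) ≤ ((z - κ t) * (starRingEnd ℂ) n).re := by
    have e1 : (z - κ t) * (starRingEnd ℂ) n = E * (starRingEnd ℂ) n
        + ((((s - t) * (k.re ^ 2 + k.im ^ 2) / ‖k‖ : ℝ)) : ℂ) * (-Complex.I)
        + ((η / ‖k‖ : ℝ) : ℂ) * (starRingEnd ℂ) k := by
      have hkk : k * (starRingEnd ℂ) k = ((k.re ^ 2 + k.im ^ 2 : ℝ) : ℂ) := by
        rw [Complex.mul_conj, Complex.normSq_apply]; push_cast; ring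
      have hk0' : (‖k‖ : ℂ) ≠ 0 := by exact_mod_cast hk0.ne'
      rw [hzq, hn, hE]
      simp only [map_div₀, map_mul, Complex.conj_I, Complex.conj_ofReal]
      push_cast at hkk ⊢
      rw [← hkk]
      field_simp
      ring_nf
      rw [Complex.I_sq]
      ring
    rw [e1]
    have h1 : -(K * (s - t) ^ 2) ≤ (E * (starRingEnd ℂ) n).re := by
      have := (abs_le.mp (Complex.abs_re_le_norm (E * (starRingEnd ℂ) n))).1
      rw [norm_mul, RCLike.norm_conj, hn1, mul_one] at this
      linarith
    have h2 : 0 < η / ‖k‖ * k.re := by positivity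
    simp only [Complex.add_re, Complex.re_ofReal_mul, Complex.neg_re, Complex.I_re,
      Complex.conj_re]
    linarith
  -- The real part of κ changes at rate at least 19/20, and (20/19)² ≤ 2.
  have hst : (s - t) ^ 2 ≤ 2 * ‖z - κ t‖ ^ 2 := by
    have h1 := (Complex.abs_re_le_norm _).trans (h.secant t s ht hs)
    have h2 := Complex.abs_re_le_norm (z - κ t)
    simp at h1 h2
    rw [← hsx] at h2
    have h3 : 19 / 20 * |s - t| ≤ ‖z - κ t‖ := by
      have := abs_sub_abs_le_abs_sub (s - t) ((κ s).re - (κ t).re)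
      rw [abs_sub_comm (s - t) ((κ s).re - (κ t).re)] at this
      linarith
    rw [← sq_abs]
    nlinarith [abs_nonneg (s - t)]
  have hsq : r ^ 2 ≤ ‖z - (κ t - r * n)‖ ^ 2 := by
    have e : z - (κ t - r * n) = (z - κ t) + r * n := by ring
    rw [e, ← Complex.normSq_eq_norm_sq, Complex.normSq_add, Complex.normSq_eq_norm_sq,
      Complex.normSq_eq_norm_sq, norm_mul, hn1, Complex.norm_real, Real.norm_eq_abs, abs_of_pos hr]
    have : (z - κ t) * (starRingEnd ℂ) (r * n) = r * ((z - κ t) * (starRingEnd ℂ) n) := by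
      simp; ring
    rw [this, Complex.re_ofReal_mul]
    have h5 : r * (K * (s - t) ^ 2) ≤ r * (K * (2 * ‖z - κ t‖ ^ 2)) := by
      have := h.K_pos
      gcongr
    nlinarith [mul_le_mul_of_nonneg_left hinner hr.le, sq_nonneg ‖z - κ t‖]
  exact (abs_le_of_sq_le_sq' hsq (norm_nonneg _)).2

/-- Barrier argument: (M / log 2) log(|z - c| / r) is nonnegative off the exterior disc of radius r
and equals M on the circle of radius 2r, so it dominates u between them. Then log s ≤ s - 1 makes
the bound linear in the distance to κ(t). The bound is one-sided, to be used for u and -u. -/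
theorem abs_le_mul_norm_sub (h : LocalArc κ κ' φ δ ρ K) {u : ℂ → ℝ} {M : ℝ} (hM : 0 < M)
    (hu : HarmonicOnNhd u (upper φ ρ)) (hb : ∀ z ∈ upper φ ρ, u z ≤ M)
    (h0 : ∀ p ∈ square ρ, p.im = φ p.re → Tendsto u (𝓝[upper φ ρ] p) (𝓝 0))
    {r : ℝ} (hr : 0 < r) (hrK : 4 * r * K ≤ 1) (hrρ : 16 * r ≤ ρ) {t : ℝ} (ht : |t| < δ)
    (htρ : |(κ t).re| < ρ / 2) {z : ℂ} (hz : z ∈ upper φ ρ) (hzr : ‖z - κ t‖ < r) :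
    u z ≤ M / (Real.log 2 * r) * ‖z - κ t‖ := by
  set c : ℂ := κ t - r * (Complex.I * κ' t / ‖κ' t‖) with hc
  have hcq : ‖κ t - c‖ ≤ r := by
    rw [hc, sub_sub_cancel, norm_mul, norm_div, norm_mul, Complex.norm_I, Complex.norm_real,
      Complex.norm_real, norm_norm, one_mul, Real.norm_eq_abs, abs_of_pos hr]
    exact mul_le_of_le_one_right hr.le (div_self_le_one _)
  have hge : ∀ z ∈ upper φ ρ, r ≤ ‖z - c‖ := fun z hz => h.norm_sub_center_ge hr hrK ht hz
  have hl2 : 0 < Real.log 2 := Real.log_pos (by norm_num)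
  set V : Set ℂ := upper φ ρ ∩ Metric.ball c (2 * r) with hV
  have hVo : IsOpen V := (h.isOpen_upper ρ).inter Metric.isOpen_ball
  set b : ℂ → ℝ := fun z => M / Real.log 2 * (Real.log ‖z - c‖ - Real.log r) with hbdef
  -- Room comes from 16r ≤ ρ and |Re κ(t)| < ρ/2: the only frontier points of V inside the larger
  -- circle then lie on the graph.
  have hsub : Metric.closedBall c (2 * r) ⊆ square ρ := by
    intro p hp
    have h1 : ‖p - κ t‖ ≤ 3 * r := by
      rw [Metric.mem_closedBall, dist_eq_norm] at hp
      have : p - κ t = (p - c) - (κ t - c) := by ring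
      rw [this]
      exact (norm_sub_le _ _).trans (by linarith)
    have h2 := (Complex.abs_re_le_norm (p - κ t)).trans h1
    have h3 := (Complex.abs_im_le_norm (p - κ t)).trans h1
    have h4 := h.abs_graph_le (κ t).re
    rw [h.graph t ht] at h4
    simp only [Complex.sub_re, Complex.sub_im, abs_le] at h2 h3
    have h5 := abs_le.mp (h4.trans (by linarith : 11 / 10 * |(κ t).re| ≤ 11 / 20 * ρ))
    have h6 := abs_lt.mp htρ
    constructor <;> rw [abs_lt] <;> constructor <;> linarith [h2.1, h2.2, h3.1, h3.2, h5.1, h5.2]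
  have hbh : HarmonicOnNhd b V := by
    intro z hz
    have hne : z - c ≠ 0 := by
      intro h0; have := hge z hz.1; rw [h0, norm_zero] at this; linarith
    have h1 : HarmonicAt (fun z => Real.log ‖z - c‖) z :=
      AnalyticAt.harmonicAt_log_norm (f := fun z => z - c) (by fun_prop) hne
    have h2 := (h1.sub (harmonicAt_const (Real.log r))).const_smul (c := M / Real.log 2)
    exact h2
  have hv : HarmonicOnNhd (u - b) V :=
    HarmonicOnNhd.sub (hu.mono inter_subset_left) hbh
  have hbcont : ∀ p, p ≠ c → ContinuousAt b p := by
    intro p hp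
    have : ‖p - c‖ ≠ 0 := norm_ne_zero_iff.mpr (sub_ne_zero.mpr hp)
    have h1 : ContinuousAt (fun z => ‖z - c‖) p := by fun_prop
    exact continuousAt_const.mul ((h1.log this).sub continuousAt_const)
  have hbpos : ∀ z ∈ V, 0 ≤ b z := by
    intro z hz
    have := Real.log_le_log hr (hge z hz.1)
    exact mul_nonneg (by positivity) (by linarith)
  have key := harmonic_le_of_boundary hVo hv (m := 0) ?_ ?_
  · have hzV : z ∈ V := by
      refine ⟨hz, ?_⟩
      rw [Metric.mem_ball, dist_eq_norm]
      have : z - c = (z - κ t) + (κ t - c) := by ring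
      rw [this]
      exact (norm_add_le _ _).trans_lt (by linarith)
    have h1 := key z hzV
    simp only [Pi.sub_apply] at h1
    have h2 : b z ≤ M / (Real.log 2 * r) * ‖z - κ t‖ := by
      have hzc := hge z hz
      rw [hbdef]
      simp only
      rw [← Real.log_div (by linarith) hr.ne']
      have h3 := Real.log_le_sub_one_of_pos (div_pos (hr.trans_le hzc) hr)
      have h4 : ‖z - c‖ / r - 1 ≤ ‖z - κ t‖ / r := by
        rw [div_sub_one hr.ne']
        gcongr
        have : z - c = (z - κ t) + (κ t - c) := by ring
        rw [this]
        linarith [norm_add_le (z - κ t) (κ t - c)]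
      calc _ ≤ M / Real.log 2 * (‖z - κ t‖ / r) := by gcongr; linarith
        _ = _ := by field_simp
    linarith
  · intro p hp ε hε
    rw [hVo.frontier_eq] at hp
    have hpcl : p ∈ Metric.closedBall c (2 * r) :=
      Metric.closure_ball_subset_closedBall (closure_mono inter_subset_right hp.1)
    have hpge : r ≤ ‖p - c‖ := by
      have : V ⊆ {z | r ≤ ‖z - c‖} := fun z hz => hge z hz.1
      have hcl : IsClosed {z : ℂ | r ≤ ‖z - c‖} := isClosed_le continuous_const (by fun_prop)
      exact closure_minimal this hcl hp.1
    have hpc : p ≠ c := by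
      rintro rfl; simp at hpge; linarith
    by_cases hp2 : ‖p - c‖ < 2 * r
    · have hps : p ∈ square ρ := hsub hpcl
      have hpu : p ∉ upper φ ρ := fun hu' => hp.2 ⟨hu', by rwa [Metric.mem_ball, dist_eq_norm]⟩
      have hpe : p.im = φ p.re := by
        apply le_antisymm
        · by_contra! hlt; exact hpu ⟨hps, hlt⟩
        · have hcont := h.continuous_graph
          have hcl : IsClosed {z : ℂ | φ z.re ≤ z.im} := isClosed_le (by fun_prop) (by fun_prop)
          exact closure_minimal (fun z (hz : z ∈ V) => hz.1.2.le) hcl hp.1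
      have h1 := (h0 p hps hpe).mono_left (nhdsWithin_mono p (inter_subset_left (t := Metric.ball c (2 * r))))
      filter_upwards [h1.eventually_lt_const hε, self_mem_nhdsWithin] with z h2 h3
      have := hbpos z h3
      simp only [Pi.sub_apply]; linarith
    · have hp3 : ‖p - c‖ = 2 * r := by
        rw [Metric.mem_closedBall, dist_eq_norm] at hpcl
        linarith [not_lt.mp hp2]
      have hbp : b p = M := by
        rw [hbdef]; simp only
        rw [hp3, Real.log_mul two_ne_zero hr.ne']; field_simp; ring
      have h1 : ∀ᶠ z in 𝓝[V] p, M - ε < b z := by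
        apply ((hbcont p hpc).eventually_const_lt ?_).filter_mono nhdsWithin_le_nhds
        rw [hbp]; linarith
      filter_upwards [h1, self_mem_nhdsWithin] with z h2 h3
      have := hb z h3.1
      simp only [Pi.sub_apply]; linarith
  · intro ε hε
    rw [eventually_inf_principal]
    have : (Metric.ball c (2 * r))ᶜ ∈ Bornology.cobounded ℂ :=
      Bornology.isCobounded_compl_iff.mpr Metric.isBounded_ball
    filter_upwards [this] with z h1 h2
    exact absurd h2.2 h1

/-- At height η above the arc, u is O(η) on a ball of radius η/4, so the interior gradient estimate
is independent of η. -/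
theorem exists_norm_dz_le (h : LocalArc κ κ' φ δ ρ K) {u : ℂ → ℝ} {M : ℝ} (hM : 0 < M)
    (hu : HarmonicOnNhd u (upper φ ρ)) (hb : ∀ z ∈ upper φ ρ, |u z| ≤ M)
    (h0 : ∀ p ∈ square ρ, p.im = φ p.re → Tendsto u (𝓝[upper φ ρ] p) (𝓝 0)) :
    ∃ B : ℝ, ∃ ρ' > 0, ρ' ≤ ρ ∧ ∀ z ∈ upper φ ρ', ‖dz u z‖ ≤ B := by
  have hK := h.K_pos
  have hρ := h.ρ_pos
  set r : ℝ := min (ρ / 16) (1 / (4 * K)) with hrdef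
  have hr : 0 < r := by rw [hrdef]; positivity
  have hrρ : 16 * r ≤ ρ := by linarith [min_le_left (ρ / 16) (1 / (4 * K))]
  have hrK : 4 * r * K ≤ 1 := by
    have := min_le_right (ρ / 16) (1 / (4 * K))
    rw [← hrdef, le_div_iff₀ (by positivity)] at this
    linarith
  set C : ℝ := M / (Real.log 2 * r) with hC
  have hC0 : 0 < C := by
    have : 0 < Real.log 2 := Real.log_pos (by norm_num)
    positivity
  -- In the square of half side r/4 the height satisfies η ≤ 21r/40, so points of the ball lie
  -- within 5η/4 < r of κ(t), where the barrier bound applies.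
  refine ⟨8 * (C * (5 / 4)) / (1 / 4), r / 4, by linarith, by linarith, fun z hz => ?_⟩
  obtain ⟨⟨hz1, hz2⟩, hz3⟩ := hz
  set η : ℝ := z.im - φ z.re with hη
  have hη0 : 0 < η := sub_pos.mpr hz3
  have hφz := abs_le.mp (h.abs_graph_le z.re)
  have hηr : η ≤ 21 / 40 * r := by
    have := abs_lt.mp hz2
    rw [hη]; linarith [hφz.1, this.2]
  obtain ⟨t, ht, htx⟩ := h.surj z.re (by linarith)
  have hzq : z - κ t = Complex.I * η := by
    apply Complex.ext
    · simp [htx]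
    · simp [hη, ← htx, h.graph t ht]
  have hball : ∀ w ∈ Metric.ball z (η / 4), w ∈ upper φ ρ ∧ ‖w - κ t‖ ≤ 5 / 4 * η := by
    intro w hw
    rw [Metric.mem_ball, dist_eq_norm] at hw
    have h1 := (Complex.abs_re_le_norm (w - z)).trans hw.le
    have h2 := (Complex.abs_im_le_norm (w - z)).trans hw.le
    have h3 := abs_le.mp (h.abs_sub_le w.re z.re)
    simp only [Complex.sub_re, Complex.sub_im] at h1 h2
    have h1' := abs_le.mp h1
    have h2' := abs_le.mp h2
    have h4 := abs_lt.mp hz1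
    have h5 := abs_lt.mp hz2
    refine ⟨⟨⟨?_, ?_⟩, ?_⟩, ?_⟩
    · rw [abs_lt]; constructor <;> linarith
    · rw [abs_lt]; constructor <;> linarith
    · linarith [h3.2]
    · have : w - κ t = (w - z) + (z - κ t) := by ring
      rw [this, hzq]
      refine (norm_add_le _ _).trans ?_
      rw [norm_mul, Complex.norm_I, Complex.norm_real, Real.norm_eq_abs, abs_of_pos hη0]
      linarith
  have htρ : |(κ t).re| < ρ / 2 := by rw [htx]; linarith
  have hest : ∀ w ∈ Metric.ball z (η / 4), |u w - 0| ≤ C * (5 / 4 * η) := by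
    intro w hw
    obtain ⟨hwu, hwn⟩ := hball w hw
    have hwr : ‖w - κ t‖ < r := by linarith
    have h1 := h.abs_le_mul_norm_sub hM hu (fun z hz => (abs_le.mp (hb z hz)).2) h0 hr hrK hrρ ht
      htρ hwu hwr
    have h2 := h.abs_le_mul_norm_sub (u := -u) hM hu.neg
      (fun z hz => by simp only [Pi.neg_apply]; linarith [(abs_le.mp (hb z hz)).1])
      (fun p hp hpe => neg_zero (G := ℝ) ▸ (h0 p hp hpe).neg) hr hrK hrρ ht htρ hwu hwr
    simp only [Pi.neg_apply] at h2
    have h3 : C * ‖w - κ t‖ ≤ C * (5 / 4 * η) := by gcongr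
    rw [sub_zero, abs_le]
    constructor <;> linarith
  have := norm_dz_le (by positivity) (by positivity)
    (hu.mono fun w hw => (hball w hw).1) 0 hest
  refine this.trans (le_of_eq ?_)
  field_simp

end LocalArc

/-! ### Holomorphic completion up to the arc -/

namespace LocalArc

variable {κ κ' : ℝ → ℂ} {φ : ℝ → ℝ} {δ ρ K : ℝ}

theorem norm_le (h : LocalArc κ κ' φ δ ρ K) {t : ℝ} (ht : |t| < δ) : ‖κ t‖ ≤ 2 * |t| := by
  have h1 := h.secant 0 t (by simpa using h.δ_pos) ht
  rw [h.zero] at h1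
  simp only [sub_zero, Complex.ofReal_zero] at h1
  have h2 : ‖(t : ℂ) * (1 + Complex.I)‖ ≤ 3 / 2 * |t| := by
    rw [norm_mul, Complex.norm_real, Real.norm_eq_abs, mul_comm]
    gcongr
    have : ‖(1 + Complex.I : ℂ)‖ ^ 2 = 2 := by
      rw [← Complex.normSq_eq_norm_sq, Complex.normSq_apply]; norm_num
    nlinarith [norm_nonneg (1 + Complex.I : ℂ)]
  have h3 : κ t = (κ t - t * (1 + Complex.I)) + t * (1 + Complex.I) := by ring
  rw [h3]
  refine (norm_add_le _ _).trans ?_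
  linarith [abs_nonneg t]

theorem add_mem_upper (h : LocalArc κ κ' φ δ ρ K) {ρ' t ε : ℝ} (ht : |t| < δ) (htρ : |t| < ρ' / 4)
    (hε : 0 < ε) (hερ : ε < ρ' / 4) : κ t + ε * Complex.I ∈ upper φ ρ' := by
  have h1 := h.norm_le ht
  have h2 := (Complex.abs_re_le_norm (κ t)).trans h1
  have h3 := (Complex.abs_im_le_norm (κ t)).trans h1
  have h4 : κ t + ε * Complex.I = ⟨(κ t).re, (κ t).im + ε⟩ := by apply Complex.ext <;> simp
  rw [h4]
  refine ⟨⟨by simp only; linarith, ?_⟩, by simp only [h.graph t ht]; linarith⟩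
  simp only
  refine (abs_add_le _ _).trans_lt ?_
  rw [abs_of_pos hε]
  linarith

/-- The region need not be convex, but since φ increases, the part of the square up and to the left
of any of its points is convex and lies in it. Two points are joined through the corner with the
smaller real part and the larger imaginary part; each leg is at most twice their distance, whence
4B. -/
theorem lipschitzOnWith_upper (h : LocalArc κ κ' φ δ ρ K) {ρ' B : ℝ} {w Q : ℂ → ℂ}
    (hw : ∀ z ∈ upper φ ρ', HasDerivAt w (Q z) z) (hB : ∀ z ∈ upper φ ρ', ‖Q z‖ ≤ B) :
    LipschitzOnWith (Real.toNNReal (4 * B)) w (upper φ ρ') := by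
  have key : ∀ z ∈ upper φ ρ', ∀ x y : ℝ, x ≤ z.re → -ρ' < x → z.im ≤ y → y < ρ' →
      (⟨x, y⟩ : ℂ) ∈ upper φ ρ' ∧ ‖w ⟨x, y⟩ - w z‖ ≤ B * ‖(⟨x, y⟩ : ℂ) - z‖ := by
    intro z hz x y hx hx' hy hy'
    set s : Set ℂ := {p | (p.re ≤ z.re ∧ -ρ' < p.re) ∧ (z.im ≤ p.im ∧ p.im < ρ')} with hs
    have hsub : s ⊆ upper φ ρ' := by
      intro p hp
      have h1 := abs_lt.mp hz.1.1
      have h2 := abs_lt.mp hz.1.2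
      refine ⟨⟨abs_lt.mpr ⟨hp.1.2, by linarith [hp.1.1]⟩,
        abs_lt.mpr ⟨by linarith [hp.2.1], hp.2.2⟩⟩, ?_⟩
      have h3 : φ p.re ≤ φ z.re := by
        rcases eq_or_lt_of_le hp.1.1 with h | h'
        · rw [h]
        · exact (h.lt_of_lt h').le
      linarith [hz.2, hp.2.1]
    have hconv : Convex ℝ s := by
      apply Convex.inter
      · exact Convex.inter (convex_halfSpace_re_le _) (convex_halfSpace_re_gt _)
      · exact Convex.inter (convex_halfSpace_im_ge _) (convex_halfSpace_im_lt _)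
    have hmem : (⟨x, y⟩ : ℂ) ∈ s := ⟨⟨hx, hx'⟩, hy, hy'⟩
    have hzs : z ∈ s := ⟨⟨le_rfl, (abs_lt.mp hz.1.1).1⟩, le_rfl, (abs_lt.mp hz.1.2).2⟩
    exact ⟨hsub hmem, hconv.norm_image_sub_le_of_norm_hasDerivWithin_le
      (fun p hp => (hw p (hsub hp)).hasDerivWithinAt) (fun p hp => hB p (hsub hp)) hzs hmem⟩
  apply LipschitzOnWith.of_dist_le_mul
  intro z hz z' hz'
  have hB0 : 0 ≤ B := (norm_nonneg _).trans (hB z hz)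
  rw [Real.coe_toNNReal _ (by positivity), dist_eq_norm, dist_eq_norm]
  have a1 := abs_lt.mp hz.1.1
  have a2 := abs_lt.mp hz.1.2
  have b1 := abs_lt.mp hz'.1.1
  have b2 := abs_lt.mp hz'.1.2
  set k : ℂ := ⟨min z.re z'.re, max z.im z'.im⟩ with hk
  have k1 := (key z hz (min z.re z'.re) (max z.im z'.im) (min_le_left _ _)
    (lt_min a1.1 b1.1) (le_max_left _ _) (max_lt a2.2 b2.2)).2
  have k2 := (key z' hz' (min z.re z'.re) (max z.im z'.im) (min_le_right _ _)
    (lt_min a1.1 b1.1) (le_max_right _ _) (max_lt a2.2 b2.2)).2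
  rw [← hk] at k1 k2
  have hre := Complex.abs_re_le_norm (z - z')
  have him := Complex.abs_im_le_norm (z - z')
  simp only [Complex.sub_re, Complex.sub_im] at hre him
  have n1 : ‖k - z‖ ≤ 2 * ‖z - z'‖ := by
    refine (Complex.norm_le_abs_re_add_abs_im _).trans ?_
    have : |(k - z).re| ≤ |z.re - z'.re| := by
      simp only [hk, Complex.sub_re]
      rcases le_total z.re z'.re with h | h
      · simp [min_eq_left h]
      · rw [min_eq_right h, abs_sub_comm]
    have : |(k - z).im| ≤ |z.im - z'.im| := by
      simp only [hk, Complex.sub_im]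
      rcases le_total z.im z'.im with h | h
      · rw [max_eq_right h, abs_sub_comm]
      · simp [max_eq_left h]
    linarith
  have n2 : ‖k - z'‖ ≤ 2 * ‖z - z'‖ := by
    refine (Complex.norm_le_abs_re_add_abs_im _).trans ?_
    have : |(k - z').re| ≤ |z.re - z'.re| := by
      simp only [hk, Complex.sub_re]
      rcases le_total z.re z'.re with h | h
      · rw [min_eq_left h]
      · simp [min_eq_right h]
    have : |(k - z').im| ≤ |z.im - z'.im| := by
      simp only [hk, Complex.sub_im]
      rcases le_total z.im z'.im with h | h
      · simp [max_eq_right h]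
      · rw [max_eq_left h]
    linarith
  have e : w z - w z' = (w k - w z') - (w k - w z) := by ring
  rw [e]
  refine (norm_sub_le _ _).trans ?_
  nlinarith

/-- The holomorphic completion of a harmonic function on the upper side of the arc, which is
Lipschitz up to the arc. -/
theorem exists_lipschitz_primitive (h : LocalArc κ κ' φ δ ρ K) {u : ℂ → ℝ} {M : ℝ}
    (hu : HarmonicOnNhd u (upper φ ρ)) (hb : ∀ z ∈ upper φ ρ, |u z| ≤ M)
    (h0 : ∀ p ∈ square ρ, p.im = φ p.re → Tendsto u (𝓝[upper φ ρ] p) (𝓝 0)) {q : ℝ → ℂ}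
    (hq : ∀ t, |t| < δ → κ t ∈ square ρ →
      Tendsto (fun ε : ℝ => dz u (κ t + ε * Complex.I)) (𝓝[>] 0) (𝓝 (q t))) :
    ∃ ρ₀ > 0, ρ₀ ≤ ρ ∧ ∃ W : ℂ → ℂ, (∃ C, LipschitzWith C W) ∧
      (∀ z ∈ upper φ ρ₀, HasDerivAt W (dz u z) z ∧ (W z).re = u z) ∧
      (∀ t, |t| < ρ₀ → |t| < δ ∧ (W (κ t)).re = 0 ∧
        W (κ t) - W (κ 0) = ∫ s in (0 : ℝ)..t, q s * κ' s) := by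
  obtain ⟨B, ρ', hρ', hρ'ρ, hB⟩ := h.exists_norm_dz_le (M := max M 1) (by positivity) hu
    (fun z hz => (hb z hz).trans (le_max_left _ _)) h0
  obtain ⟨hc, hstar⟩ := h.starConvex_upper hρ'
  obtain ⟨w, hw, hwre⟩ := exists_hasDerivAt_dz_re_eq (h.isOpen_upper ρ') hc hstar
    (hu.mono (upper_mono hρ'ρ))
  -- Extending to a Lipschitz function on the plane makes the boundary values on the arc simply
  -- values of W.
  obtain ⟨W, hWL, hWw⟩ := (h.lipschitzOnWith_upper hw hB).extend_finite_dimension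
  have hWc : Continuous W := hWL.continuous
  have hWd : ∀ z ∈ upper φ ρ', HasDerivAt W (dz u z) z := fun z hz =>
    (hw z hz).congr_of_eventuallyEq (by
      filter_upwards [(h.isOpen_upper ρ').mem_nhds hz] with x hx using (hWw hx).symm)
  have hWre : ∀ z ∈ upper φ ρ', (W z).re = u z := fun z hz => by rw [← hWw hz]; exact hwre z hz
  have hδ := h.δ_pos
  refine ⟨min (ρ' / 4) (δ / 2), by positivity,
    (min_le_left _ _).trans (by linarith), W, ⟨_, hWL⟩, fun z hz => ?_, fun t ht => ?_⟩
  · have := upper_mono (show min (ρ' / 4) (δ / 2) ≤ ρ' from (min_le_left _ _).trans (by linarith)) hz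
    exact ⟨hWd z this, hWre z this⟩
  have htρ : |t| < ρ' / 4 := ht.trans_le (min_le_left _ _)
  have htδ : |t| < δ := ht.trans_le ((min_le_right _ _).trans (by linarith))
  have hsq : ∀ s, |s| < ρ' / 4 → |s| < δ → κ s ∈ square ρ' := fun s hs hs' =>
    mem_square_of_norm_lt ((h.norm_le hs').trans_lt (by linarith [abs_nonneg s]))
  have hεnear : ∀ᶠ ε : ℝ in 𝓝[>] 0, 0 < ε ∧ ε < ρ' / 4 :=
    Ioo_mem_nhdsGT (by linarith : (0 : ℝ) < ρ' / 4)
  have hlim : ∀ s : ℝ, Tendsto (fun ε : ℝ => W (κ s + ε * Complex.I)) (𝓝[>] 0) (𝓝 (W (κ s))) := by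
    intro s
    have : Continuous fun ε : ℝ => W (κ s + ε * Complex.I) := by fun_prop
    simpa using (this.tendsto 0).mono_left nhdsWithin_le_nhds
  refine ⟨htδ, ?_, ?_⟩
  · have h1 : Tendsto (fun ε : ℝ => (W (κ t + ε * Complex.I)).re) (𝓝[>] 0) (𝓝 (W (κ t)).re) :=
      (Complex.continuous_re.tendsto _).comp (hlim t)
    have hup : Tendsto (fun ε : ℝ => κ t + ε * Complex.I) (𝓝[>] 0) (𝓝[upper φ ρ] (κ t)) := by
      apply tendsto_nhdsWithin_iff.mpr ⟨?_, ?_⟩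
      · have : Continuous fun ε : ℝ => κ t + ε * Complex.I := by fun_prop
        simpa using (this.tendsto 0).mono_left nhdsWithin_le_nhds
      · filter_upwards [hεnear] with ε hε
        exact upper_mono hρ'ρ (h.add_mem_upper htδ htρ hε.1 hε.2)
    have h2 := (h0 (κ t) (square_mono hρ'ρ (hsq t htρ htδ)) (h.graph t htδ).symm).comp hup
    refine tendsto_nhds_unique h1 (h2.congr' ?_)
    filter_upwards [hεnear] with ε hε
    exact (hWre _ (h.add_mem_upper htδ htρ hε.1 hε.2)).symm
  · have hs_of : ∀ s ∈ uIcc 0 t, |s| < ρ' / 4 ∧ |s| < δ := by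
      intro s hs
      have : |s| ≤ |t| := by simpa using abs_sub_left_of_mem_uIcc hs
      exact ⟨this.trans_lt htρ, this.trans_lt htδ⟩
    have hκ'c : ContinuousOn κ' (uIcc 0 t) := h.cont.mono fun s hs => abs_lt.mp (hs_of s hs).2
    have hκc : ContinuousOn κ (uIcc 0 t) := fun s hs =>
      (h.hasDerivAt s (hs_of s hs).2).continuousAt.continuousWithinAt
    have hdzc : ContinuousOn (dz u) (upper φ ρ) := fun z hz =>
      (HarmonicAt.differentiableAt_complex_partial (hu z hz)).continuousAt.continuousWithinAt
    have hcomp : ∀ ε : ℝ, 0 < ε → ε < ρ' / 4 →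
        ContinuousOn (fun s => dz u (κ s + ε * Complex.I) * κ' s) (uIcc 0 t) := by
      intro ε h1 h2
      refine ContinuousOn.mul (hdzc.comp (hκc.add continuousOn_const) fun s hs => ?_) hκ'c
      exact upper_mono hρ'ρ (h.add_mem_upper (hs_of s hs).2 (hs_of s hs).1 h1 h2)
    have hFTC : ∀ ε : ℝ, 0 < ε → ε < ρ' / 4 →
        ∫ s in (0 : ℝ)..t, dz u (κ s + ε * Complex.I) * κ' s
          = W (κ t + ε * Complex.I) - W (κ 0 + ε * Complex.I) := by
      intro ε h1 h2
      apply intervalIntegral.integral_eq_sub_of_hasDerivAt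
        (f := fun s => W (κ s + ε * Complex.I))
      · intro s hs
        exact HasDerivAt.comp s (hWd _ (h.add_mem_upper (hs_of s hs).2 (hs_of s hs).1 h1 h2))
          ((h.hasDerivAt s (hs_of s hs).2).add_const _)
      · exact (hcomp ε h1 h2).intervalIntegrable
    -- The arc shifted up by ε lies inside the region, where the fundamental theorem applies. The
    -- uniform bounds |dz u| ≤ B and |κ'| ≤ 3 let ε tend to 0.
    have hDCT : Tendsto (fun ε : ℝ => ∫ s in (0 : ℝ)..t, dz u (κ s + ε * Complex.I) * κ' s)
        (𝓝[>] 0) (𝓝 (∫ s in (0 : ℝ)..t, q s * κ' s)) := by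
      apply intervalIntegral.tendsto_integral_filter_of_dominated_convergence
        (fun _ => B * 3)
      · filter_upwards [hεnear] with ε hε
        exact ((hcomp ε hε.1 hε.2).mono uIoc_subset_uIcc).aestronglyMeasurable measurableSet_uIoc
      · filter_upwards [hεnear] with ε hε
        filter_upwards with s hs
        have hs' := hs_of s (uIoc_subset_uIcc hs)
        have hmem := h.add_mem_upper hs'.2 hs'.1 hε.1 hε.2
        rw [norm_mul]
        have h3 : ‖κ' s‖ ≤ 3 := by
          have h1 := h.near s hs'.2
          have h2 : ‖(1 + Complex.I : ℂ)‖ ≤ 2 := by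
            refine (norm_add_le _ _).trans ?_
            simp; norm_num
          have h4 : κ' s = (κ' s - (1 + Complex.I)) + (1 + Complex.I) := by ring
          rw [h4]
          exact (norm_add_le _ _).trans (by linarith)
        exact mul_le_mul (hB _ hmem) h3 (norm_nonneg _) ((norm_nonneg _).trans (hB _ hmem))
      · exact intervalIntegrable_const
      · filter_upwards with s hs
        have hs' := hs_of s (uIoc_subset_uIcc hs)
        exact (hq s hs'.2 (square_mono hρ'ρ (hsq s hs'.1 hs'.2))).mul_const _
    refine tendsto_nhds_unique ((hlim t).sub (hlim 0)) (hDCT.congr' ?_)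
    filter_upwards [hεnear] with ε hε
    exact hFTC ε hε.1 hε.2

end LocalArc

/-- **Painlevé's theorem** for an increasing graph: two Lipschitz functions that are holomorphic
on the two sides of the graph and agree on the graph fit together to a holomorphic function. -/
theorem differentiableOn_ite_graph {φ : ℝ → ℝ} (hφc : Continuous φ) (hφ : StrictMono φ) {ρ : ℝ}
    {A B : ℂ → ℂ} {CA CB : NNReal} (hA : LipschitzWith CA A) (hB : LipschitzWith CB B)
    (hAd : ∀ z ∈ Metric.ball (0 : ℂ) ρ, φ z.re < z.im → DifferentiableAt ℂ A z)
    (hBd : ∀ z ∈ Metric.ball (0 : ℂ) ρ, z.im < φ z.re → DifferentiableAt ℂ B z)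
    (hAB : ∀ z ∈ Metric.ball (0 : ℂ) ρ, z.im = φ z.re → A z = B z) :
    DifferentiableOn ℂ (fun z => if φ z.re ≤ z.im then A z else B z) (Metric.ball 0 ρ) := by
  set W : ℂ → ℂ := fun z => if φ z.re ≤ z.im then A z else B z with hW
  -- The derivative off the graph, with the default value 0 on the graph. It is bounded by the
  -- Lipschitz constants, hence integrable on rectangles.
  set D : ℂ → ℂ := fun z => if φ z.re < z.im then deriv A z else
    if z.im < φ z.re then deriv B z else 0 with hD
  have ho1 : IsOpen {z : ℂ | φ z.re < z.im} := isOpen_lt (by fun_prop) (by fun_prop)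
  have ho2 : IsOpen {z : ℂ | z.im < φ z.re} := isOpen_lt (by fun_prop) (by fun_prop)
  have hWd : ∀ z ∈ Metric.ball (0 : ℂ) ρ, z.im ≠ φ z.re → HasDerivAt W (D z) z := by
    intro z hz hne
    rcases lt_or_gt_of_ne hne with hlt | hlt
    · have e : D z = deriv B z := by simp [hD, hlt, hlt.le]
      rw [e]
      refine (hBd z hz hlt).hasDerivAt.congr_of_eventuallyEq ?_
      filter_upwards [ho2.mem_nhds hlt] with x hx
      simp only [hW, if_neg (not_le.mpr (show x.im < φ x.re from hx))]
    · have e : D z = deriv A z := by simp [hD, hlt]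
      rw [e]
      refine (hAd z hz hlt).hasDerivAt.congr_of_eventuallyEq ?_
      filter_upwards [ho1.mem_nhds hlt] with x hx
      simp only [hW, if_pos (show φ x.re < x.im from hx).le]
  have hWc : ContinuousOn W (Metric.ball 0 ρ) := by
    apply ContinuousOn.if
    · intro z hz
      have := frontier_le_subset_eq (f := fun z : ℂ => φ z.re) (g := fun z : ℂ => z.im)
        (by fun_prop) (by fun_prop) hz.2
      exact hAB z hz.1 this.symm
    · exact hA.continuous.continuousOn
    · exact hB.continuous.continuousOn
  have hDm : Measurable D :=
    Measurable.ite ho1.measurableSet (measurable_deriv A)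
      (Measurable.ite ho2.measurableSet (measurable_deriv B) measurable_const)
  have hDb : ∀ z, ‖D z‖ ≤ max CA CB := by
    intro z
    simp only [hD]
    split_ifs
    · exact (norm_deriv_le_of_lipschitz hA).trans (by exact_mod_cast le_max_left _ _)
    · exact (norm_deriv_le_of_lipschitz hB).trans (by exact_mod_cast le_max_right _ _)
    · simp
  have hInt : ∀ (p : ℝ → ℂ) (a b : ℝ), Continuous p →
      IntervalIntegrable (fun x => D (p x)) MeasureTheory.volume a b := by
    intro p a b hp
    rw [intervalIntegrable_iff]
    refine MeasureTheory.Measure.integrableOn_of_bounded (M := (max CA CB : NNReal)) (by simp)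
      (hDm.comp hp.measurable).aestronglyMeasurable ?_
    filter_upwards with x using by simpa using hDb (p x)
  -- Morera's theorem on rectangles. Each horizontal or vertical side meets the graph at most once,
  -- so the fundamental theorem with a countable exceptional set expresses differences of W as
  -- integrals of D; Fubini makes the two double integrals cancel.
  have hcons : Complex.IsConservativeOn W (Metric.ball 0 ρ) := by
    intro z w hzw
    have hmem : ∀ x ∈ uIcc z.re w.re, ∀ y ∈ uIcc z.im w.im,
        (x + y * Complex.I : ℂ) ∈ Metric.ball (0 : ℂ) ρ := by
      intro x hx y hy
      apply hzw
      refine ⟨?_, ?_⟩ <;> simpa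
    have hH : ∀ y ∈ uIcc z.im w.im, ∫ x in z.re..w.re, D (x + y * Complex.I)
        = W (w.re + y * Complex.I) - W (z.re + y * Complex.I) := by
      intro y hy
      apply MeasureTheory.integral_eq_of_hasDerivAt_off_countable
        (fun x : ℝ => W (x + y * Complex.I)) _ (s := {x | φ x = y})
      · apply Set.Subsingleton.countable
        intro x hx x' hx'
        exact hφ.injective (hx.trans hx'.symm)
      · exact hWc.comp (by fun_prop) fun x hx => hmem x hx y hy
      · rintro x ⟨hx, hxs⟩
        have hx' : x ∈ uIcc z.re w.re := Ioo_subset_Icc_self hx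
        have h1 := hWd _ (hmem x hx' y hy) (by simpa using fun h => hxs h.symm)
        have h2 : HasDerivAt (fun x : ℝ => (x + y * Complex.I : ℂ)) 1 x :=
          (Complex.ofRealCLM.hasDerivAt (x := x)).add_const _
        exact (HasDerivAt.comp x h1 h2).congr_deriv (mul_one _)
      · exact hInt _ _ _ (by fun_prop)
    have hV : ∀ x ∈ uIcc z.re w.re, Complex.I * ∫ y in z.im..w.im, D (x + y * Complex.I)
        = W (x + w.im * Complex.I) - W (x + z.im * Complex.I) := by
      intro x hx
      rw [← intervalIntegral.integral_const_mul]
      apply MeasureTheory.integral_eq_of_hasDerivAt_off_countable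
        (fun y : ℝ => W (x + y * Complex.I)) _ (s := {φ x}) (countable_singleton _)
      · exact hWc.comp (by fun_prop) fun y hy => hmem x hx y hy
      · rintro y ⟨hy, hys⟩
        have hy' : y ∈ uIcc z.im w.im := Ioo_subset_Icc_self hy
        have h1 := hWd _ (hmem x hx y hy') (by simpa using hys)
        have h2 : HasDerivAt (fun y : ℝ => (x + y * Complex.I : ℂ)) Complex.I y := by
          simpa using ((Complex.ofRealCLM.hasDerivAt (x := y)).mul_const Complex.I).const_add (x : ℂ)
        exact (HasDerivAt.comp y h1 h2).congr_deriv (mul_comm _ _)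
      · exact (hInt _ _ _ (by fun_prop)).const_mul _
    have hWi : ∀ y ∈ uIcc z.im w.im, IntervalIntegrable (fun x : ℝ => W (x + y * Complex.I))
        MeasureTheory.volume z.re w.re := fun y hy =>
      (hWc.comp (by fun_prop) fun x hx => hmem x hx y hy).intervalIntegrable
    have hWi' : ∀ x ∈ uIcc z.re w.re, IntervalIntegrable (fun y : ℝ => W (x + y * Complex.I))
        MeasureTheory.volume z.im w.im := fun x hx =>
      (hWc.comp (by fun_prop) fun y hy => hmem x hx y hy).intervalIntegrable
    rw [← add_eq_zero_iff_eq_neg, Complex.wedgeIntegral_add_wedgeIntegral_eq, add_sub_assoc,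
      ← smul_sub, ← intervalIntegral.integral_sub (hWi _ left_mem_uIcc) (hWi _ right_mem_uIcc),
      ← intervalIntegral.integral_sub (hWi' _ right_mem_uIcc) (hWi' _ left_mem_uIcc)]
    have e1 : ∫ x in z.re..w.re, (W (x + z.im * Complex.I) - W (x + w.im * Complex.I))
        = ∫ x in z.re..w.re, ∫ y in z.im..w.im, -(Complex.I * D (x + y * Complex.I)) := by
      apply intervalIntegral.integral_congr
      intro x hx
      simp only
      rw [intervalIntegral.integral_neg, intervalIntegral.integral_const_mul, hV x hx]
      ring
    have e2 : ∫ y in z.im..w.im, (W (w.re + y * Complex.I) - W (z.re + y * Complex.I))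
        = ∫ y in z.im..w.im, ∫ x in z.re..w.re, D (x + y * Complex.I) := by
      apply intervalIntegral.integral_congr
      intro y hy
      simp only
      rw [hH y hy]
    have e3 : ∫ x in z.re..w.re, ∫ y in z.im..w.im, D (x + y * Complex.I)
        = ∫ y in z.im..w.im, ∫ x in z.re..w.re, D (x + y * Complex.I) := by
      apply MeasureTheory.intervalIntegral_intervalIntegral_swap
      have hm : Measurable fun p : ℝ × ℝ => (p.1 + p.2 * Complex.I : ℂ) := by fun_prop
      refine MeasureTheory.Measure.integrableOn_of_bounded (M := (max CA CB : NNReal)) ?_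
        (hDm.comp hm).aestronglyMeasurable ?_
      · rw [MeasureTheory.Measure.volume_eq_prod, MeasureTheory.Measure.prod_prod]
        simp [uIoc, ENNReal.mul_eq_top]
      · filter_upwards with p using (hDb _).trans_eq (by simp)
    rw [e1, e2, ← e3]
    simp only [intervalIntegral.integral_neg, intervalIntegral.integral_const_mul, smul_eq_mul]
    ring
  exact (hcons.isExactOn_ball hWc).differentiableOn Metric.isOpen_ball

theorem dz_neg_comp_neg (v : ℂ → ℝ) (z : ℂ) : dz (fun w => v (-w)) z = -dz v (-z) := by
  unfold dz
  have h : fderiv ℝ (fun w => v (-w)) z = -fderiv ℝ v (-z) := by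
    have := (ContinuousLinearEquiv.neg ℝ (M := ℂ)).comp_right_fderiv (f := v) (x := z)
    ext w
    have h2 := congrArg (fun L => L w) this
    simpa [Function.comp_def] using h2
  rw [h]
  simp; ring

theorem harmonicAt_comp_of_differentiable {v : ℂ → ℝ} {g : ℂ → ℂ} (hg : Differentiable ℂ g) {z : ℂ}
    (h : HarmonicAt v (g z)) : HarmonicAt (fun w => v (g w)) z := by
  obtain ⟨r, hr, hball⟩ := Metric.eventually_nhds_iff_ball.mp h.eventually
  obtain ⟨F, hF, hFe⟩ := HarmonicOnNhd.exists_analyticOnNhd_ball_re_eq (f := v) hball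
  have hgz : g z ∈ Metric.ball (g z) r := Metric.mem_ball_self hr
  have h1 : AnalyticAt ℂ (fun w => F (g w)) z := (hF _ hgz).comp (hg.analyticAt z)
  refine (harmonicAt_congr_nhds ?_).mp h1.harmonicAt_re
  filter_upwards [hg.continuous.continuousAt.preimage_mem_nhds (Metric.ball_mem_nhds (g z) hr)]
    with w hw using hFe hw

/-- A function that vanishes on the arc, is harmonic on both sides of it and has equal normal
limits of the gradient from both sides is harmonic across the arc. -/
theorem LocalArc.harmonicAt_zero {κ κ' : ℝ → ℂ} {φ : ℝ → ℝ} {δ ρ K : ℝ}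
    (h : LocalArc κ κ' φ δ ρ K) {v : ℂ → ℝ} {M : ℝ}
    (hup : HarmonicOnNhd v (upper φ ρ)) (hlow : HarmonicOnNhd v (lower φ ρ))
    (hM : ∀ z ∈ square ρ, |v z| ≤ M)
    (hz : ∀ p ∈ square ρ, p.im = φ p.re → v p = 0 ∧ ContinuousAt v p) {q : ℝ → ℂ}
    (hqu : ∀ t, |t| < δ → κ t ∈ square ρ →
      Tendsto (fun ε : ℝ => dz v (κ t + ε * Complex.I)) (𝓝[>] 0) (𝓝 (q t)))
    (hql : ∀ t, |t| < δ → κ t ∈ square ρ →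
      Tendsto (fun ε : ℝ => dz v (κ t - ε * Complex.I)) (𝓝[>] 0) (𝓝 (q t))) :
    HarmonicAt v 0 := by
  have hneg : ∀ {r : ℝ} {z : ℂ}, z ∈ square r → -z ∈ square r := fun hz => by
    simpa [square] using hz
  obtain ⟨ρ₁, hρ₁, hρ₁ρ, A, ⟨CA, hA⟩, hAu, hAκ⟩ := h.exists_lipschitz_primitive hup
    (fun z hz => hM z hz.1) (fun p hp hpe => by
      have := (hz p hp hpe).2.tendsto
      rw [(hz p hp hpe).1] at this
      exact this.mono_left nhdsWithin_le_nhds) hqu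
  have hupneg : ∀ {r : ℝ} {z : ℂ}, z ∈ upper (fun x => -φ (-x)) r ↔ -z ∈ lower φ r := by
    intro r z
    simp only [upper, lower, square, mem_ofPred_eq, Complex.neg_re, Complex.neg_im, abs_neg]
    constructor <;> rintro ⟨h1, h2⟩ <;> exact ⟨h1, by linarith⟩
  -- The point reflection z ↦ -z carries the lower side to the upper side of the reflected arc,
  -- which is again increasing; the boundary derivative becomes -q(-t).
  obtain ⟨ρ₂, hρ₂, hρ₂ρ, B, ⟨CB, hB⟩, hBu, hBκ⟩ := h.reflect.exists_lipschitz_primitive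
    (u := fun z => v (-z)) (q := fun t => -q (-t)) (M := M)
    (fun z hz => harmonicAt_comp_of_differentiable (g := fun z => -z) (by fun_prop)
      (hlow (-z) (hupneg.mp hz)))
    (fun z hz => hM _ (hneg hz.1))
    (fun p hp hpe => by
      have h1 := hz (-p) (hneg hp) (by simp at hpe ⊢; linarith)
      have h2 : ContinuousAt (fun z => v (-z)) p :=
        ContinuousAt.comp (f := fun z : ℂ => -z) h1.2 (by fun_prop)
      have := h2.tendsto
      rw [h1.1] at this
      exact this.mono_left nhdsWithin_le_nhds)
    (fun t ht htρ => by
      have h1 := hql (-t) (by simpa using ht) (by simpa using hneg htρ)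
      refine h1.neg.congr fun ε => ?_
      rw [dz_neg_comp_neg]
      congr 2; ring)
  set ρ₃ : ℝ := min ρ₁ ρ₂ / 4 with hρ₃
  have hρ₃0 : 0 < ρ₃ := by positivity
  have hρ₃1 : 4 * ρ₃ ≤ ρ₁ := by linarith [min_le_left ρ₁ ρ₂]
  have hρ₃2 : 4 * ρ₃ ≤ ρ₂ := by linarith [min_le_right ρ₁ ρ₂]
  set c : ℂ := A 0 - B 0 with hc
  have hκ0 : κ 0 = 0 := h.zero
  have harc : ∀ z ∈ Metric.ball (0 : ℂ) ρ₃, z.im = φ z.re →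
      ∃ t, |t| < ρ₁ ∧ |t| < ρ₂ ∧ κ t = z := by
    intro z hzb hze
    have hzr : |z.re| < ρ₃ := (Complex.abs_re_le_norm z).trans_lt (by simpa using hzb)
    obtain ⟨t, ht, htx⟩ := h.surj z.re (by linarith)
    have h1 := (Complex.abs_re_le_norm _).trans (h.secant 0 t (by simpa using h.δ_pos) ht)
    simp [hκ0] at h1
    rw [htx] at h1
    have h2 := abs_sub_abs_le_abs_sub t z.re
    rw [abs_sub_comm] at h2
    refine ⟨t, by linarith, by linarith, ?_⟩
    apply Complex.ext htx
    rw [← h.graph t ht, htx, hze]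
  have hABarc : ∀ z ∈ Metric.ball (0 : ℂ) ρ₃, z.im = φ z.re → A z = B (-z) + c := by
    intro z hzb hze
    obtain ⟨t, ht1, ht2, rfl⟩ := harc z hzb hze
    have a1 := (hAκ t ht1).2.2
    have b1 := (hBκ (-t) (by simpa using ht2)).2.2
    -- Both completions have the same increment along the arc, so after reflecting back they differ
    -- there by a constant c.
    have e : ∫ s in (0 : ℝ)..-t, -q (-s) * κ' (-s) = ∫ s in (0 : ℝ)..t, q s * κ' s := by
      have := intervalIntegral.integral_comp_neg (a := 0) (b := -t) (fun s => q s * κ' s)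
      simp only [neg_neg, neg_zero] at this
      simp only [neg_mul, intervalIntegral.integral_neg]
      rw [this, intervalIntegral.integral_symm, neg_neg]
    rw [e] at b1
    simp only [neg_neg, neg_zero, hκ0] at a1 b1
    rw [hc]
    linear_combination a1 - b1
  -- Both real parts vanish on the arc, so c is imaginary and adding it leaves the harmonic function
  -- unchanged.
  have hcre : c.re = 0 := by
    have a1 := (hAκ 0 (by simpa using hρ₁)).2.1
    have b1 := (hBκ 0 (by simpa using hρ₂)).2.1
    simp only [neg_zero, hκ0] at a1 b1
    simp [hc, a1, b1]
  have hmemu : ∀ z ∈ Metric.ball (0 : ℂ) ρ₃, φ z.re < z.im → z ∈ upper φ ρ₁ := fun z hzb hlt =>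
    ⟨mem_square_of_norm_lt ((mem_ball_zero_iff.mp hzb).trans_le (by linarith)), hlt⟩
  have hmeml : ∀ z ∈ Metric.ball (0 : ℂ) ρ₃, z.im < φ z.re →
      -z ∈ upper (fun x => -φ (-x)) ρ₂ := fun z hzb hlt => by
    rw [hupneg, neg_neg]
    exact ⟨mem_square_of_norm_lt ((mem_ball_zero_iff.mp hzb).trans_le (by linarith)), hlt⟩
  have hB' : LipschitzWith CB (fun z => B (-z) + c) := by
    apply LipschitzWith.of_dist_le_mul
    intro x y
    simpa using hB.dist_le_mul (-x) (-y)
  have hdiff := differentiableOn_ite_graph h.continuous_graph (fun _ _ => h.lt_of_lt) hA hB'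
    (fun z hzb hlt => (hAu z (hmemu z hzb hlt)).1.differentiableAt)
    (fun z hzb hlt => by
      have h1 := (hBu _ (hmeml z hzb hlt)).1.differentiableAt
      exact (DifferentiableAt.comp z (f := fun z : ℂ => -z) h1 (by fun_prop)).add_const c)
    hABarc
  have han := hdiff.analyticAt (Metric.ball_mem_nhds (0 : ℂ) hρ₃0)
  refine (harmonicAt_congr_nhds ?_).mp han.harmonicAt_re
  filter_upwards [Metric.ball_mem_nhds (0 : ℂ) hρ₃0] with z hzb
  rcases lt_trichotomy (φ z.re) z.im with hlt | heq | hlt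
  · rw [if_pos hlt.le]; exact (hAu z (hmemu z hzb hlt)).2
  · rw [if_pos heq.le]
    obtain ⟨t, ht1, ht2, rfl⟩ := harc z hzb heq.symm
    rw [(hAκ t ht1).2.1, (hz _ (mem_square_of_norm_lt ((mem_ball_zero_iff.mp hzb).trans_le
      (by linarith))) heq.symm).1]
  · rw [if_neg (not_le.mpr hlt), Complex.add_re, hcre, add_zero,
      (hBu _ (hmeml z hzb hlt)).2, neg_neg]

/-! ### Charts at the regular points of the curve -/

/-- A Lipschitz bound on κ' yields the quadratic Taylor error. Nearness of κ' to 1 + i makes Re κ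
injective, so the arc is a graph with slope near 1. -/
theorem exists_localArc {κ : ℝ → ℂ} (hκ : ContDiffAt ℝ 2 κ 0) (h0 : κ 0 = 0)
    (hd : deriv κ 0 = 1 + Complex.I) {δ₀ : ℝ} (hδ₀ : 0 < δ₀) :
    ∃ (φ : ℝ → ℝ) (δ ρ K : ℝ), δ ≤ δ₀ ∧ LocalArc κ (deriv κ) φ δ ρ K := by
  have hd1 : ContDiffAt ℝ 1 (deriv κ) 0 := by
    have h1 : ContDiffAt ℝ 1 (fun t => fderiv ℝ κ t 1) 0 :=
      (hκ.fderiv_right (m := 1) (by norm_num)).clm_apply contDiffAt_const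
    simpa using h1
  obtain ⟨K₀, s, hs, hLip⟩ := hd1.exists_lipschitzOnWith
  have hnear : ∀ᶠ t in 𝓝 (0 : ℝ), ‖deriv κ t - (1 + Complex.I)‖ ≤ 1 / 20 := by
    have h1 : ContinuousAt (fun t => ‖deriv κ t - (1 + Complex.I)‖) 0 :=
      (hd1.continuousAt.sub continuousAt_const).norm
    have h2 := h1.eventually_lt_const (u := 1 / 20) (by simp [hd])
    exact h2.mono fun t ht => ht.le
  have hdiff : ∀ᶠ t in 𝓝 (0 : ℝ), HasDerivAt κ (deriv κ t) t := by
    filter_upwards [hκ.eventually (by simp)] with t ht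
    exact (ht.differentiableAt two_ne_zero).hasDerivAt
  obtain ⟨δ₁, hδ₁, hball⟩ := Metric.eventually_nhds_iff.mp ((hnear.and hdiff).and hs)
  set δ : ℝ := min δ₀ δ₁ with hδdef
  have hδ : 0 < δ := lt_min hδ₀ hδ₁
  have hall : ∀ t, |t| < δ → ‖deriv κ t - (1 + Complex.I)‖ ≤ 1 / 20 ∧ HasDerivAt κ (deriv κ t) t ∧
      t ∈ s := by
    intro t ht
    have := @hball t (by simpa using ht.trans_le (min_le_right _ _))
    exact ⟨this.1.1, this.1.2, this.2⟩
  have hsecgen : ∀ a b : ℝ, |a| < δ → |b| < δ → ∀ (k : ℂ) (C : ℝ),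
      (∀ x ∈ uIcc a b, ‖deriv κ x - k‖ ≤ C) → ‖κ b - κ a - (b - a) * k‖ ≤ C * |b - a| := by
    intro a b ha hb k C hC
    have hx : ∀ x ∈ uIcc a b, |x| < δ := by
      intro x hx
      rw [abs_lt] at ha hb ⊢
      rcases le_total a b with h | h
      · rw [uIcc_of_le h] at hx; exact ⟨by linarith [hx.1], by linarith [hx.2]⟩
      · rw [uIcc_of_ge h] at hx; exact ⟨by linarith [hx.1], by linarith [hx.2]⟩
    have hF : ∀ x ∈ uIcc a b, HasDerivWithinAt (fun x : ℝ => κ x - x * k) (deriv κ x - k)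
        (uIcc a b) x := by
      intro x hx'
      have h1 : HasDerivAt (fun x : ℝ => (x : ℂ) * k) (1 * k) x :=
        (Complex.ofRealCLM.hasDerivAt (x := x)).mul_const k
      rw [one_mul] at h1
      exact ((hall x (hx x hx')).2.1.sub h1).hasDerivWithinAt
    have := (convex_uIcc a b).norm_image_sub_le_of_norm_hasDerivWithin_le hF hC left_mem_uIcc
      right_mem_uIcc
    rw [Real.norm_eq_abs] at this
    have e : κ b - κ a - (b - a) * k = κ b - b * k - (κ a - a * k) := by ring
    rwa [e]
  have hxlt : ∀ a b : ℝ, |a| < δ → |b| < δ → ∀ x ∈ uIcc a b, |x| < δ := by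
    intro a b ha hb x hx
    rw [abs_lt] at ha hb ⊢
    rcases le_total a b with h | h
    · rw [uIcc_of_le h] at hx; exact ⟨by linarith [hx.1], by linarith [hx.2]⟩
    · rw [uIcc_of_ge h] at hx; exact ⟨by linarith [hx.1], by linarith [hx.2]⟩
  have hsec : ∀ a b, |a| < δ → |b| < δ →
      ‖κ b - κ a - (b - a) * (1 + Complex.I)‖ ≤ 1 / 20 * |b - a| := fun a b ha hb =>
    hsecgen a b ha hb _ _ fun x hx => (hall x (hxlt a b ha hb x hx)).1
  have hre : ∀ a b, |a| < δ → |b| < δ → 19 / 20 * |b - a| ≤ |(κ b).re - (κ a).re| := by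
    intro a b ha hb
    have h1 := (Complex.abs_re_le_norm _).trans (hsec a b ha hb)
    simp at h1
    have := abs_sub_abs_le_abs_sub (b - a) ((κ b).re - (κ a).re)
    rw [abs_sub_comm (b - a) ((κ b).re - (κ a).re)] at this
    linarith
  have hinj : InjOn (fun t => (κ t).re) (Ioo (-δ) δ) := by
    intro a ha b hb hab
    have := hre a b (abs_lt.mpr ha) (abs_lt.mpr hb)
    simp only at hab
    rw [hab, sub_self, abs_zero] at this
    have h2 : |b - a| = 0 := le_antisymm (by linarith) (abs_nonneg _)
    linarith [abs_eq_zero.mp h2]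
  set τ := Function.invFunOn (fun t => (κ t).re) (Ioo (-δ) δ)
  have hτ : ∀ t ∈ Ioo (-δ) δ, τ (κ t).re = t := fun t ht => hinj.leftInvOn_invFunOn ht
  -- The deviation of the graph from the diagonal is extended, rather than the graph itself, so that
  -- the slope bound for φ holds on the whole real line.
  have hψ : LipschitzOnWith (1 / 10) (fun x => (κ (τ x)).im - x)
      ((fun t => (κ t).re) '' Ioo (-δ) δ) := by
    apply LipschitzOnWith.of_dist_le_mul
    rintro _ ⟨b, hb, rfl⟩ _ ⟨a, ha, rfl⟩
    simp only [hτ a ha, hτ b hb, Real.dist_eq]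
    have ha' := abs_lt.mpr ha
    have hb' := abs_lt.mpr hb
    have h1 := hsec a b ha' hb'
    have h2 := hre a b ha' hb'
    set E := κ b - κ a - (b - a) * (1 + Complex.I) with hE
    have h3 : (κ b).im - (κ b).re - ((κ a).im - (κ a).re) = E.im - E.re := by
      simp [hE]; ring
    rw [h3]
    -- The sharp constant √2 is rounded up to 3/2; then (3/2)(1/20)(20/19) ≤ 1/10.
    have h4 : |E.im - E.re| ≤ 3 / 2 * ‖E‖ := by
      apply abs_le_of_sq_le_sq _ (by positivity)
      have : ‖E‖ ^ 2 = E.re ^ 2 + E.im ^ 2 := by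
        rw [← Complex.normSq_eq_norm_sq, Complex.normSq_apply]; ring
      nlinarith [sq_nonneg (E.im + E.re), sq_nonneg E.im, sq_nonneg E.re]
    have h5 : ((1 / 10 : NNReal) : ℝ) = 1 / 10 := by norm_num
    rw [h5]
    linarith [abs_nonneg (b - a)]
  obtain ⟨ψ, hψL, hψe⟩ := hψ.extend_real
  refine ⟨fun x => x + ψ x, δ, δ / 4, K₀ + 1, min_le_left _ _, hδ, by positivity, by positivity,
    fun t ht => (hall t ht).2.1, hLip.continuousOn.mono fun t ht => (hall t (abs_lt.mpr ht)).2.2,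
    fun t ht => (hall t ht).1, ?_, hsec, ?_, ?_, ?_, h0⟩
  · intro a b ha hb
    have := hsecgen a b ha hb (deriv κ a) (K₀ * |b - a|) ?_
    · refine this.trans ?_
      rw [mul_assoc, ← sq, sq_abs]
      have := sq_nonneg (b - a)
      linarith
    · intro x hx
      have h1 := hLip.dist_le_mul x (hall x (hxlt a b ha hb x hx)).2.2 a (hall a ha).2.2
      rw [dist_eq_norm, Real.dist_eq] at h1
      refine h1.trans ?_
      have := abs_sub_left_of_mem_uIcc hx
      gcongr
  · intro t ht
    have := hψe (mem_image_of_mem (fun t => (κ t).re) (abs_lt.mp ht))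
    simp only [hτ t (abs_lt.mp ht)] at this
    simp only [← this]
    ring
  · intro x hx
    have h1 := hre 0 (δ / 2) (by simpa using hδ) (by rw [abs_of_pos] <;> linarith)
    have hcont : ContinuousOn (fun t => (κ t).re) (Icc (-(δ / 2)) (δ / 2)) := fun t ht =>
      (Complex.continuous_re.continuousAt.comp
        (hall t (abs_lt.mpr ⟨by linarith [ht.1], by linarith [ht.2]⟩)).2.1.continuousAt
        ).continuousWithinAt
    have hp := (abs_le.mp ((Complex.abs_re_le_norm _).trans (hsec 0 (δ / 2) (by simpa using hδ)
      (by rw [abs_of_pos] <;> linarith)))).1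
    have hm := (abs_le.mp ((Complex.abs_re_le_norm _).trans (hsec 0 (-(δ / 2)) (by simpa using hδ)
      (by rw [abs_neg, abs_of_pos] <;> linarith)))).2
    simp [h0] at hp hm
    rw [abs_of_pos (half_pos hδ)] at hp hm
    have hx' := abs_lt.mp hx
    obtain ⟨t, ht, htx⟩ := intermediate_value_Icc (by linarith) hcont
      (show x ∈ Icc (κ (-(δ / 2))).re (κ (δ / 2)).re from ⟨by linarith, by linarith⟩)
    exact ⟨t, abs_lt.mpr ⟨by linarith [ht.1], by linarith [ht.2]⟩, htx⟩
  · intro x y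
    have := hψL.dist_le_mul x y
    rw [Real.dist_eq, Real.dist_eq] at this
    have e : x + ψ x - (y + ψ y) - (x - y) = ψ x - ψ y := by ring
    rw [e]
    exact this.trans (le_of_eq (by norm_num))

theorem IsPiecewiseRegularJordan.exists_int_of_eq {γ : ℝ → ℂ} (hγ : IsPiecewiseRegularJordan γ)
    {s t : ℝ} (h : γ s = γ t) : ∃ n : ℤ, s = t + n := by
  have hf : ∀ s, γ (Int.fract s) = γ s := fun s => by
    have := hγ.periodic.sub_int_mul_eq (x := s) ⌊s⌋
    rwa [mul_one] at this
  have h1 : γ (Int.fract s) = γ (Int.fract t) := by rw [hf, hf, h]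
  have h2 := hγ.injOn ⟨Int.fract_nonneg s, Int.fract_lt_one s⟩
    ⟨Int.fract_nonneg t, Int.fract_lt_one t⟩ h1
  refine ⟨⌊s⌋ - ⌊t⌋, ?_⟩
  have h3 := Int.floor_add_fract s
  have h4 := Int.floor_add_fract t
  push_cast
  linarith

theorem IsPiecewiseRegularJordan.range_subset {γ : ℝ → ℂ} (hγ : IsPiecewiseRegularJordan γ)
    (t₀ : ℝ) {δ : ℝ} (hδ : 0 < δ) :
    range γ ⊆ (fun t => γ (t₀ + t)) '' Ioo (-δ) δ ∪ γ '' Icc (t₀ + δ) (t₀ + 1 - δ) := by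
  rintro _ ⟨s, rfl⟩
  obtain ⟨y, hy, hye⟩ := hγ.periodic.exists_mem_Ico one_pos s (t₀ - δ / 2)
  rw [hye]
  by_cases h1 : y < t₀ + δ
  · exact Or.inl ⟨y - t₀, ⟨by linarith [hy.1], by linarith⟩, by simp⟩
  by_cases h2 : y ≤ t₀ + 1 - δ
  · exact Or.inr ⟨y, ⟨not_lt.mp h1, h2⟩, rfl⟩
  · refine Or.inl ⟨y - t₀ - 1, ⟨by linarith [not_le.mp h2], by linarith [hy.2]⟩, ?_⟩
    have := hγ.periodic.sub_eq y
    simp only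
    rw [← this]
    congr 1; ring

/-- Dividing by ω = γ'(t₀)/(1 + i) turns the tangent to 1 + i. The rest of the period is compact
and, by injectivity, misses γ(t₀); a small square therefore meets the curve only in the local graph.
-/
theorem IsPiecewiseRegularJordan.exists_chart {γ : ℝ → ℂ} (hγ : IsPiecewiseRegularJordan γ)
    {t₀ : ℝ} (ht₀ : IsRegularParam γ t₀) {δ₀ : ℝ} (hδ₀ : 0 < δ₀) :
    ∃ (ω : ℂ) (κ' : ℝ → ℂ) (φ : ℝ → ℝ) (δ ρ K : ℝ), ω ≠ 0 ∧ δ ≤ δ₀ ∧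
      LocalArc (fun t => (γ (t₀ + t) - γ t₀) / ω) κ' φ δ ρ K ∧
      ∀ ζ ∈ square ρ, γ t₀ + ω * ζ ∈ range γ ↔ ζ.im = φ ζ.re := by
  have hI : (1 + Complex.I) ≠ 0 := by
    intro h; have := congrArg Complex.re h; simp at this
  set ω : ℂ := deriv γ t₀ / (1 + Complex.I) with hω
  have hω0 : ω ≠ 0 := div_ne_zero ht₀.2 hI
  have hc2 : ContDiffAt ℝ 2 γ t₀ := contDiffAt_infty.mp ht₀.1 2
  have hcκ : ContDiffAt ℝ 2 (fun t => (γ (t₀ + t) - γ t₀) / ω) 0 := by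
    have h1 : ContDiffAt ℝ 2 (fun t => γ (t₀ + t)) 0 :=
      ContDiffAt.comp (0 : ℝ) (f := fun t => t₀ + t) (by simpa using hc2) (by fun_prop)
    exact (h1.sub contDiffAt_const).div_const ω
  have hdκ : deriv (fun t => (γ (t₀ + t) - γ t₀) / ω) 0 = 1 + Complex.I := by
    rw [deriv_div_const, deriv_sub_const, deriv_comp_const_add, add_zero, hω]
    field_simp [ht₀.2]
  obtain ⟨φ, δ, ρ₀, K, hδ, h⟩ := exists_localArc hcκ (by simp) hdκ
    (lt_min hδ₀ (show (0 : ℝ) < 1 / 4 by norm_num))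
  have hδpos := h.δ_pos
  have hδ4 : δ ≤ 1 / 4 := hδ.trans (min_le_right _ _)
  have hAc : IsClosed (γ '' Icc (t₀ + δ) (t₀ + 1 - δ)) :=
    (isCompact_Icc.image hγ.continuous).isClosed
  have hnot : γ t₀ ∉ γ '' Icc (t₀ + δ) (t₀ + 1 - δ) := by
    rintro ⟨s, hs, hse⟩
    obtain ⟨n, hn⟩ := hγ.exists_int_of_eq hse
    have h1 : (n : ℝ) < 1 := by linarith [hs.2]
    have h2 : (0 : ℝ) < n := by linarith [hs.1]
    have h3 : n < 1 := by exact_mod_cast h1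
    have h4 : 0 < n := by exact_mod_cast h2
    omega
  obtain ⟨η, hη, hball⟩ := Metric.isOpen_iff.mp hAc.isOpen_compl _ hnot
  have hωn : 0 < ‖ω‖ := norm_pos_iff.mpr hω0
  have hρ0 := h.ρ_pos
  set ρ := min ρ₀ (η / (2 * ‖ω‖)) with hρ
  refine ⟨ω, _, φ, δ, ρ, K, hω0, hδ.trans (min_le_left _ _),
    h.mono (lt_min hρ0 (by positivity)) (min_le_left _ _), fun ζ hζ => ⟨fun hr => ?_, fun hr => ?_⟩⟩
  · rcases hγ.range_subset t₀ hδpos hr with ⟨t, ht, hte⟩ | hA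
    · have : ζ = (γ (t₀ + t) - γ t₀) / ω := by
        rw [eq_div_iff hω0]; simp only at hte; rw [hte]; ring
      rw [this]
      exact (h.graph t (abs_lt.mpr ht)).symm
    · exfalso
      refine hball ?_ hA
      rw [Metric.mem_ball, dist_eq_norm, add_sub_cancel_left, norm_mul]
      have h1 : ‖ζ‖ < 2 * ρ := (Complex.norm_le_abs_re_add_abs_im ζ).trans_lt
        (by linarith [hζ.1, hζ.2])
      have h2 : 2 * ρ ≤ η / ‖ω‖ := by
        have := min_le_right ρ₀ (η / (2 * ‖ω‖))
        calc 2 * ρ ≤ 2 * (η / (2 * ‖ω‖)) := by linarith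
          _ = η / ‖ω‖ := by field_simp
      rw [le_div_iff₀ hωn] at h2
      nlinarith
  · obtain ⟨t, ht, htx⟩ := h.surj ζ.re (hζ.1.trans_le (min_le_left _ _))
    refine ⟨t₀ + t, ?_⟩
    have : ζ = (γ (t₀ + t) - γ t₀) / ω := by
      apply Complex.ext htx.symm
      rw [hr, ← htx]
      exact h.graph t ht
    rw [this]
    field_simp
    ring

/-! ### The two domains of the curve -/

theorem isOpen_one_lt_norm : IsOpen {z : ℂ | 1 < ‖z‖} := isOpen_lt continuous_const continuous_norm

theorem IsInnerConformal.isOpen {γ : ℝ → ℂ} {f : ℂ → ℂ} (hf : IsInnerConformal γ f) :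
    IsOpen (inner γ) :=
  hf.2.image_eq ▸ isOpen_image_of_injOn Metric.isOpen_ball hf.1 hf.2.injOn

theorem IsOuterConformal.isOpen {γ : ℝ → ℂ} {g : ℂ → ℂ} (hg : IsOuterConformal γ g) :
    IsOpen (outer γ) :=
  hg.2.1.image_eq ▸ isOpen_image_of_injOn isOpen_one_lt_norm hg.1 hg.2.1.injOn

theorem IsInnerConformal.isPreconnected {γ : ℝ → ℂ} {f : ℂ → ℂ} (hf : IsInnerConformal γ f) :
    IsPreconnected (inner γ) :=
  hf.2.image_eq ▸ (convex_ball (0 : ℂ) 1).isPreconnected.image f hf.1.continuousOn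

theorem inner_union_outer (γ : ℝ → ℂ) : inner γ ∪ outer γ = (range γ)ᶜ := by
  ext z
  simp only [inner, outer, mem_union, mem_ofPred_eq]
  tauto

theorem disjoint_inner_outer (γ : ℝ → ℂ) : Disjoint (inner γ) (outer γ) :=
  Set.disjoint_left.mpr fun _ h1 h2 => h2.2 h1.2

theorem IsInnerConformal.mem {γ : ℝ → ℂ} {f : ℂ → ℂ} (hf : IsInnerConformal γ f) :
    f 0 ∈ inner γ := hf.2.mapsTo (by simp)

/-- The image of the disc is connected and misses the curve, so it lies in one component, which is
bounded by definition of `inner`. -/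
theorem IsInnerConformal.isBounded {γ : ℝ → ℂ} {f : ℂ → ℂ} (hf : IsInnerConformal γ f) :
    Bornology.IsBounded (inner γ) :=
  hf.mem.2.subset (hf.isPreconnected.subset_connectedComponentIn hf.mem fun _ hz => hz.1)

/-- The complement of the curve is the disjoint union of two open sets, so the closure of one cannot
meet the other. -/
theorem frontier_inner_subset {γ : ℝ → ℂ} (hi : IsOpen (inner γ)) (ho : IsOpen (outer γ)) :
    frontier (inner γ) ⊆ range γ := by
  intro p hp
  rw [hi.frontier_eq] at hp
  by_contra hr
  rcases (inner_union_outer γ).symm ▸ (show p ∈ (range γ)ᶜ from hr) with h | h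
  · exact hp.2 h
  · exact ((disjoint_inner_outer γ).closure_left ho).le_bot ⟨hp.1, h⟩

theorem frontier_outer_subset {γ : ℝ → ℂ} (hi : IsOpen (inner γ)) (ho : IsOpen (outer γ)) :
    frontier (outer γ) ⊆ range γ := by
  intro p hp
  rw [ho.frontier_eq] at hp
  by_contra hr
  rcases (inner_union_outer γ).symm ▸ (show p ∈ (range γ)ᶜ from hr) with h | h
  · exact ((disjoint_inner_outer γ).symm.closure_left hi).le_bot ⟨hp.1, h⟩
  · exact hp.2 h

/-! ### Green's functions -/

/-- Properness: f(C) is compact and misses p, so preimages of points tending to p leave C. -/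
theorem eventually_leftInverse_notMem {f k : ℂ → ℂ} {U C : Set ℂ} (hf : ContinuousOn f U)
    (hk : ∀ w ∈ U, k (f w) = w) (hC : IsCompact C) (hCU : C ⊆ U) {p : ℂ} (hp : p ∉ f '' U) :
    ∀ᶠ z in 𝓝[f '' U] p, k z ∈ U \ C := by
  have h1 : IsClosed (f '' C) := (hC.image_of_continuousOn (hf.mono hCU)).isClosed
  have h2 : p ∉ f '' C := fun h => hp (image_mono hCU h)
  filter_upwards [nhdsWithin_le_nhds (h1.isOpen_compl.mem_nhds h2), self_mem_nhdsWithin]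
    with z hz hzU
  obtain ⟨w, hw, rfl⟩ := hzU
  rw [hk w hw]
  exact ⟨hw, fun h => hz (mem_image_of_mem f h)⟩

theorem IsGreenFunction.eqOn_of_isBounded {E : Set ℂ} (hE : IsOpen E)
    (hEb : Bornology.IsBounded E) {p : ℂ} (hp : p ∈ E) {G₁ G₂ : ℂ → ℝ}
    (h₁ : IsGreenFunction E (p : OnePoint ℂ) G₁) (h₂ : IsGreenFunction E (p : OnePoint ℂ) G₂) :
    ∀ z ∈ E, z ≠ p → G₁ z = G₂ z := by
  have key : ∀ G₁ G₂ : ℂ → ℝ, IsGreenFunction E (p : OnePoint ℂ) G₁ →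
      IsGreenFunction E (p : OnePoint ℂ) G₂ → ∀ z ∈ E, z ≠ p → G₁ z ≤ G₂ z := by
    intro G₁ G₂ h₁ h₂ z hz hzp
    obtain ⟨⟨H₁, hH₁, hG₁⟩, -⟩ := h₁.1.1 p rfl
    obtain ⟨⟨H₂, hH₂, hG₂⟩, -⟩ := h₂.1.1 p rfl
    have := harmonic_le_of_boundary hE (hH₁.sub hH₂) (m := 0) ?_ ?_ z hz
    · simp only [Pi.sub_apply] at this
      rw [hG₁ z hz hzp, hG₂ z hz hzp]
      linarith
    · intro q hq ε hε
      have hqp : q ≠ p := by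
        rintro rfl
        rw [hE.frontier_eq] at hq
        exact hq.2 hp
      have h3 := ((h₁.2 q hq).sub (h₂.2 q hq)).eventually_lt_const
        (show (0 : ℝ) - 0 < ε by simpa using hε)
      filter_upwards [h3, self_mem_nhdsWithin, nhdsWithin_le_nhds (isOpen_ne.mem_nhds hqp)]
        with z h4 h5 h6
      rw [hG₁ z h5 h6, hG₂ z h5 h6] at h4
      simp only [Pi.sub_apply]
      linarith
    · intro ε _
      rw [eventually_inf_principal]
      filter_upwards [Bornology.isCobounded_compl_iff.mpr hEb] with z h4 h5
      exact absurd h5 h4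
  exact fun z hz hzp => le_antisymm (key G₁ G₂ h₁ h₂ z hz hzp) (key G₂ G₁ h₂ h₁ z hz hzp)

theorem tendsto_log_norm_cobounded :
    Tendsto (fun z : ℂ => Real.log ‖z‖) (Bornology.cobounded ℂ) atTop :=
  Real.tendsto_log_atTop.comp tendsto_norm_cobounded_atTop

/-- G₁ - G₂ has a limit at infinity that might be positive. Subtracting ε G₂, which tends to +∞
there and to 0 at the frontier, makes the maximum principle applicable; then ε → 0. -/
theorem IsGreenFunction.eqOn_of_infty {E : Set ℂ} (hE : IsOpen E) {G₁ G₂ : ℂ → ℝ}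
    (h₁ : IsGreenFunction E OnePoint.infty G₁) (h₂ : IsGreenFunction E OnePoint.infty G₂) :
    ∀ z ∈ E, G₁ z = G₂ z := by
  have key : ∀ G₁ G₂ : ℂ → ℝ, IsGreenFunction E OnePoint.infty G₁ →
      IsGreenFunction E OnePoint.infty G₂ → ∀ z ∈ E, G₁ z ≤ G₂ z := by
    intro G₁ G₂ h₁ h₂ z hz
    obtain ⟨hG₁, c₁, hc₁⟩ := h₁.1.2 rfl
    obtain ⟨hG₂, c₂, hc₂⟩ := h₂.1.2 rfl
    have hev : ∀ ε > 0, G₁ z - G₂ z ≤ ε * G₂ z := by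
      intro ε hε
      have := harmonic_le_of_boundary hE ((hG₁.sub hG₂).sub (hG₂.const_smul (c := ε)))
        (m := 0) ?_ ?_ z hz
      · simp only [Pi.sub_apply, Pi.smul_apply, smul_eq_mul] at this
        linarith
      · intro q hq η hη
        have h3 := (((h₁.2 q hq).sub (h₂.2 q hq)).sub ((h₂.2 q hq).const_mul ε)).eventually_lt_const
          (show (0 : ℝ) - 0 - ε * 0 < η by simpa using hη)
        filter_upwards [h3] with z h4
        simp only [Pi.sub_apply, Pi.smul_apply, smul_eq_mul]
        linarith
      · intro η hη
        have h3 := (hc₁.sub hc₂).eventually_lt_const (show c₁ - c₂ < c₁ - c₂ + 1 by linarith)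
        have h4 : Tendsto G₂ (Bornology.cobounded ℂ ⊓ 𝓟 E) atTop := by
          have := hc₂.add_atTop (tendsto_log_norm_cobounded.mono_left inf_le_left)
          simpa using this
        filter_upwards [h3, h4.eventually_ge_atTop ((c₁ - c₂ + 1) / ε)] with z h5 h6
        rw [div_le_iff₀ hε] at h6
        simp only [Pi.sub_apply, Pi.smul_apply, smul_eq_mul]
        linarith
    have hlim : Tendsto (fun ε : ℝ => ε * G₂ z) (𝓝[>] 0) (𝓝 0) := by
      have : Continuous fun ε : ℝ => ε * G₂ z := by fun_prop
      simpa using (this.tendsto 0).mono_left nhdsWithin_le_nhds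
    have := ge_of_tendsto hlim (by filter_upwards [self_mem_nhdsWithin] with ε hε using hev ε hε)
    linarith
  exact fun z hz => le_antisymm (key G₁ G₂ h₁ h₂ z hz) (key G₂ G₁ h₂ h₁ z hz)

/-- The Blaschke factor with zero `x`. -/
noncomputable def blaschke (x w : ℂ) : ℂ := (w - x) / (1 - (starRingEnd ℂ) x * w)

theorem one_sub_conj_mul_ne_zero {x w : ℂ} (hx : ‖x‖ < 1) (hw : ‖w‖ ≤ 1) :
    1 - (starRingEnd ℂ) x * w ≠ 0 := by
  intro h
  have h1 : ‖(starRingEnd ℂ) x * w‖ = 1 := by rw [← sub_eq_zero.mp h]; simp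
  rw [norm_mul, RCLike.norm_conj] at h1
  nlinarith [norm_nonneg x, norm_nonneg w]

theorem one_sub_norm_blaschke_sq {x w : ℂ} (hx : ‖x‖ < 1) (hw : ‖w‖ ≤ 1) :
    1 - ‖blaschke x w‖ ^ 2
      = (1 - ‖x‖ ^ 2) * (1 - ‖w‖ ^ 2) / ‖1 - (starRingEnd ℂ) x * w‖ ^ 2 := by
  have h0 : ‖1 - (starRingEnd ℂ) x * w‖ ^ 2 ≠ 0 :=
    pow_ne_zero 2 (norm_ne_zero_iff.mpr (one_sub_conj_mul_ne_zero hx hw))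
  rw [blaschke, norm_div, div_pow, one_sub_div h0]
  congr 1
  simp only [← Complex.normSq_eq_norm_sq, Complex.normSq_apply]
  simp
  ring

/-- The squeeze is 0 ≤ 1 - |b|² ≤ (1 - |w|²)/(1 - |x|)², with no limit of w itself required. -/
theorem tendsto_log_norm_blaschke {x : ℂ} (hx : ‖x‖ < 1) {α : Type*} {l : Filter α} {k : α → ℂ}
    (hk : ∀ᶠ a in l, ‖k a‖ < 1) (hlim : Tendsto (fun a => ‖k a‖) l (𝓝 1)) :
    Tendsto (fun a => -Real.log ‖blaschke x (k a)‖) l (𝓝 0) := by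
  have h1 : Tendsto (fun a => 1 - ‖blaschke x (k a)‖ ^ 2) l (𝓝 0) := by
    have hup : Tendsto (fun a => (1 - ‖k a‖ ^ 2) / (1 - ‖x‖) ^ 2) l (𝓝 0) := by
      have := ((hlim.pow 2).const_sub 1).div_const ((1 - ‖x‖) ^ 2)
      simpa using this
    refine tendsto_of_tendsto_of_tendsto_of_le_of_le' tendsto_const_nhds hup ?_ ?_
    · filter_upwards [hk] with a ha
      rw [one_sub_norm_blaschke_sq hx ha.le]
      have h3 : 0 ≤ 1 - ‖x‖ ^ 2 := by nlinarith [norm_nonneg x]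
      have h4 : 0 ≤ 1 - ‖k a‖ ^ 2 := by nlinarith [norm_nonneg (k a)]
      positivity
    · filter_upwards [hk] with a ha
      rw [one_sub_norm_blaschke_sq hx ha.le]
      have h4 : 0 ≤ 1 - ‖k a‖ ^ 2 := by nlinarith [norm_nonneg (k a)]
      have h5 : 1 - ‖x‖ ≤ ‖1 - (starRingEnd ℂ) x * k a‖ := by
        have := norm_sub_norm_le 1 ((starRingEnd ℂ) x * k a)
        rw [norm_mul, RCLike.norm_conj, norm_one] at this
        nlinarith [norm_nonneg x, norm_nonneg (k a)]
      have h6 : 0 < 1 - ‖x‖ := by linarith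
      gcongr
      nlinarith [sq_nonneg ‖x‖]
  have h2 : Tendsto (fun a => ‖blaschke x (k a)‖ ^ 2) l (𝓝 1) := by
    simpa using h1.const_sub 1
  have h3 := ((h2.log one_ne_zero).const_mul (-(1 / 2) : ℝ))
  simp only [Real.log_one, mul_zero] at h3
  refine h3.congr fun a => ?_
  rw [Real.log_pow]; push_cast; ring

theorem IsInnerConformal.isGreenFunction {γ : ℝ → ℂ} {f k : ℂ → ℂ} (hf : IsInnerConformal γ f)
    (hk : ∀ w ∈ Metric.ball (0 : ℂ) 1, k (f w) = w) {x : ℂ} (hx : x ∈ Metric.ball (0 : ℂ) 1) :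
    IsGreenFunction (inner γ) (f x : OnePoint ℂ) (fun z => -Real.log ‖blaschke x (k z)‖) := by
  have hx1 : ‖x‖ < 1 := by simpa using hx
  refine ⟨⟨fun p hp => ⟨?_, 0, ?_⟩, fun h => absurd h (OnePoint.coe_ne_infty _)⟩, ?_⟩
  · obtain rfl := OnePoint.coe_injective hp
    -- The regular part left after splitting off -log|f(w) - f(x)|. The divided slope of f at x
    -- never vanishes: by injectivity away from x, and because f'(x) ≠ 0 at x.
    refine ⟨fun z => Real.log ‖dslope f x (k z) * (1 - (starRingEnd ℂ) x * k z)‖, ?_, ?_⟩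
    · intro z hz
      obtain ⟨w, hw, rfl⟩ := hf.2.surjOn hz
      have hw1 : ‖w‖ < 1 := by simpa using hw
      have hd : DifferentiableOn ℂ (dslope f x) (Metric.ball 0 1) :=
        (Complex.differentiableOn_dslope (Metric.isOpen_ball.mem_nhds hx)).mpr hf.1
      have hka : AnalyticAt ℂ k (f w) :=
        analyticAt_leftInverse Metric.isOpen_ball hf.1 hf.2.injOn hk hw
      have hda : AnalyticAt ℂ (dslope f x) (k (f w)) := by
        rw [hk w hw]; exact hd.analyticAt (Metric.isOpen_ball.mem_nhds hw)
      refine AnalyticAt.harmonicAt_log_norm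
        (f := fun z => dslope f x (k z) * (1 - (starRingEnd ℂ) x * k z)) ?_ ?_
      · exact (hda.comp hka).mul (analyticAt_const.sub (analyticAt_const.mul hka))
      · rw [hk w hw]
        refine mul_ne_zero ?_ (one_sub_conj_mul_ne_zero hx1 hw1.le)
        rcases eq_or_ne w x with rfl | hne
        · rw [dslope_same]
          exact deriv_ne_zero_of_injOn Metric.isOpen_ball hf.1 hf.2.injOn hw
        · rw [dslope_of_ne _ hne, slope_def_field]
          exact div_ne_zero (sub_ne_zero.mpr fun h => hne (hf.2.injOn hw hx h))
            (sub_ne_zero.mpr hne)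
    · intro z hz hzp
      obtain ⟨w, hw, rfl⟩ := hf.2.surjOn hz
      have hw1 : ‖w‖ < 1 := by simpa using hw
      have hne : w ≠ x := fun h => hzp (by rw [h])
      simp only [hk w hw]
      rw [dslope_of_ne _ hne, slope_def_field, blaschke]
      have a1 := norm_ne_zero_iff.mpr (sub_ne_zero.mpr hzp)
      have a2 := norm_ne_zero_iff.mpr (sub_ne_zero.mpr hne)
      have a3 := norm_ne_zero_iff.mpr (one_sub_conj_mul_ne_zero hx1 hw1.le)
      rw [norm_mul, norm_div, norm_div, Real.log_div a2 a3,
        Real.log_mul (div_ne_zero a1 a2) a3, Real.log_div a1 a2, Real.log_inv]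
      ring
  · have : Bornology.cobounded ℂ ⊓ 𝓟 (inner γ) = ⊥ := by
      rw [← disjoint_iff, disjoint_principal_right]
      exact Bornology.isCobounded_compl_iff.mpr hf.isBounded
    rw [this]
    exact tendsto_bot
  · intro p hp
    rw [hf.isOpen.frontier_eq] at hp
    have hev : ∀ r < 1, ∀ᶠ z in 𝓝[inner γ] p, r < ‖k z‖ ∧ ‖k z‖ < 1 := by
      intro r hr
      have h1 := eventually_leftInverse_notMem (C := Metric.closedBall 0 r) hf.1.continuousOn hk
        (isCompact_closedBall 0 r) (Metric.closedBall_subset_ball hr)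
        (p := p) (by rw [hf.2.image_eq]; exact hp.2)
      rw [hf.2.image_eq] at h1
      filter_upwards [h1] with z hz
      exact ⟨by simpa using hz.2, by simpa using hz.1⟩
    apply tendsto_log_norm_blaschke hx1
    · filter_upwards [hev 0 one_pos] with z hz using hz.2
    · refine tendsto_order.mpr ⟨fun r hr => ?_, fun r hr => ?_⟩
      · filter_upwards [hev r hr] with z hz using hz.1
      · filter_upwards [hev 0 one_pos] with z hz using hz.2.trans hr

/-- `greenFunction` is an arbitrary choice among candidates. The explicit candidate proves that one
exists, and uniqueness off the pole transfers its values to the chosen one. -/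
theorem IsInnerConformal.greenFunction_spec {γ : ℝ → ℂ} {f : ℂ → ℂ} (hf : IsInnerConformal γ f)
    {x : ℂ} (hx : x ∈ Metric.ball (0 : ℂ) 1) :
    IsGreenFunction (inner γ) (f x : OnePoint ℂ) (greenFunction (inner γ) (f x : OnePoint ℂ)) ∧
    ∀ w ∈ Metric.ball (0 : ℂ) 1, w ≠ x →
      greenFunction (inner γ) (f x : OnePoint ℂ) (f w) = -Real.log ‖blaschke x w‖ := by
  have hk : ∀ w ∈ Metric.ball (0 : ℂ) 1, Function.invFunOn f (Metric.ball 0 1) (f w) = w :=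
    fun w hw => hf.2.injOn.leftInvOn_invFunOn hw
  have h1 := hf.isGreenFunction hk hx
  have h2 : IsGreenFunction (inner γ) (f x : OnePoint ℂ)
      (greenFunction (inner γ) (f x : OnePoint ℂ)) := Classical.epsilon_spec ⟨_, h1⟩
  refine ⟨h2, fun w hw hne => ?_⟩
  rw [h2.eqOn_of_isBounded hf.isOpen hf.isBounded (hf.2.mapsTo hx) h1 (f w) (hf.2.mapsTo hw)
    (fun h => hne (hf.2.injOn hw hx h)), hk w hw]

/-- The behaviour of the exterior map at infinity. -/
theorem IsOuterConformal.exists_inv {γ : ℝ → ℂ} {g : ℂ → ℂ} (hg : IsOuterConformal γ g) :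
    ∃ (F : ℂ → ℂ) (r : ℝ), 0 < r ∧ r ≤ 1 ∧ DifferentiableOn ℂ F (Metric.ball 0 r) ∧
      InjOn F (Metric.ball 0 r) ∧ F 0 = 0 ∧
      ∀ w ∈ Metric.ball (0 : ℂ) r, w ≠ 0 → 1 < ‖w⁻¹‖ ∧ F w = (g w⁻¹)⁻¹ ∧ g w⁻¹ ≠ 0 := by
  have hlim : Tendsto (fun w : ℂ => g w⁻¹) (𝓝[≠] 0) (Bornology.cobounded ℂ) :=
    hg.2.2.comp tendsto_inv₀_nhdsNE_zero
  have hlim0 : Tendsto (fun w : ℂ => (g w⁻¹)⁻¹) (𝓝[≠] 0) (𝓝 0) :=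
    tendsto_inv₀_cobounded.comp hlim
  have hne : ∀ᶠ w : ℂ in 𝓝[≠] 0, g w⁻¹ ≠ 0 := by
    have := hlim.eventually (Bornology.isCobounded_compl_iff.mpr
      (Bornology.isBounded_singleton (x := (0 : ℂ))))
    filter_upwards [this] with w hw using hw
  rw [eventually_nhdsWithin_iff] at hne
  obtain ⟨r₀, hr₀, hball⟩ := Metric.eventually_nhds_iff_ball.mp hne
  have hnorm : ∀ w ∈ Metric.ball (0 : ℂ) (min r₀ 1), w ≠ 0 → 1 < ‖w⁻¹‖ ∧ g w⁻¹ ≠ 0 := by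
    intro w hw hw0
    have h1 : ‖w‖ < min r₀ 1 := by simpa using hw
    refine ⟨?_, hball w (by simpa using h1.trans_le (min_le_left _ _)) hw0⟩
    rw [norm_inv]
    exact (one_lt_inv₀ (norm_pos_iff.mpr hw0)).mpr (h1.trans_le (min_le_right _ _))
  classical
  set F : ℂ → ℂ := Function.update (fun w => (g w⁻¹)⁻¹) 0 0 with hF
  have hFne : ∀ w, w ≠ 0 → F w = (g w⁻¹)⁻¹ := fun w hw => Function.update_of_ne hw _ _
  have hF0 : F 0 = 0 := Function.update_self _ _ _
  refine ⟨F, min r₀ 1, lt_min hr₀ one_pos, min_le_right _ _, ?_, ?_, hF0, fun w hw hw0 =>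
    ⟨(hnorm w hw hw0).1, hFne w hw0, (hnorm w hw hw0).2⟩⟩
  · refine (Complex.differentiableOn_compl_singleton_and_continuousAt_iff (c := 0)
      (Metric.ball_mem_nhds 0 (lt_min hr₀ one_pos))).mp ⟨?_, ?_⟩
    · rintro w ⟨hw, hw0⟩
      have h1 := hnorm w hw hw0
      have h2 : DifferentiableAt ℂ g w⁻¹ := hg.1.differentiableAt (isOpen_one_lt_norm.mem_nhds h1.1)
      have h3 : DifferentiableAt ℂ (fun w => (g w⁻¹)⁻¹) w :=
        (DifferentiableAt.comp w h2 (differentiableAt_inv hw0)).inv h1.2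
      refine (h3.congr_of_eventuallyEq ?_).differentiableWithinAt
      filter_upwards [isOpen_ne.mem_nhds hw0] with y hy using hFne y hy
    · rw [continuousAt_iff_punctured_nhds, hF0]
      refine hlim0.congr' ?_
      filter_upwards [self_mem_nhdsWithin] with w hw using (hFne w hw).symm
  · intro a ha b hb hab
    by_cases ha0 : a = 0 <;> by_cases hb0 : b = 0
    · rw [ha0, hb0]
    · rw [ha0, hF0, hFne b hb0] at hab
      exact absurd (inv_eq_zero.mp hab.symm) (hnorm b hb hb0).2
    · rw [hb0, hF0, hFne a ha0] at hab
      exact absurd (inv_eq_zero.mp hab) (hnorm a ha ha0).2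
    · rw [hFne a ha0, hFne b hb0, inv_inj] at hab
      exact inv_injective (hg.2.1.injOn (hnorm a ha ha0).1 (hnorm b hb hb0).1 hab)

/-- In the coordinate 1/z, F(w) = 1/g(1/w) maps neighbourhoods of 0 onto neighbourhoods of 0, so the
outer domain contains a neighbourhood of infinity. With z = 1/F(w) the difference of logarithms is
log|F(w)/w|, which tends to log|F'(0)|. -/
theorem IsOuterConformal.tendsto_leftInverse {γ : ℝ → ℂ} {g k : ℂ → ℂ} (hg : IsOuterConformal γ g)
    (hk : ∀ w ∈ {z : ℂ | 1 < ‖z‖}, k (g w) = w) :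
    (∀ᶠ z in Bornology.cobounded ℂ, z ∈ outer γ) ∧
    ∃ c : ℝ, Tendsto (fun z => Real.log ‖k z‖ - Real.log ‖z‖) (Bornology.cobounded ℂ) (𝓝 c) := by
  obtain ⟨F, r, hr, -, hFd, hFi, hF0, hF⟩ := hg.exists_inv
  have h0 : (0 : ℂ) ∈ Metric.ball (0 : ℂ) r := Metric.mem_ball_self hr
  have hd := deriv_ne_zero_of_injOn Metric.isOpen_ball hFd hFi h0
  have hFa : HasDerivAt F (deriv F 0) 0 :=
    (hFd.differentiableAt (Metric.ball_mem_nhds 0 hr)).hasDerivAt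
  have hinv : Tendsto (fun z : ℂ => z⁻¹) (Bornology.cobounded ℂ) (𝓝[≠] 0) :=
    tendsto_inv₀_cobounded'
  have himg : ∀ s ∈ 𝓝 (0 : ℂ), s ⊆ Metric.ball 0 r → ∀ᶠ z in Bornology.cobounded ℂ,
      ∃ w ∈ s, w ≠ 0 ∧ z = g w⁻¹ := by
    intro s hs hsr
    have h1 := image_mem_nhds_of_injOn Metric.isOpen_ball hFd hFi h0 hs
    rw [hF0] at h1
    have h2 := hinv.eventually ((eventually_of_mem (nhdsWithin_le_nhds h1)
      (fun x hx => hx)).and self_mem_nhdsWithin)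
    filter_upwards [h2] with z hz
    obtain ⟨⟨w, hw, hwz⟩, hz0⟩ := hz
    have hw0 : w ≠ 0 := by
      rintro rfl
      rw [hF0] at hwz
      exact hz0 hwz.symm
    refine ⟨w, hw, hw0, ?_⟩
    rw [(hF w (hsr hw) hw0).2.1] at hwz
    exact (inv_injective hwz).symm
  refine ⟨?_, Real.log ‖deriv F 0‖, ?_⟩
  · filter_upwards [himg _ (Metric.ball_mem_nhds 0 hr) le_rfl] with z hz
    obtain ⟨w, hw, hw0, rfl⟩ := hz
    exact hg.2.1.mapsTo (hF w hw hw0).1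
  · have hslope : Tendsto (fun w : ℂ => Real.log ‖w⁻¹ * F w‖) (𝓝[≠] 0)
        (𝓝 (Real.log ‖deriv F 0‖)) := by
      have h1 := hasDerivAt_iff_tendsto_slope_zero.mp hFa
      simp only [zero_add, hF0, sub_zero, smul_eq_mul] at h1
      exact h1.norm.log (norm_ne_zero_iff.mpr hd)
    intro s hs
    have h2 := hslope hs
    rw [mem_map, mem_nhdsWithin_iff_exists_mem_nhds_inter] at h2
    obtain ⟨u, hu, hus⟩ := h2
    rw [mem_map]
    filter_upwards [himg _ (inter_mem hu (Metric.ball_mem_nhds 0 hr)) inter_subset_right] with z hz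
    obtain ⟨w, hw, hw0, rfl⟩ := hz
    have h3 := hus ⟨hw.1, hw0⟩
    have h4 := hF w hw.2 hw0
    simp only [mem_preimage] at h3 ⊢
    convert h3 using 1
    rw [hk _ h4.1, h4.2.1, norm_mul, norm_inv (g w⁻¹), Real.log_mul
      (norm_ne_zero_iff.mpr (inv_ne_zero hw0)) (inv_ne_zero (norm_ne_zero_iff.mpr h4.2.2)),
      Real.log_inv ‖g w⁻¹‖]
    ring

theorem IsOuterConformal.isGreenFunction {γ : ℝ → ℂ} {g k : ℂ → ℂ} (hg : IsOuterConformal γ g)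
    (hk : ∀ w ∈ {z : ℂ | 1 < ‖z‖}, k (g w) = w) :
    IsGreenFunction (outer γ) OnePoint.infty (fun z => Real.log ‖k z‖) := by
  refine ⟨⟨fun p hp => absurd hp (OnePoint.infty_ne_coe _), fun _ => ⟨?_, ?_⟩⟩, ?_⟩
  · intro z hz
    obtain ⟨w, hw, rfl⟩ := hg.2.1.surjOn hz
    refine AnalyticAt.harmonicAt_log_norm
      (analyticAt_leftInverse isOpen_one_lt_norm hg.1 hg.2.1.injOn hk hw) ?_
    rw [hk w hw]
    rintro rfl
    simp at hw
    linarith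
  · obtain ⟨c, hc⟩ := (hg.tendsto_leftInverse hk).2
    exact ⟨c, hc.mono_left inf_le_left⟩
  · intro p hp
    rw [hg.isOpen.frontier_eq] at hp
    -- Near p the preimages leave compact subsets of the exterior disc; since g is large beyond R,
    -- they cannot escape to infinity and so must approach the circle.
    have hbig : ∀ᶠ w in Bornology.cobounded ℂ, ‖p‖ + 1 < ‖g w‖ :=
      (tendsto_norm_cobounded_atTop.comp hg.2.2).eventually_gt_atTop _
    obtain ⟨R, -, hR⟩ := (hasBasis_cobounded_norm (E := ℂ)).eventually_iff.mp hbig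
    have hev : ∀ r > 1, ∀ᶠ z in 𝓝[outer γ] p, 1 < ‖k z‖ ∧ ‖k z‖ < r := by
      intro r hr
      have hCc : IsCompact (Metric.closedBall (0 : ℂ) R ∩ {w | r ≤ ‖w‖}) :=
        (isCompact_closedBall 0 R).inter_right (isClosed_le continuous_const continuous_norm)
      have h1 := eventually_leftInverse_notMem hg.1.continuousOn hk hCc
        (fun w hw => show 1 < ‖w‖ from hr.trans_le hw.2)
        (p := p) (by rw [hg.2.1.image_eq]; exact hp.2)
      rw [hg.2.1.image_eq] at h1
      have h2 : ∀ᶠ z in 𝓝 p, ‖z‖ < ‖p‖ + 1 :=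
        continuous_norm.continuousAt.eventually_lt_const (by linarith)
      filter_upwards [h1, self_mem_nhdsWithin, nhdsWithin_le_nhds h2] with z hz hzo hzp
      refine ⟨hz.1, ?_⟩
      by_contra! hle
      obtain ⟨w, hw, rfl⟩ := hg.2.1.surjOn hzo
      rw [hk w hw] at hz hle
      by_cases hwR : R ≤ ‖w‖
      · exact absurd (hR hwR) (not_lt.mpr hzp.le)
      · exact hz.2 ⟨by simpa using (not_le.mp hwR).le, hle⟩
    have hlim : Tendsto (fun z => ‖k z‖) (𝓝[outer γ] p) (𝓝 1) := by
      refine tendsto_order.mpr ⟨fun r hr => ?_, fun r hr => ?_⟩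
      · filter_upwards [hev 2 one_lt_two] with z hz using hr.trans hz.1
      · filter_upwards [hev r hr] with z hz using hz.2
    simpa using hlim.log one_ne_zero

theorem IsOuterConformal.greenFunction_spec {γ : ℝ → ℂ} {g : ℂ → ℂ} (hg : IsOuterConformal γ g) :
    IsGreenFunction (outer γ) OnePoint.infty (greenFunction (outer γ) OnePoint.infty) ∧
    ∀ w, 1 < ‖w‖ → greenFunction (outer γ) OnePoint.infty (g w) = Real.log ‖w‖ := by
  have hk : ∀ w ∈ {z : ℂ | 1 < ‖z‖}, Function.invFunOn g {z : ℂ | 1 < ‖z‖} (g w) = w :=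
    fun w hw => hg.2.1.injOn.leftInvOn_invFunOn hw
  have h1 := hg.isGreenFunction hk
  have h2 : IsGreenFunction (outer γ) OnePoint.infty (greenFunction (outer γ) OnePoint.infty) :=
    Classical.epsilon_spec ⟨_, h1⟩
  refine ⟨h2, fun w hw => ?_⟩
  rw [h2.eqOn_of_infty hg.isOpen h1 (g w) (hg.2.1.mapsTo hw), hk w hw]

/-! ### Stationarity makes the potential harmonic across regular points -/

theorem dz_comp_affine {u : ℂ → ℝ} {p ω ζ : ℂ} (h : DifferentiableAt ℝ u (p + ω * ζ)) :
    dz (fun w => u (p + ω * w)) ζ = ω * dz u (p + ω * ζ) := by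
  have h1 : HasFDerivAt (fun w : ℂ => p + ω * w) (ω • ContinuousLinearMap.id ℝ ℂ) ζ := by
    have := ((hasDerivAt_id ζ).const_mul ω).const_add p
    refine (this.hasFDerivAt.restrictScalars ℝ).congr_fderiv ?_
    ext x
    simp [mul_comm]
  have h2 : fderiv ℝ (fun w => u (p + ω * w)) ζ
      = (fderiv ℝ u (p + ω * ζ)).comp (ω • ContinuousLinearMap.id ℝ ℂ) :=
    (h.hasFDerivAt.comp ζ h1).fderiv
  unfold dz
  rw [h2]
  set L := fderiv ℝ u (p + ω * ζ)
  have hL : ∀ z : ℂ, L z = z.re * L 1 + z.im * L Complex.I := by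
    intro z
    conv_lhs => rw [show z = z.re • (1 : ℂ) + z.im • Complex.I by simp [Complex.re_add_im]]
    rw [map_add, map_smul, map_smul, smul_eq_mul, smul_eq_mul]
  have e1 := hL ω
  have e2 := hL (ω * Complex.I)
  simp only [ContinuousLinearMap.comp_apply, smul_apply,
    ContinuousLinearMap.id_apply, smul_eq_mul, mul_one]
  rw [e1, e2]
  apply Complex.ext <;> simp

/-- Points on the normal of an arc stay away from the arc. -/
theorem LocalArc.le_norm_sub {κ κ' : ℝ → ℂ} {φ : ℝ → ℝ} {δ ρ K : ℝ} (h : LocalArc κ κ' φ δ ρ K)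
    {p η : ℂ} (hp : p.im = φ p.re) (hη : η.im = φ η.re) {ε : ℝ} :
    |ε| ≤ 3 * ‖p + ε * Complex.I - η‖ := by
  set d := p + ε * Complex.I - η with hd
  have h1 := Complex.abs_re_le_norm d
  have h2 := Complex.abs_im_le_norm d
  have h3 := h.abs_sub_le p.re η.re
  have e1 : d.re = p.re - η.re := by simp [hd]
  have e2 : d.im = φ p.re - φ η.re + ε := by simp [hd, hp, hη]; ring
  rw [e1] at h1
  rw [e2] at h2
  have h4 := abs_add_le (φ p.re - φ η.re + ε) (-(φ p.re - φ η.re))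
  rw [abs_neg] at h4
  have e3 : φ p.re - φ η.re + ε + -(φ p.re - φ η.re) = ε := by ring
  rw [e3] at h4
  have := norm_nonneg d
  linarith

/-- Moves the boundary data to a chart. Rays vertical in the chart approach the curve
non-tangentially on either side, so both normal limits of `dz` are ω times the conjugate of the
common gradient. -/
theorem harmonicAt_of_isRegularParam {γ : ℝ → ℂ} (hγ : IsPiecewiseRegularJordan γ)
    {f g : ℂ → ℂ} (hf : IsInnerConformal γ f) (hg : IsOuterConformal γ g) {t₀ : ℝ}
    (ht₀ : ∀ᶠ t in 𝓝 t₀, IsRegularParam γ t) {u : ℂ → ℝ}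
    (hu : ∀ᶠ z in 𝓝 (γ t₀), z ∉ range γ → HarmonicAt u z)
    (h0 : ∀ t, u (γ t) = 0 ∧ ContinuousAt u (γ t))
    (hv : ∀ t, IsRegularParam γ t → ∃ v, HasNontangentialGradient (inner γ) u (γ t) v ∧
      HasNontangentialGradient (outer γ) u (γ t) v) :
    HarmonicAt u (γ t₀) := by
  obtain ⟨δ₀, hδ₀, hreg⟩ := Metric.eventually_nhds_iff.mp ht₀
  obtain ⟨ω, κ', φ, δ, ρ₀, K, hω, hδ, harc₀, hchart₀⟩ := hγ.exists_chart ht₀.self_of_nhds hδ₀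
  have hbd : ∀ᶠ z in 𝓝 (γ t₀), |u z| ≤ 1 := by
    have h1 := (h0 t₀).2.abs
    refine (h1.eventually_le_const (u := 1) ?_)
    simp [(h0 t₀).1]
  have hA : Continuous fun ζ : ℂ => γ t₀ + ω * ζ := by fun_prop
  have hnear : ∀ᶠ ζ in 𝓝 (0 : ℂ), |u (γ t₀ + ω * ζ)| ≤ 1 ∧
      (γ t₀ + ω * ζ ∉ range γ → HarmonicAt u (γ t₀ + ω * ζ)) :=
    (hA.tendsto' 0 (γ t₀) (by simp)).eventually (hbd.and hu)
  obtain ⟨r, hr, hball⟩ := Metric.eventually_nhds_iff_ball.mp hnear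
  set ρ := min ρ₀ (r / 2) with hρ
  have hρ0 : 0 < ρ := lt_min harc₀.ρ_pos (by linarith)
  have hsq : ∀ ζ ∈ square ρ, ζ ∈ Metric.ball (0 : ℂ) r := by
    intro ζ hζ
    have h1 := Complex.norm_le_abs_re_add_abs_im ζ
    have h2 : ρ ≤ r / 2 := min_le_right _ _
    have := hζ.1
    have := hζ.2
    rw [mem_ball_zero_iff]
    linarith
  have harc := harc₀.mono hρ0 (min_le_left _ _)
  have hchart : ∀ ζ ∈ square ρ, γ t₀ + ω * ζ ∈ range γ ↔ ζ.im = φ ζ.re :=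
    fun ζ hζ => hchart₀ ζ (square_mono (min_le_left _ _) hζ)
  clear_value ρ
  clear harc₀ hchart₀
  set κ : ℝ → ℂ := fun t => (γ (t₀ + t) - γ t₀) / ω with hκ
  have hκγ : ∀ t, γ t₀ + ω * κ t = γ (t₀ + t) := by
    intro t
    simp only [hκ]
    field_simp
    ring
  set v : ℂ → ℝ := fun ζ => u (γ t₀ + ω * ζ) with hvdef
  have hharm : ∀ ζ ∈ square ρ, ζ.im ≠ φ ζ.re → HarmonicAt u (γ t₀ + ω * ζ) := fun ζ hζ hne =>
    (hball ζ (hsq ζ hζ)).2 fun hm => hne ((hchart ζ hζ).mp hm)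
  have hharm' : ∀ ζ ∈ square ρ, ζ.im ≠ φ ζ.re → HarmonicAt v ζ := fun ζ hζ hne =>
    harmonicAt_comp_of_differentiable (v := u) (g := fun ζ => γ t₀ + ω * ζ) (by fun_prop)
      (hharm ζ hζ hne)
  -- Each side is connected and so lies in one of the two domains. Which one is irrelevant, since
  -- the gradient has the same limit from both.
  have hside : ∀ S ⊆ square ρ, IsPreconnected S → (∀ ζ ∈ S, ζ.im ≠ φ ζ.re) →
      ((∀ ζ ∈ S, γ t₀ + ω * ζ ∈ inner γ) ∨ (∀ ζ ∈ S, γ t₀ + ω * ζ ∈ outer γ)) := by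
    intro S hS hSc hne
    have h1 : IsPreconnected ((fun ζ => γ t₀ + ω * ζ) '' S) := hSc.image _ hA.continuousOn
    have h2 : (fun ζ => γ t₀ + ω * ζ) '' S ⊆ inner γ ∪ outer γ := by
      rintro _ ⟨ζ, hζ, rfl⟩
      rw [inner_union_outer]
      exact fun hm => hne ζ hζ ((hchart ζ (hS hζ)).mp hm)
    rcases h1.subset_or_subset hf.isOpen hg.isOpen (disjoint_inner_outer γ) h2 with h | h
    · exact Or.inl fun ζ hζ => h ⟨ζ, hζ, rfl⟩
    · exact Or.inr fun ζ hζ => h ⟨ζ, hζ, rfl⟩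
  have hne_inner : (frontier (inner γ)).Nonempty := by
    rw [nonempty_frontier_iff]
    exact ⟨⟨_, hf.mem⟩, fun h => (h ▸ mem_univ (γ t₀) : γ t₀ ∈ inner γ).1 ⟨t₀, rfl⟩⟩
  have hne_outer : (frontier (outer γ)).Nonempty := by
    rw [nonempty_frontier_iff]
    exact ⟨⟨g 2, hg.2.1.mapsTo (by simp)⟩,
      fun h => (h ▸ mem_univ (γ t₀) : γ t₀ ∈ outer γ).1 ⟨t₀, rfl⟩⟩
  have hlim : ∀ S ⊆ square ρ, IsPreconnected S → (∀ ζ ∈ S, ζ.im ≠ φ ζ.re) → ∀ σ : ℝ, |σ| = 1 →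
      ∀ t, κ t ∈ square ρ → (κ t).im = φ (κ t).re →
      (∀ᶠ ε : ℝ in 𝓝[>] 0, κ t + (σ * ε : ℝ) * Complex.I ∈ S) → ∀ w,
      HasNontangentialGradient (inner γ) u (γ (t₀ + t)) w ∧
      HasNontangentialGradient (outer γ) u (γ (t₀ + t)) w →
      Tendsto (fun ε : ℝ => dz v (κ t + (σ * ε : ℝ) * Complex.I)) (𝓝[>] 0)
        (𝓝 (ω * (starRingEnd ℂ) w)) := by
    intro S hS hSc hne σ hσ t hκt hgr hev w hw
    have hX : ∃ X : Set ℂ, (∀ ζ ∈ S, γ t₀ + ω * ζ ∈ X) ∧ (frontier X).Nonempty ∧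
        frontier X ⊆ range γ ∧ HasNontangentialGradient X u (γ (t₀ + t)) w := by
      rcases hside S hS hSc hne with h | h
      · exact ⟨_, h, hne_inner, frontier_inner_subset hf.isOpen hg.isOpen, hw.1⟩
      · exact ⟨_, h, hne_outer, frontier_outer_subset hf.isOpen hg.isOpen, hw.2⟩
    obtain ⟨X, hXS, hXne, hXγ, hXw⟩ := hX
    obtain ⟨r', hr', hr'sq⟩ := Metric.isOpen_iff.mp (isOpen_square ρ) _ hκt
    have hpath : Tendsto (fun ε : ℝ => γ t₀ + ω * (κ t + (σ * ε : ℝ) * Complex.I)) (𝓝[>] 0)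
        (𝓝[{z | z ∈ X ∧ dist z (γ (t₀ + t)) ≤ 3 * Metric.infDist z (frontier X)}]
          (γ (t₀ + t))) := by
      refine tendsto_nhdsWithin_iff.mpr ⟨?_, ?_⟩
      · refine (Continuous.tendsto' ?_ 0 _ (by simp [hκγ])).mono_left nhdsWithin_le_nhds
        fun_prop
      · filter_upwards [hev, self_mem_nhdsWithin,
          nhdsWithin_le_nhds (Iio_mem_nhds (half_pos hr'))] with ε hε hε0 hεr
        have hε0' : 0 < ε := hε0
        have hεr' : ε < r' / 2 := hεr
        have hσε : ‖((σ * ε : ℝ) : ℂ) * Complex.I‖ = ε := by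
          rw [norm_mul, Complex.norm_I, mul_one, Complex.norm_real, Real.norm_eq_abs, abs_mul, hσ,
            one_mul, abs_of_pos hε0']
        refine ⟨hXS _ hε, ?_⟩
        have hd : dist (γ t₀ + ω * (κ t + (σ * ε : ℝ) * Complex.I)) (γ (t₀ + t)) = ‖ω‖ * ε := by
          rw [← hκγ t, dist_eq_norm, show γ t₀ + ω * (κ t + (σ * ε : ℝ) * Complex.I)
            - (γ t₀ + ω * κ t) = ω * ((σ * ε : ℝ) * Complex.I) by ring, norm_mul, hσε]
        rw [hd]
        have hω' := norm_pos_iff.mpr hω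
        -- Frontier points in the chart lie on the graph, at distance at least ε/3; those outside
        -- are at distance more than ε because ε < r'/2. This gives aperture 3.
        have : ‖ω‖ * ε / 3 ≤ Metric.infDist (γ t₀ + ω * (κ t + (σ * ε : ℝ) * Complex.I))
            (frontier X) := by
          refine (Metric.le_infDist hXne).mpr fun y hy => ?_
          set η := (y - γ t₀) / ω with hη
          have hyη : y = γ t₀ + ω * η := by rw [hη]; field_simp; ring
          have hyr := hXγ hy
          have e : dist (γ t₀ + ω * (κ t + (σ * ε : ℝ) * Complex.I)) y
              = ‖ω‖ * ‖κ t + (σ * ε : ℝ) * Complex.I - η‖ := by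
            rw [hyη, dist_eq_norm, ← norm_mul]
            congr 1; ring
          rw [e, mul_div_assoc]
          refine mul_le_mul_of_nonneg_left ?_ hω'.le
          by_cases hηs : η ∈ square ρ
          · have h2 := harc.le_norm_sub hgr ((hchart η hηs).mp (hyη ▸ hyr)) (ε := σ * ε)
            rw [abs_mul, hσ, one_mul, abs_of_pos hε0'] at h2
            linarith
          · have h2 : r' ≤ ‖η - κ t‖ := by
              by_contra! hlt
              exact hηs (hr'sq (by rwa [Metric.mem_ball, dist_eq_norm]))
            have h3 : ‖η - κ t‖ ≤ ‖κ t + (σ * ε : ℝ) * Complex.I - η‖ + ε := by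
              have h4 := norm_sub_le ((σ * ε : ℝ) * Complex.I)
                (κ t + (σ * ε : ℝ) * Complex.I - η)
              rw [hσε, show (σ * ε : ℝ) * Complex.I - (κ t + (σ * ε : ℝ) * Complex.I - η)
                = η - κ t by ring] at h4
              linarith
            linarith
        linarith
    have h1 := (hXw 3).comp hpath
    have h2 := ((Complex.continuous_conj.tendsto w).comp h1).const_mul ω
    refine h2.congr' ?_
    filter_upwards [hev] with ε hε
    simp only [Function.comp_apply]
    rw [star_gradient]
    exact (dz_comp_affine ((hharm _ (hS hε) (hne _ hε)).1.differentiableAt two_ne_zero)).symm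
  choose! w hw using hv
  have hregt : ∀ t, |t| < δ → IsRegularParam γ (t₀ + t) := fun t ht =>
    hreg (by simpa [Real.dist_eq] using ht.trans_le hδ)
  have hupc : IsPreconnected (upper φ ρ) := by
    obtain ⟨h1, h2⟩ := harc.starConvex_upper hρ0
    exact (h2.isPathConnected h1).isConnected.isPreconnected
  have hlowc : IsPreconnected (lower φ ρ) := by
    obtain ⟨h1, h2⟩ := harc.reflect.starConvex_upper hρ0
    have h3 := ((h2.isPathConnected h1).isConnected.isPreconnected).image (fun z => -z)
      continuous_neg.continuousOn
    convert h3 using 1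
    ext z
    simp only [image_neg_eq_neg, Set.mem_neg, upper, lower, square, mem_ofPred_eq, Complex.neg_re,
      Complex.neg_im, abs_neg, neg_neg, neg_lt_neg_iff]
  have htan : ∀ (σ : ℝ) (t : ℝ), κ t ∈ square ρ →
      ∀ᶠ ε : ℝ in 𝓝[>] 0, κ t + (σ * ε : ℝ) * Complex.I ∈ square ρ := by
    intro σ t ht
    have hc : Tendsto (fun ε : ℝ => κ t + (σ * ε : ℝ) * Complex.I) (𝓝[>] 0) (𝓝 (κ t)) := by
      refine (Continuous.tendsto' ?_ 0 _ (by simp)).mono_left nhdsWithin_le_nhds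
      fun_prop
    exact hc.eventually ((isOpen_square ρ).mem_nhds ht)
  have hmain : HarmonicAt v 0 := by
    refine harc.harmonicAt_zero (M := 1) (q := fun t => ω * (starRingEnd ℂ) (w (t₀ + t)))
      (fun ζ hζ => hharm' ζ hζ.1 hζ.2.ne') (fun ζ hζ => hharm' ζ hζ.1 hζ.2.ne)
      (fun ζ hζ => (hball ζ (hsq ζ hζ)).1) ?_ ?_ ?_
    · intro p hp hpφ
      obtain ⟨t, ht⟩ := (hchart p hp).mpr hpφ
      have := h0 t
      rw [ht] at this
      exact ⟨this.1, this.2.comp_of_eq hA.continuousAt rfl⟩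
    · intro t ht hκt
      have h1 := hlim _ (fun ζ hζ => hζ.1) hupc (fun ζ hζ => hζ.2.ne') 1 (by simp) t hκt
        (harc.graph t ht).symm ?_ _ (hw _ (hregt t ht))
      · simpa using h1
      · filter_upwards [htan 1 t hκt, self_mem_nhdsWithin] with ε hε hε0
        refine ⟨hε, ?_⟩
        have : 0 < ε := hε0
        have h2 := harc.graph t ht
        simp [h2, this]
    · intro t ht hκt
      have h1 := hlim _ (fun ζ hζ => hζ.1) hlowc (fun ζ hζ => hζ.2.ne) (-1) (by simp) t hκt
        (harc.graph t ht).symm ?_ _ (hw _ (hregt t ht))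
      · simpa [← sub_eq_add_neg] using h1
      · filter_upwards [htan (-1) t hκt, self_mem_nhdsWithin] with ε hε hε0
        refine ⟨hε, ?_⟩
        have : 0 < ε := hε0
        have h2 := harc.graph t ht
        simp [h2, this]
  have hinv : Differentiable ℂ fun z : ℂ => (z - γ t₀) / ω := by fun_prop
  have h1 := harmonicAt_comp_of_differentiable (v := v) (g := fun z : ℂ => (z - γ t₀) / ω) hinv
    (z := γ t₀) (by simpa using hmain)
  refine (harmonicAt_congr_nhds (Eventually.of_forall fun z => ?_)).mp h1
  simp only [hvdef]
  congr 1
  field_simp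
  ring

/-! ### Removable singularities and Liouville's theorem -/

/-- A continuous function that is harmonic off a point is harmonic. -/
theorem harmonicAt_of_continuousAt {u : ℂ → ℝ} {q : ℂ} (hd : ∀ᶠ z in 𝓝[≠] q, HarmonicAt u z)
    (hc : ContinuousAt u q) : HarmonicAt u q := by
  rw [eventually_nhdsWithin_iff] at hd
  obtain ⟨r, hr, hball⟩ := Metric.eventually_nhds_iff_ball.mp hd
  -- The gradient estimate on the ball of radius |z - q| around z, with oscillation ε/9, gives |T| ≤
  -- 8ε/9. So T extends holomorphically with T(q) = 0, and its divided slope at q continues `dz u`.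
  set T : ℂ → ℂ := fun z => (z - q) * dz u z with hT
  have hTd : DifferentiableOn ℂ T (Metric.ball q r \ {q}) := fun z hz =>
    (((differentiableAt_id.sub_const q).mul
      (HarmonicAt.differentiableAt_complex_partial (hball z hz.1 hz.2))) :
        DifferentiableAt ℂ T z).differentiableWithinAt
  have hTq : T q = 0 := by simp [hT]
  have hTc : ContinuousAt T q := by
    rw [Metric.continuousAt_iff]
    intro ε hε
    obtain ⟨δ, hδ, hδu⟩ := Metric.continuousAt_iff.mp hc (ε / 9) (by positivity)
    refine ⟨min δ r / 2, by positivity, fun z hz => ?_⟩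
    rw [hTq, dist_zero_right]
    rcases eq_or_ne z q with rfl | hne
    · simpa [hTq] using hε
    · have hpos : 0 < ‖z - q‖ := norm_pos_iff.mpr (sub_ne_zero.mpr hne)
      rw [dist_eq_norm] at hz
      have hin : ∀ y ∈ Metric.ball z ‖z - q‖, dist y q < min δ r ∧ y ≠ q := by
        intro y hy
        rw [Metric.mem_ball, dist_eq_norm] at hy
        constructor
        · rw [dist_eq_norm]
          have := norm_add_le (y - z) (z - q)
          rw [sub_add_sub_cancel] at this
          linarith
        · rintro rfl
          rw [norm_sub_rev] at hy
          exact lt_irrefl _ hy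
      have h1 := norm_dz_le (u := u) hpos (M := ε / 9) (by positivity)
        (fun y hy => hball y ((hin y hy).1.trans_le (min_le_right _ _)) (hin y hy).2) (u q)
        (fun y hy => (hδu ((hin y hy).1.trans_le (min_le_left _ _))).le)
      rw [le_div_iff₀ hpos] at h1
      calc ‖T z‖ = ‖dz u z‖ * ‖z - q‖ := by rw [hT]; simp only [norm_mul]; ring
        _ ≤ 8 * (ε / 9) := h1
        _ < ε := by linarith
  have hTD := (Complex.differentiableOn_compl_singleton_and_continuousAt_iff
    (Metric.ball_mem_nhds q hr)).mp ⟨hTd, hTc⟩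
  have hSD := (Complex.differentiableOn_dslope (Metric.ball_mem_nhds q hr)).mpr hTD
  have hqb : q ∈ Metric.ball q r := Metric.mem_ball_self hr
  obtain ⟨w, hw⟩ := exists_hasDerivAt_of_starConvex Metric.isOpen_ball
    ((convex_ball q r).starConvex hqb) hSD
  have hS : ∀ z ∈ Metric.ball q r, z ≠ q → dslope T q z = dz u z := by
    intro z hz hne
    rw [dslope_of_ne _ hne, slope_def_field, hTq, sub_zero, hT]
    exact mul_div_cancel_left₀ _ (sub_ne_zero.mpr hne)
  have hfd : ∀ z ∈ Metric.ball q r, z ≠ q →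
      HasFDerivAt (fun z => u z - (w z).re) (0 : ℂ →L[ℝ] ℝ) z := by
    intro z hz hne
    have h1 := (Complex.reCLM.hasFDerivAt (x := w z)).comp z
      ((hw z hz).hasFDerivAt.restrictScalars ℝ)
    have h2 : HasFDerivAt u (fderiv ℝ u z) z :=
      ((hball z hz hne).1.differentiableAt two_ne_zero).hasFDerivAt
    refine (h2.fun_sub h1).congr_fderiv ?_
    rw [hS z hz hne]
    ext a
    have ha : a = a.re • (1 : ℂ) + a.im • Complex.I := by simp
    rw [ha]
    simp only [map_add, map_smul]
    simp [dz]
  have hwc : ContinuousAt (fun z => u z - (w z).re) q :=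
    hc.sub (Complex.continuous_re.continuousAt.comp (hw q hqb).continuousAt)
  have hconst : ∀ z ∈ Metric.ball q r, u z - (w z).re = u q - (w q).re := by
    intro z hz
    rcases eq_or_ne z q with rfl | hne
    · rfl
    have hseg : ∀ s ∈ Icc (0 : ℝ) 1, q + (1 - s : ℝ) * (z - q) ∈ Metric.ball q r := by
      intro s hs
      rw [Metric.mem_ball, dist_eq_norm] at hz ⊢
      rw [add_sub_cancel_left, norm_mul, Complex.norm_real, Real.norm_eq_abs,
        abs_of_nonneg (by linarith [hs.2])]
      nlinarith [hs.1, norm_nonneg (z - q)]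
    have hsd : ∀ s : ℝ, HasDerivAt (fun s : ℝ => q + (1 - s : ℝ) * (z - q)) (-(z - q)) s := by
      intro s
      have h1 : HasDerivAt (fun s : ℝ => ((1 - s : ℝ) : ℂ)) (-1 : ℂ) s := by
        have := ((hasDerivAt_id s).const_sub 1).ofReal_comp
        simpa using this
      exact ((h1.mul_const (z - q)).const_add q).congr_deriv (by ring)
    have hne' : ∀ s ∈ Ico (0 : ℝ) 1, q + (1 - s : ℝ) * (z - q) ≠ q := by
      intro s hs h
      rw [add_eq_left, mul_eq_zero] at h
      rcases h with h | h
      · have := Complex.ofReal_eq_zero.mp h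
        linarith [hs.2]
      · exact hne (sub_eq_zero.mp h)
    -- The segment is run from z towards q, so that q is the right end, where continuity suffices.
    have h1 := constant_of_has_deriv_right_zero (a := 0) (b := 1)
      (f := fun s : ℝ => u (q + (1 - s : ℝ) * (z - q)) - (w (q + (1 - s : ℝ) * (z - q))).re)
      ?_ ?_ 1 (by simp)
    · simpa using h1.symm
    · intro s hs
      refine ContinuousAt.continuousWithinAt ?_
      rcases eq_or_lt_of_le hs.2 with rfl | hlt
      · exact ContinuousAt.comp_of_eq (g := fun z => u z - (w z).re) hwc (hsd 1).continuousAt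
          (by simp)
      · exact ContinuousAt.comp (g := fun z => u z - (w z).re)
          (hfd _ (hseg s hs) (hne' s ⟨hs.1, hlt⟩)).continuousAt (hsd s).continuousAt
    · intro s hs
      have h2 := (hfd _ (hseg s ⟨hs.1, hs.2.le⟩) (hne' s hs)).comp_hasDerivAt s (hsd s)
      exact (h2.congr_deriv (by simp)).hasDerivWithinAt
  have hwa : AnalyticAt ℂ (fun z => w z + ((u q - (w q).re : ℝ) : ℂ)) q :=
    (DifferentiableOn.analyticAt (fun z hz => (hw z hz).differentiableAt.differentiableWithinAt)
      (Metric.ball_mem_nhds q hr)).add analyticAt_const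
  refine (harmonicAt_congr_nhds ?_).mp hwa.harmonicAt_re
  filter_upwards [Metric.ball_mem_nhds q hr] with z hz
  have := hconst z hz
  simp only [Complex.add_re, Complex.ofReal_re]
  linarith

/-- An entire harmonic function with logarithmic growth is constant. -/
theorem exists_eq_const_of_log_growth {u : ℂ → ℝ} (hu : ∀ z, HarmonicAt u z) {b M : ℝ}
    (hM : ∀ᶠ z in Bornology.cobounded ℂ, |u z - b * Real.log ‖z‖| ≤ M) :
    b = 0 ∧ ∃ c, ∀ z, u z = c := by
  suffices h : ∃ c, ∀ z, u z = c by
    refine ⟨?_, h⟩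
    obtain ⟨c, hc⟩ := h
    by_contra hb
    have h1 : Tendsto (fun z : ℂ => |b| * Real.log ‖z‖) (Bornology.cobounded ℂ) atTop :=
      (Real.tendsto_log_atTop.comp tendsto_norm_cobounded_atTop).const_mul_atTop (abs_pos.mpr hb)
    obtain ⟨z, hz, hz1, hz2⟩ := (hM.and ((h1.eventually_gt_atTop (M + |c|)).and
      (tendsto_norm_cobounded_atTop.eventually_gt_atTop 1))).exists
    rw [hc] at hz
    have h2 := abs_sub_abs_le_abs_sub (b * Real.log ‖z‖) c
    rw [abs_sub_comm, abs_mul, abs_of_pos (Real.log_pos hz2)] at h2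
    linarith
  obtain ⟨R, -, hR⟩ := (hasBasis_cobounded_norm (E := ℂ)).eventually_iff.mp hM
  set M' := |M| + |b| * Real.log 2 + 1 with hM'
  have hlog2 := Real.log_pos one_lt_two
  have hM'0 : 0 < M' := by positivity
  -- On the ball of radius |z|/2 the logarithm varies by at most log 2, so u differs boundedly from
  -- the constant b log|z|. Hence `dz u`, an entire function, is O(1/|z|) and vanishes.
  have hbd : ∀ z : ℂ, 2 * |R| + 1 ≤ ‖z‖ → ‖dz u z‖ ≤ 16 * M' / ‖z‖ := by
    intro z hz
    have hz0 : 0 < ‖z‖ := by linarith [abs_nonneg R]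
    have h1 := norm_dz_le (u := u) (c := z) (half_pos hz0) hM'0 (fun y _ => hu y)
      (b * Real.log ‖z‖) ?_
    · refine h1.trans (le_of_eq ?_)
      field_simp
      ring
    · intro y hy
      rw [Metric.mem_ball, dist_eq_norm] at hy
      have h2 : ‖z‖ / 2 ≤ ‖y‖ := by
        have := norm_sub_norm_le z y
        rw [norm_sub_rev] at this
        linarith
      have h3 : ‖y‖ ≤ 2 * ‖z‖ := by
        have := norm_sub_norm_le y z
        linarith
      have hy0 : 0 < ‖y‖ := by linarith
      have h4 : |u y - b * Real.log ‖y‖| ≤ M := hR (by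
        show R ≤ ‖y‖
        linarith [le_abs_self R])
      have h5 : |Real.log ‖y‖ - Real.log ‖z‖| ≤ Real.log 2 := by
        rw [abs_le]
        constructor
        · have := Real.log_le_log (by linarith) h2
          rw [Real.log_div hz0.ne' two_ne_zero] at this
          linarith
        · have := Real.log_le_log hy0 h3
          rw [Real.log_mul two_ne_zero hz0.ne'] at this
          linarith
      have e : u y - b * Real.log ‖z‖
          = (u y - b * Real.log ‖y‖) + b * (Real.log ‖y‖ - Real.log ‖z‖) := by ring
      rw [e]
      refine (abs_add_le _ _).trans ?_
      rw [abs_mul]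
      have := mul_le_mul_of_nonneg_left h5 (abs_nonneg b)
      linarith [le_abs_self M]
  have hdiff : Differentiable ℂ (dz u) := fun z =>
    HarmonicAt.differentiableAt_complex_partial (hu z)
  have hlim : Tendsto (dz u) (cocompact ℂ) (𝓝 0) := by
    rw [← Metric.cobounded_eq_cocompact]
    refine squeeze_zero_norm' (a := fun z : ℂ => 16 * M' / ‖z‖) ?_
      (tendsto_norm_cobounded_atTop.const_div_atTop _)
    filter_upwards [tendsto_norm_cobounded_atTop.eventually_ge_atTop (2 * |R| + 1)] with z hz
      using hbd z hz
  obtain ⟨w, hw, hwu⟩ := exists_hasDerivAt_dz_re_eq isOpen_univ (mem_univ (0 : ℂ))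
    (convex_univ.starConvex (mem_univ 0)) (u := u) (fun z _ => hu z)
  have hw0 : ∀ z, w z = w 0 := fun z =>
    is_const_of_deriv_eq_zero (fun z => (hw z trivial).differentiableAt)
      (fun z => by rw [(hw z trivial).deriv, hdiff.apply_eq_of_tendsto_cocompact z hlim]) z 0
  exact ⟨(w 0).re, fun z => by rw [← hwu z trivial, hw0 z]⟩

/-! ### The potential of a stationary curve -/

theorem IsRegularParam.add_int {γ : ℝ → ℂ} (hγ : Function.Periodic γ 1) {t : ℝ}
    (ht : IsRegularParam γ t) (n : ℤ) : IsRegularParam γ (t + n) := by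
  have h1 : γ = fun s => γ (s - n) := by
    funext s
    exact (hγ.sub_int_mul_eq n (x := s) |> fun h => by simpa using h.symm)
  have h2 : t + n - n = t := by ring
  constructor
  · rw [h1]
    have h3 : ContDiffAt ℝ (⊤ : ℕ∞) γ (t + n - n) := by rw [h2]; exact ht.1
    exact h3.comp (t + n : ℝ) (contDiffAt_id.sub contDiffAt_const)
  · rw [h1, deriv_comp_sub_const, h2]
    exact ht.2

/-- C contains the points of the plane at the break parameters; elsewhere a parameter reduced modulo
1 lies inside one smooth piece. -/
theorem IsPiecewiseRegularJordan.exists_finite_corners {γ : ℝ → ℂ}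
    (hγ : IsPiecewiseRegularJordan γ) :
    ∃ C : Set ℂ, C.Finite ∧ ∀ t, γ t ∉ C → ∀ᶠ s in 𝓝 t, IsRegularParam γ s := by
  obtain ⟨n, τ, hτ, h0, h1, hpc⟩ := hγ.pieces
  refine ⟨range (γ ∘ τ), finite_range _, fun t ht => ?_⟩
  set r := Int.fract t with hr
  have hrt : γ r = γ t := by
    have := hγ.periodic.sub_int_mul_eq (Int.floor t) (x := t)
    rw [hr, Int.fract]
    simpa using this
  have hne : ∀ k, r ≠ τ k := fun k h => ht ⟨k, by rw [Function.comp_apply, ← h, hrt]⟩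
  obtain ⟨i, hi⟩ : ∃ i : Fin n, r ∈ Ioo (τ i.castSucc) (τ i.succ) := by
    by_contra! hcon
    have hall : ∀ k, τ k ≤ r := by
      intro k
      induction k using Fin.induction with
      | zero => rw [h0]; exact Int.fract_nonneg t
      | succ i ih =>
        by_contra! hlt
        exact hcon i ⟨lt_of_le_of_ne ih (hne _).symm, hlt⟩
    have := hall (Fin.last n)
    rw [h1] at this
    exact absurd (Int.fract_lt_one t) (not_lt.mpr this)
  have hreg : ∀ᶠ s in 𝓝 r, IsRegularParam γ s := by
    filter_upwards [Ioo_mem_nhds hi.1 hi.2] with s hs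
    have hn : Icc (τ i.castSucc) (τ i.succ) ∈ 𝓝 s := Icc_mem_nhds hs.1 hs.2
    refine ⟨(hpc i).1.contDiffAt hn, ?_⟩
    rw [← derivWithin_of_mem_nhds hn]
    exact (hpc i).2 s ⟨hs.1.le, hs.2.le⟩
  have htend : Tendsto (fun s : ℝ => s - ⌊t⌋) (𝓝 t) (𝓝 r) :=
    (continuous_id.sub continuous_const).tendsto' t r rfl
  filter_upwards [htend.eventually hreg] with s hs
  simpa using hs.add_int hγ.periodic ⌊t⌋

/-- Off the closure the filter is trivial, so there is no need to know that each curve point is a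
frontier point of both domains. -/
theorem IsGreenFunction.tendsto_of_notMem {E : Set ℂ} (hE : IsOpen E) {w : OnePoint ℂ} {G : ℂ → ℝ}
    (hG : IsGreenFunction E w G) {p : ℂ} (hp : p ∉ E) : Tendsto G (𝓝[E] p) (𝓝 0) := by
  by_cases hc : p ∈ closure E
  · exact hG.2 p (hE.frontier_eq ▸ ⟨hc, hp⟩)
  · rw [notMem_closure_iff_nhdsWithin_eq_bot.mp hc]
    exact tendsto_bot

theorem HasNontangentialGradient.congr {E : Set ℂ} (hE : IsOpen E) {u v : ℂ → ℝ} {p w : ℂ}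
    (h : HasNontangentialGradient E u p w) (huv : ∀ᶠ z in 𝓝 p, z ∈ E → v z = u z) :
    HasNontangentialGradient E v p w := by
  intro M
  refine (h M).congr' ?_
  filter_upwards [self_mem_nhdsWithin, nhdsWithin_le_nhds huv.eventually_nhds] with z hz hz'
  have : u =ᶠ[𝓝 z] v := by
    filter_upwards [hz', hE.mem_nhds hz.1] with y hy hyE using (hy hyE).symm
  unfold gradient
  rw [this.fderiv_eq]

theorem HasNontangentialGradient.neg {E : Set ℂ} {u : ℂ → ℝ} {p w : ℂ}
    (h : HasNontangentialGradient E u p w) :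
    HasNontangentialGradient E (fun z => -u z) p (-w) := by
  intro M
  refine (h M).neg.congr fun z => ?_
  unfold gradient
  rw [fderiv_fun_neg, map_neg]

theorem greenPotential_sum_single (E : Set ℂ) {m : ℕ} (w : Fin m → OnePoint ℂ) (a : Fin m → ℝ)
    (z : ℂ) : greenPotential E (∑ j, Finsupp.single (w j) (a j)) z
      = ∑ j, a j * greenFunction E (w j) z := by
  unfold greenPotential
  rw [← Finsupp.sum_finsetSum_index (by simp) (by intros; ring)]
  simp

theorem greenPotential_single (E : Set ℂ) (w : OnePoint ℂ) (z : ℂ) :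
    greenPotential E (Finsupp.single w 1) z = greenFunction E w z := by
  simp [greenPotential]

theorem harmonicAt_sum_mul {m : ℕ} {H : Fin m → ℂ → ℝ} (a : Fin m → ℝ) {z : ℂ}
    (h : ∀ j, HarmonicAt (H j) z) : HarmonicAt (fun w => ∑ j, a j * H j w) z := by
  have : ∀ s : Finset (Fin m), HarmonicAt (fun w => ∑ j ∈ s, a j * H j w) z := by
    intro s
    induction s using Finset.induction_on with
    | empty => simp
    | insert j s hj ih =>
      have := ((h j).const_smul (c := a j)).add ih
      refine (harmonicAt_congr_nhds (Eventually.of_forall fun w => ?_)).mp this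
      simp [Finset.sum_insert hj]
  exact this _

theorem harmonicAt_log_norm_sub {p z : ℂ} (h : z ≠ p) :
    HarmonicAt (fun w => Real.log ‖w - p‖) z :=
  AnalyticAt.harmonicAt_log_norm (f := fun w => w - p) (analyticAt_id.sub analyticAt_const)
    (sub_ne_zero.mpr h)

theorem tendsto_log_norm_sub_sub (p : ℂ) :
    Tendsto (fun z => Real.log ‖z - p‖ - Real.log ‖z‖) (Bornology.cobounded ℂ) (𝓝 0) := by
  have h1 : Tendsto (fun z : ℂ => Real.log ‖1 - p * z⁻¹‖) (Bornology.cobounded ℂ) (𝓝 0) := by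
    have h2 : Tendsto (fun z : ℂ => 1 - p * z⁻¹) (Bornology.cobounded ℂ) (𝓝 1) := by
      simpa using (tendsto_inv₀_cobounded.const_mul p).const_sub (1 : ℂ)
    simpa using h2.norm.log (by simp)
  refine h1.congr' ?_
  filter_upwards [tendsto_norm_cobounded_atTop.eventually_gt_atTop ‖p‖] with z hz
  have hz0 : z ≠ 0 := norm_pos_iff.mp ((norm_nonneg p).trans_lt hz)
  have hzp : z - p ≠ 0 := sub_ne_zero.mpr fun h => by simp [h] at hz
  rw [← Real.log_div (norm_ne_zero_iff.mpr hzp) (norm_ne_zero_iff.mpr hz0), ← norm_div]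
  congr 2
  field_simp

/-- The regularised potential is entire, harmonic and of logarithmic growth, hence constant; the two
identities are this constancy read in the coordinates of f and g. -/
theorem IsStationaryJordan.exists_const {m : ℕ} {a : Fin m → ℝ} {γ : ℝ → ℂ} {f g : ℂ → ℂ}
    {x : Fin m → ℂ}
    (hγ : IsStationaryJordan γ
      (∑ j, Finsupp.single (f (x j) : OnePoint ℂ) (a j)) (Finsupp.single OnePoint.infty 1))
    (hf : IsInnerConformal γ f) (hg : IsOuterConformal γ g)
    (hx : ∀ j, x j ∈ Metric.ball (0 : ℂ) 1) :
    ∑ j, a j = 1 ∧ ∃ c : ℝ,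
      (∀ w ∈ Metric.ball (0 : ℂ) 1, (∀ j, w ≠ x j) →
        ∑ j, a j * Real.log ‖f w - f (x j)‖ = c + ∑ j, a j * Real.log ‖blaschke (x j) w‖) ∧
      ∀ w, 1 < ‖w‖ → ∑ j, a j * Real.log ‖g w - f (x j)‖ = c + Real.log ‖w‖ := by
  classical
  have hi := hf.isOpen
  have ho := hg.isOpen
  have hmem : ∀ j, f (x j) ∈ inner γ := fun j => hf.2.mapsTo (hx j)
  have hG := fun j => hf.greenFunction_spec (hx j)
  have hGo := hg.greenFunction_spec
  choose H hH hHe using fun j => (((hG j).1.1.1 _ rfl).1)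
  set Gi : Fin m → ℂ → ℝ := fun j => greenFunction (inner γ) (f (x j) : OnePoint ℂ) with hGi
  set Go : ℂ → ℝ := greenFunction (outer γ) OnePoint.infty with hGodef
  set P : ℂ → ℝ := fun w => ∑ j, a j * Real.log ‖w - f (x j)‖ with hP
  -- H₀ - P is the potential inside, minus the Green's function outside, and 0 on the curve. Inside,
  -- H₀ is written through the regular parts, so it is harmonic at the poles too.
  set H₀ : ℂ → ℝ := fun w => if w ∈ inner γ then ∑ j, a j * H j w else
    if w ∈ outer γ then P w - Go w else P w with hH₀
  have hio : ∀ w ∈ outer γ, w ∉ inner γ := fun w h1 h2 => h1.2 h2.2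
  have hPh : ∀ w, (∀ j, w ≠ f (x j)) → HarmonicAt P w := fun w hw =>
    harmonicAt_sum_mul a fun j => harmonicAt_log_norm_sub (hw j)
  have hH₀i : ∀ w ∈ inner γ, H₀ w = ∑ j, a j * H j w := fun w hw => if_pos hw
  have hH₀o : ∀ w ∈ outer γ, H₀ w = P w - Go w := fun w hw => by
    simp only [hH₀]; rw [if_neg (hio w hw), if_pos hw]
  have hH₀r : ∀ t, H₀ (γ t) = P (γ t) := fun t => by
    simp only [hH₀]
    rw [if_neg fun h => h.1 ⟨t, rfl⟩, if_neg fun h => h.1 ⟨t, rfl⟩]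
  have hHi : ∀ w ∈ inner γ, HarmonicAt H₀ w := fun w hw =>
    (harmonicAt_congr_nhds (by filter_upwards [hi.mem_nhds hw] with y hy using hH₀i y hy)).mpr
      (harmonicAt_sum_mul a fun j => hH j w hw)
  have hHo : ∀ w ∈ outer γ, HarmonicAt H₀ w := fun w hw =>
    (harmonicAt_congr_nhds (by filter_upwards [ho.mem_nhds hw] with y hy using hH₀o y hy)).mpr
      ((hPh w fun j h => hio w hw (h ▸ hmem j)).sub (hGo.1.1.2 rfl |>.1 w hw))
  have hne : ∀ t j, γ t ≠ f (x j) := fun t j h => (hmem j).1 ⟨t, h⟩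
  have hne_ev : ∀ t, ∀ᶠ z in 𝓝 (γ t), ∀ j, z ≠ f (x j) := fun t =>
    eventually_all.mpr fun j => isOpen_ne.mem_nhds (hne t j)
  have hui : ∀ w ∈ inner γ, (∀ j, w ≠ f (x j)) → H₀ w - P w = ∑ j, a j * Gi j w := by
    intro w hw hwne
    rw [hH₀i w hw, hP, ← Finset.sum_sub_distrib]
    refine Finset.sum_congr rfl fun j _ => ?_
    simp only [hGi]
    rw [hHe j w hw (hwne j), Real.log_inv]
    ring
  have huo : ∀ w ∈ outer γ, H₀ w - P w = -Go w := fun w hw => by rw [hH₀o w hw]; ring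
  have hu0 : ∀ t, H₀ (γ t) - P (γ t) = 0 ∧ ContinuousAt (fun w => H₀ w - P w) (γ t) := by
    intro t
    refine ⟨by rw [hH₀r, sub_self], ?_⟩
    have huniv : (univ : Set ℂ) = (inner γ ∪ outer γ) ∪ range γ := by
      rw [inner_union_outer, compl_union_self]
    rw [ContinuousAt, hH₀r, sub_self, ← nhdsWithin_univ, huniv, nhdsWithin_union,
      nhdsWithin_union]
    refine (Tendsto.sup ?_ ?_).sup ?_
    · have h1 : Tendsto (fun w => ∑ j, a j * Gi j w) (𝓝[inner γ] γ t) (𝓝 (∑ j, a j * 0)) :=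
        tendsto_finsetSum _ fun j _ =>
          ((hG j).1.tendsto_of_notMem hi fun h => h.1 ⟨t, rfl⟩).const_mul (a j)
      simp only [mul_zero, Finset.sum_const_zero] at h1
      refine h1.congr' ?_
      filter_upwards [self_mem_nhdsWithin, nhdsWithin_le_nhds (hne_ev t)] with w hw hw'
        using (hui w hw hw').symm
    · have h1 := (hGo.1.tendsto_of_notMem ho (p := γ t) fun h => h.1 ⟨t, rfl⟩).neg
      rw [neg_zero] at h1
      refine h1.congr' ?_
      filter_upwards [self_mem_nhdsWithin] with w hw using (huo w hw).symm
    · refine tendsto_const_nhds.congr' ?_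
      filter_upwards [self_mem_nhdsWithin] with w hw
      obtain ⟨s, rfl⟩ := hw
      rw [hH₀r, sub_self]
  have hv : ∀ t, IsRegularParam γ t → ∃ v,
      HasNontangentialGradient (inner γ) (fun w => H₀ w - P w) (γ t) v ∧
      HasNontangentialGradient (outer γ) (fun w => H₀ w - P w) (γ t) v := by
    intro t ht
    obtain ⟨v, v', h1, h2, h3⟩ := hγ.velocity t ht
    -- Zero velocity means that the potential inside and minus the Green's function outside have the
    -- same boundary gradient.
    have h4 : v = -v' := by linear_combination -h3
    refine ⟨v, h1.congr hi ?_, h4 ▸ h2.neg.congr ho (Eventually.of_forall fun z hz => ?_)⟩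
    · filter_upwards [hne_ev t] with z hz hzi
      rw [greenPotential_sum_single, hui z hzi hz]
    · rw [greenPotential_single, huo z hz]
  have hcover : ∀ z ∉ range γ, HarmonicAt H₀ z := by
    intro z hz
    rcases (inner_union_outer γ).symm ▸ (show z ∈ (range γ)ᶜ from hz) with h | h
    · exact hHi z h
    · exact hHo z h
  obtain ⟨C, hC, hCreg⟩ := hγ.curve.exists_finite_corners
  have hoff : ∀ z ∉ C, HarmonicAt H₀ z := by
    intro z hz
    by_cases hr : z ∈ range γ
    · obtain ⟨t, rfl⟩ := hr
      have h1 := harmonicAt_of_isRegularParam hγ.curve hf hg (hCreg t hz)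
        (u := fun w => H₀ w - P w) ?_ hu0 hv
      · refine (harmonicAt_congr_nhds (Eventually.of_forall fun w => ?_)).mp
          (h1.add (hPh _ (hne t)))
        simp
      · filter_upwards [hne_ev t] with w hw hwr using (hcover w hwr).sub (hPh w hw)
    · exact hcover z hr
  have hall : ∀ z, HarmonicAt H₀ z := by
    intro z
    by_cases hr : z ∈ range γ
    · obtain ⟨t, rfl⟩ := hr
      refine harmonicAt_of_continuousAt ?_ ?_
      · have h1 : (C \ {γ t})ᶜ ∈ 𝓝 (γ t) :=
          (hC.subset sdiff_subset).isClosed.isOpen_compl.mem_nhds (by simp)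
        filter_upwards [nhdsWithin_le_nhds h1, self_mem_nhdsWithin] with w hw hwt
        exact hoff w fun hwC => hw ⟨hwC, hwt⟩
      · have := (hu0 t).2.add (hPh _ (hne t)).1.continuousAt
        exact this.congr (Eventually.of_forall fun w => by simp)
    · exact hcover z hr
  obtain ⟨hev, -⟩ := hg.tendsto_leftInverse (k := Function.invFunOn g {z : ℂ | 1 < ‖z‖})
    fun w hw => hg.2.1.injOn.leftInvOn_invFunOn hw
  obtain ⟨c₁, hc₁⟩ := (hGo.1.1.2 rfl).2
  -- P grows like Σ a_j log|z| and the outer Green's function like log|z|.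
  have hlim : Tendsto (fun z => H₀ z - (∑ j, a j - 1) * Real.log ‖z‖) (Bornology.cobounded ℂ)
      (𝓝 (-c₁)) := by
    have h1 : Tendsto (fun z => ∑ j, a j * (Real.log ‖z - f (x j)‖ - Real.log ‖z‖))
        (Bornology.cobounded ℂ) (𝓝 (∑ j, a j * 0)) :=
      tendsto_finsetSum _ fun j _ => (tendsto_log_norm_sub_sub _).const_mul (a j)
    have h2 : Bornology.cobounded ℂ ⊓ 𝓟 (outer γ) = Bornology.cobounded ℂ :=
      inf_eq_left.mpr (le_principal_iff.mpr hev)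
    rw [h2] at hc₁
    have h3 := h1.sub hc₁
    simp only [mul_zero, Finset.sum_const_zero, zero_sub] at h3
    refine h3.congr' ?_
    filter_upwards [hev] with z hz
    rw [hH₀o z hz, hP]
    simp only [mul_sub, Finset.sum_sub_distrib, ← Finset.sum_mul]
    ring
  have hbd : ∀ᶠ z in Bornology.cobounded ℂ,
      |H₀ z - (∑ j, a j - 1) * Real.log ‖z‖| ≤ |(-c₁)| + 1 :=
    hlim.abs.eventually_le_const (by linarith)
  obtain ⟨hA, c, hc⟩ := exists_eq_const_of_log_growth hall hbd
  refine ⟨by linarith, c, fun w hw hwx => ?_, fun w hw => ?_⟩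
  · have hwi := hf.2.mapsTo hw
    have hwne : ∀ j, f w ≠ f (x j) := fun j h => hwx j (hf.2.injOn hw (hx j) h)
    have h1 := hui (f w) hwi hwne
    rw [hc, hP] at h1
    have h2 : ∑ j, a j * Gi j (f w) = -∑ j, a j * Real.log ‖blaschke (x j) w‖ := by
      rw [← Finset.sum_neg_distrib]
      refine Finset.sum_congr rfl fun j _ => ?_
      simp only [hGi]
      rw [(hG j).2 w hw (hwx j)]
      ring
    rw [h2] at h1
    linarith
  · have h1 := huo (g w) (hg.2.1.mapsTo hw)
    rw [hc, hGo.2 w hw, hP] at h1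
    linarith

/-! ### Boundary behaviour of the conformal maps -/

/-- Near the point `ζ` of the unit circle, the multivalued function `∏ ((F - z_j) / B_j) ^ a_j`
on the unit disc has constant modulus, where the `B_j` are holomorphic without zeros across the
circle. -/
structure BoundaryRelation {m : ℕ} (a : Fin m → ℝ) (z : Fin m → ℂ) (B : Fin m → ℂ → ℂ)
    (F : ℂ → ℂ) (ζ : ℂ) (c δ : ℝ) : Prop where
  pos : ∀ j, 0 < a j
  sum_eq : ∑ j, a j = 1
  norm_eq : ‖ζ‖ = 1
  δ_pos : 0 < δ
  diff : DifferentiableOn ℂ F (Metric.ball 0 1 ∩ Metric.ball ζ δ)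
  diffB : ∀ j, DifferentiableOn ℂ (B j) (Metric.ball ζ δ)
  neB : ∀ j, ∀ w ∈ Metric.ball ζ δ, B j w ≠ 0
  ne : ∀ w ∈ Metric.ball 0 1 ∩ Metric.ball ζ δ, ∀ j, F w ≠ z j
  log_eq : ∀ w ∈ Metric.ball 0 1 ∩ Metric.ball ζ δ,
    ∑ j, a j * Real.log ‖F w - z j‖ = c + ∑ j, a j * Real.log ‖B j w‖

theorem hasDerivAt_log_div {F B : ℂ → ℂ} {F' B' w z κ : ℂ} (hF : HasDerivAt F F' w)
    (hB : HasDerivAt B B' w) (hFz : F w ≠ z) (hB0 : B w ≠ 0) (hκ : κ ≠ 0)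
    (hs : (F w - z) / B w / κ ∈ Complex.slitPlane) :
    HasDerivAt (fun w => Complex.log ((F w - z) / B w / κ)) (F' / (F w - z) - B' / B w) w := by
  have h1 := (((hF.sub_const z).fun_div hB hB0).div_const κ).clog hs
  refine h1.congr_deriv ?_
  have := sub_ne_zero.mpr hFz
  field_simp

namespace BoundaryRelation

variable {m : ℕ} {a : Fin m → ℝ} {z : Fin m → ℂ} {B : Fin m → ℂ → ℂ} {F : ℂ → ℂ} {ζ : ℂ} {c δ : ℝ}

theorem isOpen_domain : IsOpen (Metric.ball (0 : ℂ) 1 ∩ Metric.ball ζ δ) :=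
  Metric.isOpen_ball.inter Metric.isOpen_ball

/-- Each factor is divided by its value at w, so principal logarithms are holomorphic near w; their
weighted sum has constant real part and hence zero derivative. -/
theorem sum_deriv_eq_zero (h : BoundaryRelation a z B F ζ c δ) {w : ℂ}
    (hw : w ∈ Metric.ball 0 1 ∩ Metric.ball ζ δ) :
    ∑ j, (a j : ℂ) * (deriv F w / (F w - z j) - deriv (B j) w / B j w) = 0 := by
  set κ : Fin m → ℂ := fun j => (F w - z j) / B j w with hκ
  have hκ0 : ∀ j, κ j ≠ 0 := fun j => div_ne_zero (sub_ne_zero.mpr (h.ne w hw j)) (h.neB j w hw.2)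
  have hd : HasDerivAt
      (fun y => ∑ j, (a j : ℂ) * Complex.log ((F y - z j) / B j y / κ j))
      (∑ j, (a j : ℂ) * (deriv F w / (F w - z j) - deriv (B j) w / B j w)) w := by
    refine HasDerivAt.fun_sum fun j _ => HasDerivAt.const_mul _ ?_
    refine hasDerivAt_log_div
      (h.diff.differentiableAt (isOpen_domain.mem_nhds hw)).hasDerivAt
      ((h.diffB j).differentiableAt (Metric.isOpen_ball.mem_nhds hw.2)).hasDerivAt
      (h.ne w hw j) (h.neB j w hw.2) (hκ0 j) ?_
    rw [show (F w - z j) / B j w / κ j = 1 from div_self (hκ0 j)]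
    exact Complex.one_mem_slitPlane
  have h1 : dz (fun _ : ℂ => c - ∑ j, a j * Real.log ‖κ j‖) w
      = ∑ j, (a j : ℂ) * (deriv F w / (F w - z j) - deriv (B j) w / B j w) := by
    refine dz_of_eventuallyEq_re hd ?_
    filter_upwards [isOpen_domain.mem_nhds hw] with y hy
    have e : ∀ j, ((a j : ℂ) * Complex.log ((F y - z j) / B j y / κ j)).re
        = a j * Real.log ‖F y - z j‖ - a j * Real.log ‖B j y‖ - a j * Real.log ‖κ j‖ := by
      intro j
      rw [Complex.re_ofReal_mul, Complex.log_re, norm_div, norm_div, Real.log_div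
        (div_ne_zero (norm_ne_zero_iff.mpr (sub_ne_zero.mpr (h.ne y hy j)))
          (norm_ne_zero_iff.mpr (h.neB j y hy.2))) (norm_ne_zero_iff.mpr (hκ0 j)),
        Real.log_div (norm_ne_zero_iff.mpr (sub_ne_zero.mpr (h.ne y hy j)))
          (norm_ne_zero_iff.mpr (h.neB j y hy.2))]
      ring
    rw [Complex.re_sum, Finset.sum_congr rfl fun j _ => e j, Finset.sum_sub_distrib,
      Finset.sum_sub_distrib, h.log_eq y hy]
    ring
  rw [← h1]
  simp [dz]

/-- Near ζ the sum Σ a_j log|F - z_j| is bounded. Since Σ a_j = 1 it tends to +∞ as F → ∞; and for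
bounded F the other terms are bounded above, so F cannot approach any z_j either. -/
theorem exists_compact (h : BoundaryRelation a z B F ζ c δ) :
    ∃ K : Set ℂ, IsCompact K ∧ (∀ p ∈ K, ∀ j, p ≠ z j) ∧
      ∀ᶠ w in 𝓝[Metric.ball 0 1] ζ, F w ∈ K := by
  have hζδ : ζ ∈ Metric.ball ζ δ := Metric.mem_ball_self h.δ_pos
  set b : ℂ → ℝ := fun w => c + ∑ j, a j * Real.log ‖B j w‖ with hb
  have hbc : ContinuousAt b ζ := by
    refine continuousAt_const.add (tendsto_finsetSum _ fun j _ => Tendsto.const_mul _ ?_)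
    exact (((h.diffB j).differentiableAt
      (Metric.isOpen_ball.mem_nhds hζδ)).continuousAt.norm).log
      (norm_ne_zero_iff.mpr (h.neB j ζ hζδ))
  set M := |b ζ| + 1 with hM
  have hbM : ∀ᶠ w in 𝓝 ζ, |b w| ≤ M := hbc.abs.eventually_le_const (by linarith)
  have hgrow : Tendsto (fun p : ℂ => ∑ j, a j * Real.log ‖p - z j‖) (Bornology.cobounded ℂ)
      atTop := by
    have h1 : Tendsto (fun p => ∑ j, a j * (Real.log ‖p - z j‖ - Real.log ‖p‖))
        (Bornology.cobounded ℂ) (𝓝 (∑ j, a j * 0)) :=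
      tendsto_finsetSum _ fun j _ => (tendsto_log_norm_sub_sub _).const_mul (a j)
    refine (h1.add_atTop tendsto_log_norm_cobounded).congr fun p => ?_
    simp only [mul_sub, Finset.sum_sub_distrib, ← Finset.sum_mul, h.sum_eq]
    ring
  obtain ⟨R, -, hR⟩ := (hasBasis_cobounded_norm (E := ℂ)).eventually_iff.mp
    (hgrow.eventually_gt_atTop M)
  set N := |R| + ∑ j, ‖z j‖ + 1 with hN
  have hS : 0 ≤ ∑ j, ‖z j‖ := Finset.sum_nonneg fun j _ => norm_nonneg _
  have hN1 : 1 ≤ N := by have := abs_nonneg R; linarith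
  have hNlog : 0 ≤ Real.log N := Real.log_nonneg hN1
  refine ⟨Metric.closedBall 0 |R| ∩ ⋂ j, {p | Real.exp (-(M + Real.log N) / a j) ≤ ‖p - z j‖},
    ?_, ?_, ?_⟩
  · refine (isCompact_closedBall _ _).inter_right (isClosed_iInter fun j => ?_)
    exact isClosed_le continuous_const (by fun_prop)
  · rintro p ⟨-, hp⟩ j rfl
    have := mem_iInter.mp hp j
    simp only [mem_ofPred_eq, sub_self, norm_zero] at this
    exact absurd (Real.exp_pos _) (not_lt.mpr this)
  · filter_upwards [self_mem_nhdsWithin, nhdsWithin_le_nhds hbM,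
      nhdsWithin_le_nhds (Metric.isOpen_ball.mem_nhds hζδ)] with w hw hwM hwδ
    have hlog := h.log_eq w ⟨hw, hwδ⟩
    have hwb : |∑ j, a j * Real.log ‖F w - z j‖| ≤ M := by rw [hlog]; exact hwM
    have hFR : ‖F w‖ ≤ |R| := by
      by_contra! hlt
      have h1 : M < _ := hR (show R ≤ ‖F w‖ from (le_abs_self R).trans hlt.le)
      linarith [le_abs_self (∑ j, a j * Real.log ‖F w - z j‖)]
    refine ⟨by simpa using hFR, mem_iInter.mpr fun j => ?_⟩
    have hpos : ∀ k, 0 < ‖F w - z k‖ := fun k =>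
      norm_pos_iff.mpr (sub_ne_zero.mpr (h.ne w ⟨hw, hwδ⟩ k))
    have hle : ∀ k, Real.log ‖F w - z k‖ ≤ Real.log N := by
      intro k
      refine Real.log_le_log (hpos k) ?_
      have h1 := norm_sub_le (F w) (z k)
      have h2 := Finset.single_le_sum (f := fun j => ‖z j‖) (fun j _ => norm_nonneg _)
        (Finset.mem_univ k)
      linarith
    have h2 : ∑ k, a k * Real.log ‖F w - z k‖
        ≤ a j * Real.log ‖F w - z j‖ + Real.log N := by
      rw [← Finset.add_sum_erase _ _ (Finset.mem_univ j)]
      have h3 : ∑ k ∈ Finset.univ.erase j, a k * Real.log ‖F w - z k‖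
          ≤ ∑ k ∈ Finset.univ.erase j, a k * Real.log N :=
        Finset.sum_le_sum fun k _ => mul_le_mul_of_nonneg_left (hle k) (h.pos k).le
      have h4 : ∑ k ∈ Finset.univ.erase j, a k * Real.log N ≤ ∑ k, a k * Real.log N :=
        Finset.sum_le_sum_of_subset_of_nonneg (Finset.erase_subset _ _)
          fun k _ _ => mul_nonneg (h.pos k).le hNlog
      have h5 : ∑ k, a k * Real.log N = Real.log N := by
        rw [← Finset.sum_mul, h.sum_eq, one_mul]
      rw [h5] at h4
      linarith
    show Real.exp _ ≤ ‖F w - z j‖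
    rw [← Real.le_log_iff_exp_le (hpos j), div_le_iff₀ (h.pos j)]
    have := (abs_le.mp hwb).1
    linarith

end BoundaryRelation

/-- Clearing denominators gives a polynomial whose coefficient of degree m - 1 is Σ a_j = 1, so it
is not zero. -/
theorem finite_zeros_sum_div {m : ℕ} {a : Fin m → ℝ} (ha : ∑ j, a j = 1) (z : Fin m → ℂ) :
    {p : ℂ | (∀ j, p ≠ z j) ∧ ∑ j, (a j : ℂ) / (p - z j) = 0}.Finite := by
  classical
  set q : Fin m → Polynomial ℂ := fun j =>
    ∏ k ∈ Finset.univ.erase j, (Polynomial.X - Polynomial.C (z k)) with hq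
  set Q : Polynomial ℂ := ∑ j, Polynomial.C (a j : ℂ) * q j with hQ
  have hcoeff : ∀ j, (q j).coeff (m - 1) = 1 := by
    intro j
    have h1 : (q j).natDegree = m - 1 := by
      rw [hq]
      simp only [Polynomial.natDegree_finsetProd_X_sub_C_eq_card]
      rw [Finset.card_erase_of_mem (Finset.mem_univ j), Finset.card_univ, Fintype.card_fin]
    rw [← h1]
    exact Polynomial.monic_prod_X_sub_C z _
  have hQ0 : Q ≠ 0 := by
    intro h
    have h1 : Q.coeff (m - 1) = 1 := by
      rw [hQ, Polynomial.finsetSum_coeff]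
      simp only [Polynomial.coeff_C_mul, hcoeff, mul_one]
      exact_mod_cast ha
    rw [h] at h1
    simp at h1
  refine (Polynomial.finite_setOfPred_isRoot hQ0).subset ?_
  rintro p ⟨hp, h0⟩
  show Q.eval p = 0
  have h1 : ∀ j, (a j : ℂ) * (q j).eval p = (a j : ℂ) / (p - z j) * ∏ k, (p - z k) := by
    intro j
    rw [← Finset.mul_prod_erase _ _ (Finset.mem_univ j), hq]
    simp only [Polynomial.eval_prod, Polynomial.eval_sub, Polynomial.eval_X, Polynomial.eval_C]
    have := sub_ne_zero.mpr (hp j)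
    field_simp
  rw [hQ, Polynomial.eval_finsetSum]
  simp only [Polynomial.eval_mul, Polynomial.eval_C]
  rw [Finset.sum_congr rfl fun j _ => h1 j, ← Finset.sum_mul, h0, zero_mul]

/-! ### Boundary limits from a bound on R(F) F' -/

section Limit

variable {F R : ℂ → ℂ} {ζ : ℂ} {C : ℝ}

/-- While F stays near p, |R(F)| is bounded below and so F' is bounded. From a point where F is
within ρ/2 of p, a short segment reaches any other point near ζ before F can leave the ball of
radius ρ. -/
theorem tendsto_of_mapClusterPt {p : ℂ}
    (hd : ∀ᶠ w in 𝓝[Metric.ball 0 1] ζ, DifferentiableAt ℂ F w ∧ ‖R (F w) * deriv F w‖ ≤ C)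
    (hp : MapClusterPt p (𝓝[Metric.ball 0 1] ζ) F) (hR : ContinuousAt R p) (hRp : R p ≠ 0) :
    Tendsto F (𝓝[Metric.ball 0 1] ζ) (𝓝 p) := by
  set η := ‖R p‖ / 2 with hη
  have hη0 : 0 < η := half_pos (norm_pos_iff.mpr hRp)
  have hRη : ∀ᶠ y in 𝓝 p, η ≤ ‖R y‖ :=
    hR.norm.eventually_const_le (by linarith)
  obtain ⟨ρ₀, hρ₀, hρ₀R⟩ := Metric.nhds_basis_closedBall.eventually_iff.mp hRη
  obtain ⟨δ₁, hδ₁, hδ₁F⟩ := Metric.mem_nhdsWithin_iff.mp hd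
  rw [Metric.nhds_basis_closedBall.tendsto_right_iff]
  intro ρ' hρ'
  set ρ := min ρ' ρ₀ with hρ
  have hρ0 : 0 < ρ := lt_min hρ' hρ₀
  -- The extra 1 makes the slope of the comparison function strictly larger than the bound for F'.
  set L := |C| / η + 1 with hL
  have hL0 : 0 < L := by positivity
  set δ₂ := min δ₁ (ρ / (4 * L)) with hδ₂
  have hδ₂0 : 0 < δ₂ := by positivity
  have hLδ : L * (2 * δ₂) ≤ ρ / 2 := by
    have h1 : δ₂ ≤ ρ / (4 * L) := min_le_right _ _
    rw [le_div_iff₀ (by positivity)] at h1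
    linarith
  have hcvx : Convex ℝ (Metric.ball ζ δ₂ ∩ Metric.ball (0 : ℂ) 1) :=
    (convex_ball _ _).inter (convex_ball _ _)
  have hWF : ∀ w ∈ Metric.ball ζ δ₂ ∩ Metric.ball (0 : ℂ) 1,
      DifferentiableAt ℂ F w ∧ ‖R (F w) * deriv F w‖ ≤ C := fun w hw =>
    hδ₁F ⟨Metric.ball_subset_ball (min_le_left _ _) hw.1, hw.2⟩
  have hW : ∀ᶠ w in 𝓝[Metric.ball 0 1] ζ, w ∈ Metric.ball ζ δ₂ ∩ Metric.ball (0 : ℂ) 1 :=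
    Metric.mem_nhdsWithin_iff.mpr ⟨δ₂, hδ₂0, Subset.rfl⟩
  obtain ⟨w₀, hw₀F, hw₀⟩ :=
    ((hp.frequently (Metric.ball_mem_nhds p (half_pos hρ0))).and_eventually hW).exists
  filter_upwards [hW] with w hw
  refine Metric.closedBall_subset_closedBall (min_le_left _ ρ₀) ?_
  have hseg : ∀ t ∈ Icc (0 : ℝ) 1,
      w₀ + t * (w - w₀) ∈ Metric.ball ζ δ₂ ∩ Metric.ball (0 : ℂ) 1 := by
    intro t ht
    have := hcvx.add_smul_sub_mem hw₀ hw ht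
    simpa using this
  have hww : ‖w - w₀‖ ≤ 2 * δ₂ := by
    rw [← dist_eq_norm]
    have h1 := dist_triangle_right w w₀ ζ
    have h2 : dist w ζ < δ₂ := hw.1
    have h3 : dist w₀ ζ < δ₂ := hw₀.1
    linarith
  have hpath : ∀ t ∈ Icc (0 : ℝ) 1, HasDerivAt (fun t : ℝ => F (w₀ + t * (w - w₀)) - p)
      (deriv F (w₀ + t * (w - w₀)) * (w - w₀)) t := by
    intro t ht
    have h1 : HasDerivAt (fun t : ℝ => w₀ + t * (w - w₀)) (w - w₀) t := by
      have := ((hasDerivAt_id t).ofReal_comp.mul_const (w - w₀)).const_add w₀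
      simpa using this
    exact ((hWF _ (hseg t ht)).1.hasDerivAt.comp t h1).sub_const p
  have hmain := image_norm_le_of_norm_deriv_right_lt_deriv_boundary (a := 0) (b := 1)
    (f := fun t : ℝ => F (w₀ + t * (w - w₀)) - p)
    (f' := fun t : ℝ => deriv F (w₀ + t * (w - w₀)) * (w - w₀))
    (B := fun t => ρ / 2 + L * (2 * δ₂) * t) (B' := fun _ => L * (2 * δ₂))
    (fun t ht => (hpath t ht).continuousAt.continuousWithinAt)
    (fun t ht => (hpath t ⟨ht.1, ht.2.le⟩).hasDerivWithinAt) ?_ ?_ ?_ (x := 1) (by simp)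
  · simp only [Complex.ofReal_one, one_mul, add_sub_cancel, mul_one] at hmain
    rw [Metric.mem_closedBall, dist_eq_norm]
    linarith
  · have h1 : dist (F w₀) p < ρ / 2 := hw₀F
    rw [dist_eq_norm] at h1
    simpa using h1.le
  · intro t
    simpa using ((hasDerivAt_id t).const_mul (L * (2 * δ₂))).const_add (ρ / 2)
  · intro t ht hBt
    have h1 := hWF _ (hseg t ⟨ht.1, ht.2.le⟩)
    have h2 : F (w₀ + t * (w - w₀)) ∈ Metric.closedBall p ρ₀ := by
      refine Metric.closedBall_subset_closedBall (min_le_right ρ' _) ?_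
      rw [Metric.mem_closedBall, dist_eq_norm, hBt]
      have : L * (2 * δ₂) * t ≤ L * (2 * δ₂) * 1 :=
        mul_le_mul_of_nonneg_left ht.2.le (by positivity)
      linarith
    have h3 := hρ₀R h2
    have h4 : ‖deriv F (w₀ + t * (w - w₀))‖ ≤ |C| / η := by
      rw [le_div_iff₀ hη0]
      rw [norm_mul] at h1
      have := mul_le_mul_of_nonneg_right h3 (norm_nonneg (deriv F (w₀ + t * (w - w₀))))
      linarith [le_abs_self C, h1.2]
    rw [norm_mul]
    have h5 := mul_le_mul h4 hww (norm_nonneg _) (by positivity)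
    have h6 : |C| / η < L := by linarith
    have := mul_lt_mul_of_pos_right h6 (by positivity : 0 < 2 * δ₂)
    linarith

/-- A holomorphic function on the disc for which
`R(F) F'` is bounded near `ζ` has a limit at `ζ`. -/
theorem exists_tendsto_of_norm_deriv_le {K : Set ℂ} (hζ : ‖ζ‖ = 1) (hK : IsCompact K)
    (hFK : ∀ᶠ w in 𝓝[Metric.ball 0 1] ζ, F w ∈ K)
    (hd : ∀ᶠ w in 𝓝[Metric.ball 0 1] ζ, DifferentiableAt ℂ F w ∧ ‖R (F w) * deriv F w‖ ≤ C)
    (hR : ∀ p ∈ K, ContinuousAt R p) (hZ : {p | p ∈ K ∧ R p = 0}.Finite) :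
    ∃ p ∈ K, Tendsto F (𝓝[Metric.ball 0 1] ζ) (𝓝 p) := by
  have hne : (𝓝[Metric.ball (0 : ℂ) 1] ζ).NeBot := by
    rw [← mem_closure_iff_nhdsWithin_neBot, closure_ball _ one_ne_zero]
    simp [hζ]
  by_cases hex : ∃ p', p' ∈ K ∧ MapClusterPt p' (𝓝[Metric.ball 0 1] ζ) F ∧ R p' ≠ 0
  · obtain ⟨p', hp'K, hp', hRp'⟩ := hex
    exact ⟨p', hp'K, tendsto_of_mapClusterPt hd hp' (hR p' hp'K) hRp'⟩
  push Not at hex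
  obtain ⟨p, hpK, hp⟩ := hK.exists_mapClusterPt (f := 𝓝[Metric.ball 0 1] ζ) (u := F)
    (le_principal_iff.mpr hFK)
  refine ⟨p, hpK, hK.le_nhds_of_unique_clusterPt hFK fun p' hp'K hp' => ?_⟩
  by_contra hpp
  -- Now every cluster value in K is a zero of R. With two of them, p and p', choose a radius r
  -- between 0 and their distance for which no zero in K lies on the circle about p.
  obtain ⟨r, hr, hrZ⟩ := ((Ioo_infinite (dist_pos.mpr hpp)).sdiff
    (hZ.image fun y => dist y p)).nonempty
  -- The disc near ζ is a convex lens, so its image cannot pass from near p to near p' without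
  -- crossing the circle; compactness then gives a forbidden cluster value on it.
  have hfreq : ∃ᶠ w in 𝓝[Metric.ball 0 1] ζ, F w ∈ Metric.sphere p r := by
    intro hnot
    obtain ⟨δ₁, hδ₁, hδ₁F⟩ := Metric.mem_nhdsWithin_iff.mp (hnot.and hd)
    have hW : ∀ᶠ w in 𝓝[Metric.ball 0 1] ζ, w ∈ Metric.ball ζ δ₁ ∩ Metric.ball (0 : ℂ) 1 :=
      Metric.mem_nhdsWithin_iff.mpr ⟨δ₁, hδ₁, Subset.rfl⟩
    obtain ⟨w₁, hw₁F, hw₁⟩ :=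
      ((hp.frequently (Metric.ball_mem_nhds p hr.1)).and_eventually hW).exists
    have hfar : {y | r < dist y p} ∈ 𝓝 p' :=
      (isOpen_lt continuous_const (continuous_id.dist continuous_const)).mem_nhds hr.2
    obtain ⟨w₂, hw₂F, hw₂⟩ :=
      ((MapClusterPt.frequently hp' hfar).and_eventually hW).exists
    have hpre : IsPreconnected (Metric.ball ζ δ₁ ∩ Metric.ball (0 : ℂ) 1) :=
      ((convex_ball _ _).inter (convex_ball _ _)).isPreconnected
    have hcont : ContinuousOn (fun w => dist (F w) p) (Metric.ball ζ δ₁ ∩ Metric.ball (0 : ℂ) 1) :=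
      fun w hw => ContinuousAt.continuousWithinAt
        (Tendsto.dist (hδ₁F hw).2.1.continuousAt tendsto_const_nhds)
    obtain ⟨w, hw, hwr⟩ := hpre.intermediate_value hw₁ hw₂ hcont
      ⟨le_of_lt hw₁F, le_of_lt hw₂F⟩
    exact (hδ₁F hw).1 hwr
  obtain ⟨y, hy, hyc⟩ := (isCompact_sphere p r).exists_mapClusterPt_of_frequently hfreq
  have hyK : y ∈ K := by
    by_contra hyK
    obtain ⟨w, hw, hwK⟩ := ((MapClusterPt.frequently hyc
      (hK.isClosed.isOpen_compl.mem_nhds hyK)).and_eventually hFK).exists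
    exact hw hwK
  exact hrZ ⟨y, ⟨hyK, hex y hyK hyc⟩, hy⟩

end Limit

/-- The vanishing logarithmic derivative says R(F) F' = Σ a_j B_j'/B_j, and the right side is
continuous at ζ. -/
theorem BoundaryRelation.exists_tendsto {m : ℕ} {a : Fin m → ℝ} {z : Fin m → ℂ}
    {B : Fin m → ℂ → ℂ} {F : ℂ → ℂ} {ζ : ℂ} {c δ : ℝ} (h : BoundaryRelation a z B F ζ c δ) :
    ∃ p, (∀ j, p ≠ z j) ∧ Tendsto F (𝓝[Metric.ball 0 1] ζ) (𝓝 p) := by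
  obtain ⟨K, hK, hKz, hFK⟩ := h.exists_compact
  have hζδ : ζ ∈ Metric.ball ζ δ := Metric.mem_ball_self h.δ_pos
  set S : ℂ → ℂ := fun w => ∑ j, (a j : ℂ) * (deriv (B j) w / B j w) with hS
  have hSc : ContinuousAt S ζ := by
    refine tendsto_finsetSum _ fun j _ => Tendsto.const_mul _ ?_
    exact (((h.diffB j).deriv Metric.isOpen_ball).differentiableAt
      (Metric.isOpen_ball.mem_nhds hζδ)).continuousAt.div
      ((h.diffB j).differentiableAt (Metric.isOpen_ball.mem_nhds hζδ)).continuousAt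
      (h.neB j ζ hζδ)
  have hSb : ∀ᶠ w in 𝓝 ζ, ‖S w‖ ≤ ‖S ζ‖ + 1 := hSc.norm.eventually_le_const (by linarith)
  have hd : ∀ᶠ w in 𝓝[Metric.ball 0 1] ζ, DifferentiableAt ℂ F w ∧
      ‖(∑ j, (a j : ℂ) / (F w - z j)) * deriv F w‖ ≤ ‖S ζ‖ + 1 := by
    filter_upwards [self_mem_nhdsWithin, nhdsWithin_le_nhds hSb,
      nhdsWithin_le_nhds (Metric.isOpen_ball.mem_nhds hζδ)] with w hw hwS hwδ
    refine ⟨h.diff.differentiableAt (isOpen_domain.mem_nhds ⟨hw, hwδ⟩), le_of_eq_of_le ?_ hwS⟩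
    have h1 := h.sum_deriv_eq_zero ⟨hw, hwδ⟩
    simp only [mul_sub, Finset.sum_sub_distrib] at h1
    congr 1
    rw [hS, ← sub_eq_zero, ← h1, Finset.sum_mul]
    congr 1
    exact Finset.sum_congr rfl fun j _ => by ring
  obtain ⟨p, hp, hlim⟩ := exists_tendsto_of_norm_deriv_le
    (R := fun p => ∑ j, (a j : ℂ) / (p - z j)) h.norm_eq hK hFK hd
    (fun p hp => tendsto_finsetSum _ fun j _ => continuousAt_const.div
      (continuousAt_id.sub continuousAt_const) (sub_ne_zero.mpr (hKz p hp j)))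
    ((finite_zeros_sum_div h.sum_eq z).subset fun p hp => ⟨hKz p hp.1, hp.2⟩)
  exact ⟨p, hKz p hp, hlim⟩

/-- The boundary values of the branches of `∏ ((F - z_j) / B_j) ^ a_j` are locally constant. -/
theorem BoundaryRelation.sum_log_eq_zero {m : ℕ} {a : Fin m → ℝ} {z : Fin m → ℂ}
    {B : Fin m → ℂ → ℂ} {F F' : ℂ → ℂ} {ζ : ℂ} {c δ : ℝ} (h : BoundaryRelation a z B F ζ c δ)
    (hF' : ∀ w, ‖w‖ = 1 → Tendsto F (𝓝[Metric.ball 0 1] w) (𝓝 (F' w)))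
    (hne : ∀ j, F' ζ ≠ z j) :
    ∀ᶠ w in 𝓝[Metric.sphere 0 1] ζ, ∑ j, (a j : ℂ) *
      Complex.log ((F' w - z j) / B j w / ((F' ζ - z j) / B j ζ)) = 0 := by
  have hζδ : ζ ∈ Metric.ball ζ δ := Metric.mem_ball_self h.δ_pos
  have hNeBot : ∀ w : ℂ, ‖w‖ = 1 → (𝓝[Metric.ball (0 : ℂ) 1] w).NeBot := by
    intro w hw
    rw [← mem_closure_iff_nhdsWithin_neBot, closure_ball _ one_ne_zero]
    simp [hw]
  set κ : Fin m → ℂ := fun j => (F' ζ - z j) / B j ζ with hκ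
  have hκ0 : ∀ j, κ j ≠ 0 := fun j => div_ne_zero (sub_ne_zero.mpr (hne j)) (h.neB j ζ hζδ)
  have hlim : ∀ w ∈ Metric.ball ζ δ, ‖w‖ = 1 → ∀ j,
      Tendsto (fun y => (F y - z j) / B j y / κ j) (𝓝[Metric.ball 0 1] w)
        (𝓝 ((F' w - z j) / B j w / κ j)) := by
    intro w hw hw1 j
    exact (((hF' w hw1).sub_const _).div
      (((h.diffB j).differentiableAt (Metric.isOpen_ball.mem_nhds hw)).continuousAt.mono_left
        nhdsWithin_le_nhds) (h.neB j w hw)).div_const _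
  have hone : ∀ j, (F' ζ - z j) / B j ζ / κ j = 1 := fun j => div_self (hκ0 j)
  have hsub : Metric.closedBall (1 : ℂ) (1 / 2) ⊆ Complex.slitPlane := by
    intro y hy
    refine Complex.mem_slitPlane_of_norm_lt_one (z := y - 1) ?_ |> fun h => by simpa using h
    rw [Metric.mem_closedBall, dist_eq_norm] at hy
    linarith
  have hev : ∀ᶠ y in 𝓝[Metric.ball 0 1] ζ, y ∈ Metric.ball ζ δ ∧
      ∀ j, (F y - z j) / B j y / κ j ∈ Metric.closedBall (1 : ℂ) (1 / 2) := by
    have h0 : ∀ᶠ y in 𝓝[Metric.ball 0 1] ζ, y ∈ Metric.ball ζ δ :=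
      nhdsWithin_le_nhds (Metric.isOpen_ball.mem_nhds hζδ)
    refine h0.and (eventually_all.mpr fun j => ?_)
    have h1 := hlim ζ hζδ h.norm_eq j
    rw [hone] at h1
    exact h1.eventually (Metric.closedBall_mem_nhds 1 (by norm_num))
  obtain ⟨δ', hδ', hW⟩ := Metric.mem_nhdsWithin_iff.mp hev
  have hmem : ∀ w ∈ Metric.ball ζ δ', (Metric.ball ζ δ' ∩ Metric.ball (0 : ℂ) 1) ∈
      𝓝[Metric.ball 0 1] w := fun w hw =>
    inter_mem (nhdsWithin_le_nhds (Metric.isOpen_ball.mem_nhds hw)) self_mem_nhdsWithin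
  -- T has zero derivative on a convex lens and tends to 0 at ζ, so T = 0 there; passing to the
  -- limit at other circle points gives the claim.
  set T : ℂ → ℂ := fun y => ∑ j, (a j : ℂ) * Complex.log ((F y - z j) / B j y / κ j) with hT
  have hTd : ∀ y ∈ Metric.ball ζ δ' ∩ Metric.ball (0 : ℂ) 1, HasDerivAt T 0 y := by
    intro y hy
    have hy' : y ∈ Metric.ball 0 1 ∩ Metric.ball ζ δ := ⟨hy.2, (hW hy).1⟩
    rw [← h.sum_deriv_eq_zero hy']
    refine HasDerivAt.fun_sum fun j _ => HasDerivAt.const_mul _ ?_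
    exact hasDerivAt_log_div
      (h.diff.differentiableAt (isOpen_domain.mem_nhds hy')).hasDerivAt
      ((h.diffB j).differentiableAt (Metric.isOpen_ball.mem_nhds hy'.2)).hasDerivAt
      (h.ne y hy' j) (h.neB j y hy'.2) (hκ0 j) (hsub ((hW hy).2 j))
  have hTlim : ∀ w ∈ Metric.ball ζ δ' ∩ Metric.ball ζ δ, ‖w‖ = 1 →
      Tendsto T (𝓝[Metric.ball 0 1] w)
        (𝓝 (∑ j, (a j : ℂ) * Complex.log ((F' w - z j) / B j w / κ j))) := by
    intro w hw hw1
    refine tendsto_finsetSum _ fun j _ => Tendsto.const_mul _ ?_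
    have := hNeBot w hw1
    refine (hlim w hw.2 hw1 j).clog (hsub ?_)
    refine Metric.isClosed_closedBall.mem_of_tendsto (hlim w hw.2 hw1 j) ?_
    filter_upwards [hmem w hw.1] with y hy using (hW hy).2 j
  have hTconst : ∀ y ∈ Metric.ball ζ δ' ∩ Metric.ball (0 : ℂ) 1, T y = 0 := by
    intro y hy
    have := hNeBot ζ h.norm_eq
    have h1 := hTlim ζ ⟨Metric.mem_ball_self hδ', hζδ⟩ h.norm_eq
    simp only [hone, Complex.log_one, mul_zero, Finset.sum_const_zero] at h1
    refine tendsto_nhds_unique (tendsto_const_nhds.congr' ?_) h1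
    filter_upwards [hmem ζ (Metric.mem_ball_self hδ')] with y' hy'
    exact (Metric.isOpen_ball.inter Metric.isOpen_ball).is_const_of_deriv_eq_zero
      ((convex_ball ζ δ').inter (convex_ball 0 1)).isPreconnected
      (fun y hy => (hTd y hy).differentiableAt.differentiableWithinAt)
      (fun y hy => (hTd y hy).deriv) hy hy'
  filter_upwards [self_mem_nhdsWithin, nhdsWithin_le_nhds (Metric.ball_mem_nhds ζ hδ'),
    nhdsWithin_le_nhds (Metric.isOpen_ball.mem_nhds hζδ)] with w hw hwδ' hwδ
  have hw1 : ‖w‖ = 1 := by simpa using hw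
  have := hNeBot w hw1
  refine tendsto_nhds_unique (hTlim w ⟨hwδ', hwδ⟩ hw1) (tendsto_const_nhds.congr' ?_)
  filter_upwards [hmem w hwδ'] with y hy using (hTconst y hy).symm

/-! ### The conformal welding -/

theorem IsInnerConformal.exists_boundaryRelation {m : ℕ} {a : Fin m → ℝ} {γ : ℝ → ℂ} {f : ℂ → ℂ}
    {x : Fin m → ℂ} {c : ℝ} (hf : IsInnerConformal γ f) (ha : ∀ j, 0 < a j) (hsum : ∑ j, a j = 1)
    (hx : ∀ j, x j ∈ Metric.ball (0 : ℂ) 1)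
    (hc : ∀ w ∈ Metric.ball (0 : ℂ) 1, (∀ j, w ≠ x j) →
      ∑ j, a j * Real.log ‖f w - f (x j)‖ = c + ∑ j, a j * Real.log ‖blaschke (x j) w‖)
    {ζ : ℂ} (hζ : ‖ζ‖ = 1) :
    ∃ δ, BoundaryRelation a (fun j => f (x j)) (fun j => blaschke (x j)) f ζ c δ := by
  have hev : ∀ᶠ w in 𝓝 ζ, ∀ j, w ≠ x j ∧ 1 - (starRingEnd ℂ) (x j) * w ≠ 0 := by
    refine eventually_all.mpr fun j => ?_
    have hxj : ‖x j‖ < 1 := by simpa using hx j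
    refine Filter.Eventually.and (isOpen_ne.mem_nhds ?_) ?_
    · rintro rfl
      exact hxj.ne hζ
    · refine ContinuousAt.eventually_ne ?_ (one_sub_conj_mul_ne_zero hxj hζ.le)
      fun_prop
  obtain ⟨δ, hδ, hball⟩ := Metric.eventually_nhds_iff_ball.mp hev
  exact ⟨δ,
    { pos := ha
      sum_eq := hsum
      norm_eq := hζ
      δ_pos := hδ
      diff := hf.1.mono inter_subset_left
      diffB := fun j w hw => by
        have h1 := (hball w hw j).2
        have : DifferentiableAt ℂ (blaschke (x j)) w := by
          unfold blaschke
          fun_prop (disch := exact h1)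
        exact this.differentiableWithinAt
      neB := fun j w hw => div_ne_zero (sub_ne_zero.mpr (hball w hw j).1) (hball w hw j).2
      ne := fun w hw j h => (hball w hw.2 j).1 (hf.2.injOn hw.1 (hx j) h)
      log_eq := fun w hw => hc w hw.1 fun j => (hball w hw.2 j).1 }⟩

/-- The inversion w ↦ w⁻¹ moves the exterior to the disc. Since Σ a_j = 1, log|w⁻¹| can be shared
out with every B_j equal to w⁻¹. -/
theorem IsOuterConformal.exists_boundaryRelation {m : ℕ} {a : Fin m → ℝ} {γ : ℝ → ℂ} {g : ℂ → ℂ}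
    {z : Fin m → ℂ} {c : ℝ} (hg : IsOuterConformal γ g) (ha : ∀ j, 0 < a j)
    (hsum : ∑ j, a j = 1) (hz : ∀ j, z j ∈ inner γ)
    (hc : ∀ w, 1 < ‖w‖ → ∑ j, a j * Real.log ‖g w - z j‖ = c + Real.log ‖w‖)
    {ζ : ℂ} (hζ : ‖ζ‖ = 1) :
    ∃ δ, BoundaryRelation a z (fun _ w => w⁻¹) (fun w => g w⁻¹) ζ c δ := by
  have hne : ∀ w ∈ Metric.ball ζ 1, w ≠ 0 := by
    rintro w hw rfl
    simp [hζ] at hw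
  have hlt : ∀ w ∈ Metric.ball 0 1 ∩ Metric.ball ζ 1, 1 < ‖w⁻¹‖ := by
    intro w hw
    rw [norm_inv]
    exact (one_lt_inv₀ (norm_pos_iff.mpr (hne w hw.2))).mpr (by simpa using hw.1)
  exact ⟨1,
    { pos := ha
      sum_eq := hsum
      norm_eq := hζ
      δ_pos := one_pos
      diff := fun w hw => ((hg.1.differentiableAt (isOpen_one_lt_norm.mem_nhds (hlt w hw))).comp w
        (differentiableAt_inv (hne w hw.2))).differentiableWithinAt
      diffB := fun j w hw => (differentiableAt_inv (hne w hw)).differentiableWithinAt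
      neB := fun j w hw => inv_ne_zero (hne w hw)
      ne := fun w hw j h => (hg.2.1.mapsTo (hlt w hw)).2 (h ▸ (hz j).2)
      log_eq := fun w hw => by rw [hc _ (hlt w hw), ← Finset.sum_mul, hsum, one_mul] }⟩

theorem continuousOn_sphere_of_tendsto {F F' : ℂ → ℂ}
    (hF' : ∀ w, ‖w‖ = 1 → Tendsto F (𝓝[Metric.ball 0 1] w) (𝓝 (F' w))) :
    ContinuousOn F' (Metric.sphere 0 1) := by
  have hcl : Metric.sphere (0 : ℂ) 1 ⊆ closure (Metric.ball 0 1) := by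
    rw [closure_ball _ one_ne_zero]
    exact Metric.sphere_subset_closedBall
  refine (continuousOn_extendFrom hcl fun w hw => ⟨F' w, hF' w (by simpa using hw)⟩).congr
    fun w hw => (extendFrom_eq (hcl hw) (hF' w (by simpa using hw))).symm

theorem eq_zero_of_exp_eq_one {w : ℂ} (h : Complex.exp w = 1) (hw : ‖w‖ < 1) : w = 0 := by
  obtain ⟨n, rfl⟩ := Complex.exp_eq_one_iff.mp h
  rcases eq_or_ne n 0 with rfl | hn
  · simp
  · have h1 : (1 : ℝ) ≤ |(n : ℝ)| := by exact_mod_cast Int.one_le_abs hn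
    have h2 : ‖(n : ℂ) * (2 * Real.pi * Complex.I)‖ = |(n : ℝ)| * (2 * Real.pi) := by
      simp [abs_of_pos Real.pi_pos]
    rw [h2] at hw
    nlinarith [Real.pi_gt_three]

/-- On the circle the factor is z(1 - x z̄)/(1 - x̄ z); both parenthesised terms stay in the disc of
radius 1 about 1, where the principal logarithm is continuous. -/
theorem exists_isLogBranch {x : ℂ} (hx : ‖x‖ < 1) : ∃ L, IsLogBranch x L := by
  have hs : ∀ y : ℂ, ‖y‖ < 1 → 1 - y ∈ Complex.slitPlane := fun y hy => by
    have := Complex.mem_slitPlane_of_norm_lt_one (z := -y) (by simpa using hy)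
    simpa [← sub_eq_add_neg] using this
  have h1 : ∀ θ : ℝ, ‖x * (Circle.exp (-θ) : ℂ)‖ < 1 := fun θ => by simpa using hx
  have h2 : ∀ θ : ℝ, ‖(starRingEnd ℂ) x * (Circle.exp θ : ℂ)‖ < 1 := fun θ => by simpa using hx
  refine ⟨fun θ => θ * Complex.I + Complex.log (1 - x * (Circle.exp (-θ) : ℂ))
    - Complex.log (1 - (starRingEnd ℂ) x * (Circle.exp θ : ℂ)), ?_, fun θ => ?_⟩
  · refine Continuous.sub (Continuous.add (by fun_prop) ?_) ?_
    · exact Continuous.clog (by fun_prop) fun θ => hs _ (h1 θ)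
    · exact Continuous.clog (by fun_prop) fun θ => hs _ (h2 θ)
  · rw [Complex.exp_sub, Complex.exp_add, Complex.exp_log (Complex.slitPlane_ne_zero (hs _ (h1 θ))),
      Complex.exp_log (Complex.slitPlane_ne_zero (hs _ (h2 θ))), ← Circle.coe_exp, mul_sub, mul_one,
      mul_left_comm, ← Circle.coe_mul, ← Circle.exp_add]
    simp

theorem IsLogBranch.exp_eq_blaschke {x : ℂ} {L : ℝ → ℂ} (h : IsLogBranch x L) (θ : ℝ) :
    Complex.exp (L θ) = blaschke x (Circle.exp θ) := h.2 θ

theorem IsLogBranch.re_eq_zero {x : ℂ} {L : ℝ → ℂ} (hx : ‖x‖ < 1) (h : IsLogBranch x L) (θ : ℝ) :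
    (L θ).re = 0 := by
  have h1 := one_sub_norm_blaschke_sq (w := (Circle.exp θ : ℂ)) hx (by simp)
  rw [← h.exp_eq_blaschke, Complex.norm_exp] at h1
  simp only [Circle.norm_coe, one_pow, sub_self, mul_zero, zero_div] at h1
  have h2 : Real.exp (L θ).re = 1 := by
    have := Real.exp_pos (L θ).re
    nlinarith
  simpa using h2

/-- Two functions on the disc and on the exterior disc with multiplicatively constant branches and
boundary values matched by `H` determine `H` locally. -/
theorem eventually_sum_sub_eq_log {m : ℕ} {a : Fin m → ℝ} {z x : Fin m → ℂ} {F F' G G' : ℂ → ℂ}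
    {c c' : ℝ} {L : Fin m → ℝ → ℂ} {H : ℝ → ℂ}
    (hL : ∀ j, IsLogBranch (x j) (L j)) (hH : Continuous H) (hH1 : ∀ θ, ‖H θ‖ = 1)
    (hsum : ∑ j, a j = 1)
    (hF : ∀ ζ, ‖ζ‖ = 1 → ∃ δ, BoundaryRelation a z (fun j => blaschke (x j)) F ζ c δ)
    (hG : ∀ ζ, ‖ζ‖ = 1 → ∃ δ, BoundaryRelation a z (fun _ w => w⁻¹) G ζ c' δ)
    (hF' : ∀ w, ‖w‖ = 1 → Tendsto F (𝓝[Metric.ball 0 1] w) (𝓝 (F' w)))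
    (hG' : ∀ w, ‖w‖ = 1 → Tendsto G (𝓝[Metric.ball 0 1] w) (𝓝 (G' w)))
    (hne : ∀ w, ‖w‖ = 1 → ∀ j, F' w ≠ z j)
    (hFG : ∀ θ : ℝ, G' (H θ)⁻¹ = F' (Circle.exp θ)) (θ₀ : ℝ) :
    ∀ᶠ θ in 𝓝 θ₀, ∑ j, (a j : ℂ) * (L j θ - L j θ₀) = Complex.log (H θ / H θ₀) := by
  have he : Continuous fun θ : ℝ => (Circle.exp θ : ℂ) := by fun_prop
  have hH0 : ∀ θ, H θ ≠ 0 := fun θ => norm_ne_zero_iff.mp (by rw [hH1]; exact one_ne_zero)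
  have hHinv : Continuous fun θ => (H θ)⁻¹ := hH.inv₀ hH0
  have hHi1 : ∀ θ, ‖(H θ)⁻¹‖ = 1 := fun θ => by rw [norm_inv, hH1, inv_one]
  have he1 : ∀ θ : ℝ, ‖(Circle.exp θ : ℂ)‖ = 1 := fun θ => Circle.norm_coe _
  obtain ⟨δ, hrel⟩ := hF _ (he1 θ₀)
  obtain ⟨δ', hrel'⟩ := hG _ (hHi1 θ₀)
  have hA := (tendsto_nhdsWithin_of_tendsto_nhds_of_eventually_within _ (he.tendsto θ₀)
    (Eventually.of_forall fun θ => by simp)).eventually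
      (hrel.sum_log_eq_zero hF' (hne _ (he1 θ₀)))
  have hB := (tendsto_nhdsWithin_of_tendsto_nhds_of_eventually_within _ (hHinv.tendsto θ₀)
    (Eventually.of_forall fun θ => by simp [hH1 θ])).eventually
      (hrel'.sum_log_eq_zero hG' (by rw [hFG]; exact hne _ (he1 θ₀)))
  simp only [hFG, inv_inv] at hB
  set N : Fin m → ℝ → ℂ := fun j θ => F' (Circle.exp θ) - z j with hN
  set b : Fin m → ℝ → ℂ := fun j θ => blaschke (x j) (Circle.exp θ) with hb
  have hb0 : ∀ j θ, b j θ ≠ 0 := fun j θ => by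
    simp only [hb]
    rw [← (hL j).exp_eq_blaschke]
    exact Complex.exp_ne_zero _
  have hbc : ∀ j, Continuous (b j) := fun j => by
    have : b j = fun θ => Complex.exp (L j θ) := funext fun θ => ((hL j).exp_eq_blaschke θ).symm
    rw [this]
    exact Complex.continuous_exp.comp (hL j).1
  have hN0 : ∀ j θ, N j θ ≠ 0 := fun j θ => sub_ne_zero.mpr (hne _ (he1 θ) j)
  have hNc : ∀ j, Continuous (N j) := fun j =>
    ((continuousOn_sphere_of_tendsto hF').comp_continuous he fun θ => by simp).sub
      continuous_const
  have hratio : ∀ u : ℝ → ℂ, Continuous u → u θ₀ ≠ 0 →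
      Tendsto (fun θ => Complex.log (u θ / u θ₀)) (𝓝 θ₀) (𝓝 0) := by
    intro u hu hu0
    have h1 : Tendsto (fun θ => u θ / u θ₀) (𝓝 θ₀) (𝓝 1) :=
      (hu.div_const _).tendsto' _ _ (div_self hu0)
    have h2 := h1.clog Complex.one_mem_slitPlane
    rwa [Complex.log_one] at h2
  -- The four terms add up to an integer multiple of 2πi. They are continuous at θ₀ and vanish
  -- there, so the multiple is 0 nearby. Summing with weights a_j eliminates the terms containing
  -- N_j.
  have hE : ∀ j, ∀ᶠ θ in 𝓝 θ₀, L j θ - L j θ₀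
      + Complex.log (N j θ / b j θ / (N j θ₀ / b j θ₀))
      - Complex.log (N j θ / H θ / (N j θ₀ / H θ₀)) - Complex.log (H θ / H θ₀) = 0 := by
    intro j
    have h1 := ((((hL j).1.sub continuous_const).tendsto' θ₀ 0 (sub_self _)).add
      (hratio (fun θ => N j θ / b j θ) ((hNc j).div (hbc j) (hb0 j))
        (div_ne_zero (hN0 j _) (hb0 j _)))).sub
      (hratio (fun θ => N j θ / H θ) ((hNc j).div hH hH0) (div_ne_zero (hN0 j _) (hH0 _)))
      |>.sub (hratio H hH (hH0 _))
    simp only [add_zero, sub_zero] at h1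
    have h2 := h1.norm.eventually_lt_const (u := 1) (by simp)
    filter_upwards [h2] with θ hθ
    refine eq_zero_of_exp_eq_one ?_ hθ
    have e1 := hb0 j θ
    have e2 := hb0 j θ₀
    have e3 := hN0 j θ
    have e4 := hN0 j θ₀
    have e5 := hH0 θ
    have e6 := hH0 θ₀
    rw [Complex.exp_sub, Complex.exp_sub, Complex.exp_add, Complex.exp_sub,
      (hL j).exp_eq_blaschke, (hL j).exp_eq_blaschke,
      Complex.exp_log (div_ne_zero (div_ne_zero e3 e1) (div_ne_zero e4 e2)),
      Complex.exp_log (div_ne_zero (div_ne_zero e3 e5) (div_ne_zero e4 e6)),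
      Complex.exp_log (div_ne_zero e5 e6)]
    change b j θ / b j θ₀ * _ / _ / _ = 1
    field_simp
  filter_upwards [hA, hB, eventually_all.mpr hE] with θ hAθ hBθ hEθ
  have h1 : ∑ j, (a j : ℂ) * (L j θ - L j θ₀
      + Complex.log (N j θ / b j θ / (N j θ₀ / b j θ₀))
      - Complex.log (N j θ / H θ / (N j θ₀ / H θ₀)) - Complex.log (H θ / H θ₀)) = 0 :=
    Finset.sum_eq_zero fun j _ => by rw [hEθ j, mul_zero]
  have hsum' : ∑ j, (a j : ℂ) = 1 := by exact_mod_cast hsum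
  have e : ∀ j, (a j : ℂ) * (L j θ - L j θ₀
      + Complex.log (N j θ / b j θ / (N j θ₀ / b j θ₀))
      - Complex.log (N j θ / H θ / (N j θ₀ / H θ₀)) - Complex.log (H θ / H θ₀))
      = (a j : ℂ) * (L j θ - L j θ₀)
      + (a j : ℂ) * Complex.log (N j θ / b j θ / (N j θ₀ / b j θ₀))
      - (a j : ℂ) * Complex.log (N j θ / H θ / (N j θ₀ / H θ₀))
      - (a j : ℂ) * Complex.log (H θ / H θ₀) := fun j => by ring
  rw [Finset.sum_congr rfl fun j _ => e j, Finset.sum_sub_distrib, Finset.sum_sub_distrib,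
    Finset.sum_add_distrib, ← Finset.sum_mul, hsum', hAθ, hBθ] at h1
  linear_combination h1

/-- A multiplicative relation between branches that holds locally up to constants holds globally
with a single constant. -/
theorem eq_mul_prod_exp_of_eventually {m : ℕ} {a : Fin m → ℝ} {L : Fin m → ℝ → ℂ} {H : ℝ → ℂ}
    (hH0 : ∀ θ, H θ ≠ 0) (h : ∀ θ₀, ∀ᶠ θ in 𝓝 θ₀,
      ∑ j, (a j : ℂ) * (L j θ - L j θ₀) = Complex.log (H θ / H θ₀)) (θ : ℝ) :
    H θ = H 0 * Complex.exp (-∑ j, (a j : ℂ) * L j 0) * ∏ j, Complex.exp ((a j : ℂ) * L j θ) := by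
  -- The additive relation near θ₀, exponentiated; connectedness of the line makes the constant
  -- global.
  have hloc : IsLocallyConstant fun θ => H θ * Complex.exp (-∑ j, (a j : ℂ) * L j θ) := by
    rw [IsLocallyConstant.iff_eventually_eq]
    intro θ₀
    filter_upwards [h θ₀] with θ hθ
    have h1 := Complex.exp_log (div_ne_zero (hH0 θ) (hH0 θ₀))
    rw [← hθ, eq_div_iff (hH0 θ₀)] at h1
    rw [← h1, mul_right_comm, ← Complex.exp_add, mul_comm]
    congr 2
    simp only [mul_sub, Finset.sum_sub_distrib]
    ring
  have h1 : H θ * Complex.exp (-∑ j, (a j : ℂ) * L j θ)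
      = H 0 * Complex.exp (-∑ j, (a j : ℂ) * L j 0) := hloc.apply_eq_of_preconnectedSpace θ 0
  rw [← h1, ← Complex.exp_sum, mul_assoc, ← Complex.exp_add, neg_add_cancel, Complex.exp_zero,
    mul_one]

theorem IsStationaryJordan.welding {m : ℕ} {a : Fin m → ℝ} {γ : ℝ → ℂ} {f g : ℂ → ℂ}
    {x : Fin m → ℂ} (ha : ∀ j, 0 < a j)
    (hγ : IsStationaryJordan γ
      (∑ j, Finsupp.single (f (x j) : OnePoint ℂ) (a j)) (Finsupp.single OnePoint.infty 1))
    (hf : IsInnerConformal γ f) (hg : IsOuterConformal γ g) {h : Circle ≃ₜ Circle}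
    (hh : IsWelding f g h) (hx : ∀ j, x j ∈ Metric.ball (0 : ℂ) 1) {L : Fin m → ℝ → ℂ}
    (hL : ∀ j, IsLogBranch (x j) (L j)) :
    ∃ c : ℂ, ‖c‖ = 1 ∧ ∀ θ : ℝ,
      (h (Circle.exp θ) : ℂ) = c * ∏ j, Complex.exp ((a j : ℂ) * L j θ) := by
  obtain ⟨hsum, c, hcf, hcg⟩ := hγ.exists_const hf hg hx
  have hF : ∀ ζ : ℂ, ‖ζ‖ = 1 → ∃ δ,
      BoundaryRelation a (fun j => f (x j)) (fun j => blaschke (x j)) f ζ c δ :=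
    fun ζ hζ => hf.exists_boundaryRelation ha hsum hx hcf hζ
  have hG : ∀ ζ : ℂ, ‖ζ‖ = 1 → ∃ δ,
      BoundaryRelation a (fun j => f (x j)) (fun _ w => w⁻¹) (fun w => g w⁻¹) ζ c δ :=
    fun ζ hζ => hg.exists_boundaryRelation ha hsum (fun j => hf.2.mapsTo (hx j)) hcg hζ
  have hNeBot : ∀ w : ℂ, ‖w‖ = 1 → (𝓝[Metric.ball (0 : ℂ) 1] w).NeBot := by
    intro w hw
    rw [← mem_closure_iff_nhdsWithin_neBot, closure_ball _ one_ne_zero]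
    simp [hw]
  have hF' : ∀ w : ℂ, ‖w‖ = 1 → Tendsto f (𝓝[Metric.ball 0 1] w)
      (𝓝 (extendFrom (Metric.ball 0 1) f w)) := by
    intro w hw
    obtain ⟨δ, hrel⟩ := hF w hw
    obtain ⟨p, -, hp⟩ := hrel.exists_tendsto
    exact tendsto_extendFrom ⟨p, hp⟩
  have hne : ∀ w : ℂ, ‖w‖ = 1 → ∀ j, extendFrom (Metric.ball 0 1) f w ≠ f (x j) := by
    intro w hw j
    obtain ⟨δ, hrel⟩ := hF w hw
    obtain ⟨p, hpz, hp⟩ := hrel.exists_tendsto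
    have := hNeBot w hw
    rw [tendsto_nhds_unique (hF' w hw) hp]
    exact hpz j
  -- Inversion exchanges approach from the exterior at w⁻¹ with approach from the disc at w, so the
  -- extension of g used in the welding gives the boundary values of w ↦ g(w⁻¹).
  have hG' : ∀ w : ℂ, ‖w‖ = 1 → Tendsto (fun w => g w⁻¹) (𝓝[Metric.ball 0 1] w)
      (𝓝 (extendFrom {w : ℂ | 1 < ‖w‖} g w⁻¹)) := by
    intro w hw
    have hw0 : w ≠ 0 := norm_ne_zero_iff.mp (by rw [hw]; exact one_ne_zero)
    obtain ⟨δ, hrel⟩ := hG w hw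
    obtain ⟨p, -, hp⟩ := hrel.exists_tendsto
    have h1 : Tendsto (fun y : ℂ => y⁻¹) (𝓝[{w : ℂ | 1 < ‖w‖}] w⁻¹) (𝓝[Metric.ball 0 1] w) := by
      refine tendsto_nhdsWithin_iff.mpr ⟨?_, ?_⟩
      · have := (continuousAt_inv₀ (inv_ne_zero hw0)).tendsto
        rw [inv_inv] at this
        exact this.mono_left nhdsWithin_le_nhds
      · filter_upwards [self_mem_nhdsWithin] with y hy
        rw [mem_ball_zero_iff, norm_inv]
        exact inv_lt_one_of_one_lt₀ hy
    have h2 : Tendsto g (𝓝[{w : ℂ | 1 < ‖w‖}] w⁻¹) (𝓝 p) :=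
      (hp.comp h1).congr fun y => by simp
    refine (tendsto_extendFrom ⟨p, h2⟩).comp (tendsto_nhdsWithin_iff.mpr ⟨?_, ?_⟩)
    · exact (continuousAt_inv₀ hw0).tendsto.mono_left nhdsWithin_le_nhds
    · filter_upwards [self_mem_nhdsWithin, nhdsWithin_le_nhds (isOpen_ne.mem_nhds hw0)]
        with y hy hy0
      rw [mem_ball_zero_iff] at hy
      show 1 < ‖y⁻¹‖
      rw [norm_inv]
      exact (one_lt_inv₀ (norm_pos_iff.mpr hy0)).mpr hy
  have hH : Continuous fun θ : ℝ => (h (Circle.exp θ) : ℂ) := by fun_prop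
  have hkey := eventually_sum_sub_eq_log (H := fun θ : ℝ => (h (Circle.exp θ) : ℂ)) hL hH
    (fun θ => Circle.norm_coe _) hsum hF hG hF' hG' hne
    fun θ => by rw [inv_inv, hh (Circle.exp θ)]
  refine ⟨_, ?_, eq_mul_prod_exp_of_eventually (fun θ => Circle.coe_ne_zero _) hkey⟩
  -- Blaschke factors are unimodular on the circle, so the branches are imaginary there and the
  -- constant has modulus 1.
  have hre : (-∑ j, (a j : ℂ) * L j 0).re = 0 := by
    rw [Complex.neg_re, Complex.re_sum, neg_eq_zero]
    refine Finset.sum_eq_zero fun j _ => ?_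
    rw [Complex.re_ofReal_mul, (hL j).re_eq_zero (by simpa using hx j), mul_zero]
  rw [norm_mul, Circle.norm_coe, Complex.norm_exp, hre, Real.exp_zero, one_mul]

end HeleShaw
theorem mainTheorem8 {m : ℕ} (a : Fin m → ℝ) (ha : ∀ j, 0 < a j) (z : Fin m → ℂ)
    (γ : ℝ → ℂ)
    (hγ : HeleShaw.IsStationaryJordan γ
      (∑ j, Finsupp.single (z j : OnePoint ℂ) (a j)) (Finsupp.single OnePoint.infty 1))
    (f g : ℂ → ℂ) (hf : HeleShaw.IsInnerConformal γ f) (hg : HeleShaw.IsOuterConformal γ g)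
    (h : Circle ≃ₜ Circle) (hh : HeleShaw.IsWelding f g h)
    (x : Fin m → ℂ) (hx : ∀ j, x j ∈ Metric.ball (0 : ℂ) 1 ∧ f (x j) = z j) :
    (∃ L : Fin m → ℝ → ℂ, ∀ j, HeleShaw.IsLogBranch (x j) (L j)) ∧
    ∀ L : Fin m → ℝ → ℂ, (∀ j, HeleShaw.IsLogBranch (x j) (L j)) →
      ∃ c : ℂ, ‖c‖ = 1 ∧ ∀ θ : ℝ,
        (h (Circle.exp θ) : ℂ) = c * ∏ j, Complex.exp ((a j : ℂ) * L j θ) := by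
  obtain rfl : z = fun j => f (x j) := funext fun j => (hx j).2.symm
  have hx' := fun j => (hx j).1
  refine ⟨?_, fun L hL => hγ.welding ha hf hg hh hx' hL⟩
  choose L hL using fun j => HeleShaw.exists_isLogBranch (x := x j) (by simpa using hx' j)
  exact ⟨L, hL⟩
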